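/- **Setting.** An *extended metric* on a set $X$ is a metric $d$ for which at most one infinitely remote point $\omega\in X$ is allowed: $d(x,\omega)=\infty$ for $x\ne\omega$, $d(\omega,\omega)=0$, all other distances being finite. A quadruple $(x,y,z,u)$ in $X$ is *admissible* if no entry occurs three or four times; its cross-ratio triple is $(d(x,y)d(z,u):d(x,z)d(y,u):d(x,u)d(y,z))\in\mathbb RP^2$, where infinite factors are cancelled (so $(d(x,y):d(x,z):d(y,z))$ if only $u$ is infinitely remote, and $(0:1:1)$ if $z=u$ is infinitely remote). Metrics with the same cross-ratio triples on admissible quadruples are *Möbius equivalent*. A *Möbius space* is a set with a Möbius equivalence class of extended metrics; its topology is generated by the open balls, and the complements of the closed balls, around points that are not infinitely remote. A *Möbius map* is an injective map preserving cross-ratio triples of admissible quadruples; a bijective one is a *Möbius equivalence*. $X$ is a *Ptolemy space* if the entries of every cross-ratio triple satisfy the triangle inequality. The space $\widehat{\mathbb R}^n=\mathbb R^n\cup\{\infty\}$ carries the Möbius structure of the extended Euclidean metric. A *Ptolemy circle* is a subset $\sigma\subset X$ homeomorphic to $S^1$ such that $d(x,z)d(y,u)=d(x,y)d(z,u)+d(x,u)d(y,z)$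 for all distinct $x,y,z,u\in\sigma$ such that $\{x,z\}$ separates $y$ from $u$ in $\sigma$ (infinite factors being cancelled). A *sphere between* distinct $\omega,\omega'$ is an equivalence class in $X\setminus\{\omega,\omega'\}$ of the relation that the cross-ratio triple of $(\omega,x,y,\omega')$ is of the form $(1:1:*)$. A *space inversion* with respect to $\omega,\omega'$ and a sphere $S$ between them is a fixed point free Möbius involution $\varphi:X\to X$ with $\varphi(\omega)=\omega'$, $\varphi(S)=S$, and $\varphi(\sigma)=\sigma$ for each Ptolemy circle $\sigma$ through $\omega,\omega'$. Let $X$ be a compact Ptolemy space such that (E) $X$ contains a Ptolemy circle, and (I) for all distinct $\omega,\omega'\in X$ and every sphere $S$ between them there is a unique space inversion with respect to $\omega,\omega',S$. For $\omega\in X$ put $X_\omega=X\setminus\{\omega\}$, with a metric $d$ of the Möbius structure for which $\omega$ is infinitely remote ($d$ is unique up to a factor). A *Ptolemy line* in $X_\omega$ is $\sigma\setminus\{\omega\}$ for a Ptolemy circle $\sigma\ni\omega$; its *Busemann functions* are $b(x)=\lim_{t\to\infty}\bigl(d(x,c(t))-d(c(0),c(t))\bigr)$, where $c:\mathbb R\to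 X_\omega$ is a unit speed parametrization of the line. For $x\in X_\omega$ let $F_x\subset X_\omega$ be the set of all $y$ such that $b(y)=b(x)$ for every Busemann function $b$ of every Ptolemy line in $X_\omega$ through $x$. Let $B_\omega=\{F_x: x\in X_\omega\}$ and $\pi_\omega:X_\omega\to B_\omega$, $\pi_\omega(x)=F_x$; the fibres of $\pi_\omega$ are called *$\mathbb K$-lines*. For $o\in X_\omega$ let $D_o$ be the set of the points $x\in X_\omega$ that are lifts of points $\bar x\in B_\omega$ with respect to $o$, that is, $x\in\pi_\omega^{-1}(\bar x)$ and $x$ is joined with $o$ by a segment of a Ptolemy line in $X_\omega$. The family $\{D_o\}_{o\in X_\omega}$ is the *canonical distribution* on $X_\omega$; it is *integrable* if $D_o=D_{o'}$ for all $o\in X_\omega$ and $o'\in D_o$. **Proposition.** Under these assumptions, the canonical distribution on $X_\omega$ is integrable for some $\omega\in X$ if and only if for every $\omega\in X$ every fibre of $\pi_\omega$ is a single point. In this case $X$ is Möbius equivalent to $\widehat{\mathbb R}^n$ with $n=\dim X$, the covering dimension of $X$. -/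

import Mathlib

open Set Filter Topology
open scoped ENNReal

namespace Moebius

/-! ### Extended metrics and cross-ratio triples -/

/-- An extended metric on `X`: a metric for which at most one infinitely remote point `infty`
is allowed.  Distances are finite, except that the infinitely remote point (if there is one) is at
distance `⊤` from every other point. -/
structure ExtMetric (X : Type*) where
  dist : X → X → ℝ≥0∞
  /-- `some ω` if `ω` is the infinitely remote point, `none` if there is no such point. -/
  infty : Option X
  dist_eq_zero_iff : ∀ x y, dist x y = 0 ↔ x = y
  dist_comm : ∀ x y, dist x y = dist y x
  dist_triangle : ∀ x y z, dist x z ≤ dist x y + dist y z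
  dist_eq_top_iff : ∀ x y, dist x y = ⊤ ↔ x ≠ y ∧ (infty = some x ∨ infty = some y)

section ExtMetric

variable {X : Type*}

open Classical in
/-- The real factor with which a distance enters a cross-ratio triple.  The infinite distances
of a triple cancel; equivalently, each of them is replaced by `1`.  So one gets
`(d(x,y) : d(x,z) : d(y,z))` if only the last entry is `∞`, and `(0 : 1 : 1)` if the last two
entries are `∞`. -/
noncomputable def ExtMetric.factor (d : ExtMetric X) (x y : X) : ℝ :=
  if d.dist x y = ⊤ then 1 else (d.dist x y).toReal

/-- A representative in `ℝ³` of the cross-ratio triple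
`(d(x,y)d(z,u) : d(x,z)d(y,u) : d(x,u)d(y,z))`. -/
noncomputable def ExtMetric.crt (d : ExtMetric X) (x y z u : X) : ℝ × ℝ × ℝ :=
  (d.factor x y * d.factor z u, d.factor x z * d.factor y u, d.factor x u * d.factor y z)

/-- Two triples of homogeneous coordinates represent the same point of the projective plane. -/
def ProjEq (v w : ℝ × ℝ × ℝ) : Prop := ∃ c : ℝ, c ≠ 0 ∧ v = c • w

/-- A quadruple is admissible if no entry occurs three or four times in it. -/
def Admissible (x y z u : X) : Prop :=
  ¬ (x = y ∧ y = z) ∧ ¬ (x = y ∧ y = u) ∧ ¬ (x = z ∧ z = u) ∧ ¬ (y = z ∧ z = u)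

/-- Two extended metrics are Möbius equivalent if they have the same cross-ratio triples on all
admissible quadruples. -/
def ExtMetric.MobiusEquiv (d d' : ExtMetric X) : Prop :=
  ∀ x y z u : X, Admissible x y z u → ProjEq (d.crt x y z u) (d'.crt x y z u)

/-- The topology of an extended metric: it is generated by the open balls around points that are
not infinitely remote and by the complements of the closed balls around such points. -/
@[reducible]
def ExtMetric.topology (d : ExtMetric X) : TopologicalSpace X :=
  TopologicalSpace.generateFrom
    {s | ∃ (x : X) (r : ℝ), d.infty ≠ some x ∧ 0 < r ∧
      (s = {y | d.dist x y < ENNReal.ofReal r} ∨ s = {y | d.dist x y ≤ ENNReal.ofReal r}ᶜ)}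

theorem ProjEq.symm {v w : ℝ × ℝ × ℝ} (h : ProjEq v w) : ProjEq w v := by
  obtain ⟨c, hc, rfl⟩ := h
  exact ⟨c⁻¹, inv_ne_zero hc, by rw [smul_smul, inv_mul_cancel₀ hc, one_smul]⟩

theorem ProjEq.trans {v w t : ℝ × ℝ × ℝ} (h : ProjEq v w) (h' : ProjEq w t) : ProjEq v t := by
  obtain ⟨c, hc, rfl⟩ := h
  obtain ⟨c', hc', rfl⟩ := h'
  exact ⟨c * c', mul_ne_zero hc hc', by rw [smul_smul]⟩

theorem ProjEq.refl (v : ℝ × ℝ × ℝ) : ProjEq v v := ⟨1, one_ne_zero, by rw [one_smul]⟩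

end ExtMetric

/-! ### Möbius spaces -/

/-- A Möbius space: a set with a Möbius structure, i.e. a (full) class of pairwise Möbius
equivalent extended metrics. -/
class MobiusSpace (X : Type*) where
  metrics : Set (ExtMetric X)
  nonempty : metrics.Nonempty
  equiv : ∀ d ∈ metrics, ∀ d' ∈ metrics, d.MobiusEquiv d'
  full : ∀ d ∈ metrics, ∀ d' : ExtMetric X, d.MobiusEquiv d' → d' ∈ metrics

/-- The Möbius structure generated by one extended metric. -/
@[reducible]
def MobiusSpace.ofMetric {X : Type*} (d₀ : ExtMetric X) : MobiusSpace X where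
  metrics := {d | d₀.MobiusEquiv d}
  nonempty := ⟨d₀, fun _ _ _ _ _ => ProjEq.refl _⟩
  equiv := fun _ hd _ hd' x y z u h => (hd x y z u h).symm.trans (hd' x y z u h)
  full := fun _ hd _ hd' x y z u h => (hd x y z u h).trans (hd' x y z u h)

/-- The metrics of the Möbius structure of `X`. -/
def metrics (X : Type*) [MobiusSpace X] : Set (ExtMetric X) := MobiusSpace.metrics

/-- The topology of a Möbius space.  Möbius equivalent metrics define the same topology; as a
definition that singles out no metric, we take the topology generated by the topologies of all
metrics of the structure. -/
instance (priority := 50) mobiusTopology (X : Type*) [MobiusSpace X] :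
    TopologicalSpace X :=
  ⨅ d ∈ metrics X, d.topology

/-- Möbius maps: injective maps that preserve the cross-ratio triples. -/
def IsMobius {X Y : Type*} [MobiusSpace X] [MobiusSpace Y] (f : X → Y) : Prop :=
  Function.Injective f ∧
    ∀ d ∈ metrics X, ∀ d' ∈ metrics Y, ∀ x y z u : X, Admissible x y z u →
      ProjEq (d'.crt (f x) (f y) (f z) (f u)) (d.crt x y z u)

/-- Two Möbius spaces are Möbius equivalent if there is a bijective Möbius map between them. -/
def MobiusEquivalent (X Y : Type*) [MobiusSpace X] [MobiusSpace Y] : Prop :=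
  ∃ f : X → Y, Function.Bijective f ∧ IsMobius f

/-- A Ptolemy space: the entries of the cross-ratio triple of every admissible quadruple satisfy
the triangle inequality. -/
def IsPtolemySpace (X : Type*) [MobiusSpace X] : Prop :=
  ∀ d ∈ metrics X, ∀ x y z u : X, Admissible x y z u →
    (d.crt x y z u).1 ≤ (d.crt x y z u).2.1 + (d.crt x y z u).2.2 ∧
    (d.crt x y z u).2.1 ≤ (d.crt x y z u).1 + (d.crt x y z u).2.2 ∧
    (d.crt x y z u).2.2 ≤ (d.crt x y z u).1 + (d.crt x y z u).2.1

/-! ### The extended Euclidean space -/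

/-- The set `ℝⁿ ∪ {∞}`, where `∞` is `none`. -/
def ExtendedEuclideanSpace (n : ℕ) : Type := Option (EuclideanSpace ℝ (Fin n))

/-- The Euclidean distance, extended so that `∞` is infinitely remote. -/
noncomputable def extendedEuclideanDist (n : ℕ) :
    ExtendedEuclideanSpace n → ExtendedEuclideanSpace n → ℝ≥0∞
  | none, none => 0
  | none, some _ => ⊤
  | some _, none => ⊤
  | some x, some y => edist x y

/-- The extended Euclidean metric on `ℝⁿ ∪ {∞}`. -/
noncomputable def extendedEuclideanMetric (n : ℕ) : ExtMetric (ExtendedEuclideanSpace n) where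
  dist := extendedEuclideanDist n
  infty := some none
  dist_eq_zero_iff := by
    rintro (_ | x) (_ | y)
    · exact iff_of_true rfl rfl
    · exact iff_of_false ENNReal.top_ne_zero (Option.some_ne_none y).symm
    · exact iff_of_false ENNReal.top_ne_zero (Option.some_ne_none x)
    · exact edist_eq_zero.trans (Option.some_inj (a := x) (b := y)).symm
  dist_comm := by
    rintro (_ | x) (_ | y)
    · rfl
    · rfl
    · rfl
    · exact edist_comm x y
  dist_triangle := by
    rintro (_ | x) (_ | y) (_ | z) <;>
      first
        | exact edist_triangle x y z
        | simp [extendedEuclideanDist]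
  dist_eq_top_iff := by
    rintro (_ | x) (_ | y)
    · exact iff_of_false ENNReal.zero_ne_top (fun h => h.1 rfl)
    · exact iff_of_true rfl ⟨(Option.some_ne_none y).symm, Or.inl rfl⟩
    · exact iff_of_true rfl ⟨Option.some_ne_none x, Or.inr rfl⟩
    · refine iff_of_false (edist_ne_top x y) ?_
      rintro ⟨-, h | h⟩
      · exact Option.some_ne_none x (Option.some_inj.1 h).symm
      · exact Option.some_ne_none y (Option.some_inj.1 h).symm

/-- The standard Möbius structure on the extended Euclidean space. -/
noncomputable instance (n : ℕ) : MobiusSpace (ExtendedEuclideanSpace n) :=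
  MobiusSpace.ofMetric (extendedEuclideanMetric n)

/-! ### Ptolemy circles, spheres between points and space inversions -/

section Properties

variable {X : Type*} [MobiusSpace X]

/-- The pair `(x, z)` separates the pair `(y, u)` in `σ`: the points `y` and `u` lie in different
connected components of `σ ∖ {x, z}`. -/
def Separates (σ : Set X) (x z y u : X) : Prop :=
  y ∈ σ \ {x, z} ∧ u ∈ σ \ {x, z} ∧ u ∉ connectedComponentIn (σ \ {x, z}) y

/-- A Ptolemy circle: a subset homeomorphic to the circle on which the Ptolemy equality
`d(x,z)d(y,u) = d(x,y)d(z,u) + d(x,u)d(y,z)` holds for all quadruples of distinct points such that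
`(x, z)` separates `(y, u)`. -/
def IsPtolemyCircle (σ : Set X) : Prop :=
  Nonempty (σ ≃ₜ Circle) ∧
    ∀ d ∈ metrics X, ∀ x ∈ σ, ∀ y ∈ σ, ∀ z ∈ σ, ∀ u ∈ σ,
      [x, y, z, u].Nodup → Separates σ x z y u →
        (d.crt x y z u).2.1 = (d.crt x y z u).1 + (d.crt x y z u).2.2

/-- The points `x, y` lie on some sphere between `ω` and `ω'`: the cross-ratio triple of
`(ω, x, y, ω')` has the form `(1 : 1 : ∗)`. -/
def OnCommonSphere (ω ω' x y : X) : Prop :=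
  ∀ d ∈ metrics X, (d.crt ω x y ω').1 = (d.crt ω x y ω').2.1 ∧ (d.crt ω x y ω').1 ≠ 0

/-- A sphere between `ω` and `ω'`: an equivalence class in `X ∖ {ω, ω'}` of the relation of lying
on some sphere between `ω` and `ω'`. -/
def IsSphereBetween (ω ω' : X) (S : Set X) : Prop :=
  ∃ x, x ≠ ω ∧ x ≠ ω' ∧ S = {y | OnCommonSphere ω ω' x y}

/-- A space inversion w.r.t. `ω, ω'` and `S`: a Möbius involution without fixed points that
exchanges `ω` and `ω'`, preserves `S`, and preserves every Ptolemy circle through `ω, ω'`. -/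
structure IsSpaceInversion (ω ω' : X) (S : Set X) (φ : X → X) : Prop where
  mobius : IsMobius φ
  involutive : ∀ x, φ (φ x) = x
  no_fixed_point : ∀ x, φ x ≠ x
  map_pole : φ ω = ω'
  image_sphere : φ '' S = S
  image_circle : ∀ σ : Set X, IsPtolemyCircle σ → ω ∈ σ → ω' ∈ σ → φ '' σ = σ

/-- Property (E): there is at least one Ptolemy circle. -/
def PropertyE (X : Type*) [MobiusSpace X] : Prop := ∃ σ : Set X, IsPtolemyCircle σ

/-- Property (I): for distinct `ω, ω'` and every sphere `S` between them there is a unique space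
inversion w.r.t. `ω, ω'` and `S`. -/
def PropertyI (X : Type*) [MobiusSpace X] : Prop :=
  ∀ ω ω' : X, ω ≠ ω' → ∀ S : Set X, IsSphereBetween ω ω' S →
    ∃! φ : X → X, IsSpaceInversion ω ω' S φ

/-! ### Ptolemy lines, Busemann functions and the canonical fibration -/

/-- A Ptolemy line in `X_ω = X ∖ {ω}`: a Ptolemy circle through `ω` with the point `ω` removed. -/
def IsPtolemyLine (ω : X) (l : Set X) : Prop :=
  ∃ σ : Set X, IsPtolemyCircle σ ∧ ω ∈ σ ∧ l = σ \ {ω}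

/-- `c` is a unit speed parametrization of `l` for the metric `d`. -/
def IsUnitSpeed (d : ExtMetric X) (l : Set X) (c : ℝ → X) : Prop :=
  (∀ s t : ℝ, d.dist (c s) (c t) = ENNReal.ofReal |s - t|) ∧ range c = l

/-- `b` is (on `X_ω`, where `ω` is infinitely remote for `d`) a Busemann function of the line `l`:
the limit of `d(x, y) - d(o, y)` as `y = c t` goes to infinity along `l`, where the unit speed
parametrization `c` fixes an orientation of `l` and a base point `o = c 0` on `l`. -/
def IsBusemannFunction (d : ExtMetric X) (l : Set X) (b : X → ℝ) : Prop :=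
  ∃ c : ℝ → X, IsUnitSpeed d l c ∧
    ∀ x, d.infty ≠ some x →
      Tendsto (fun t : ℝ => (d.dist x (c t)).toReal - (d.dist (c 0) (c t)).toReal) atTop
        (𝓝 (b x))

/-- The set `F_x ⊆ X_ω`: the intersection, over all Ptolemy lines `l` in `X_ω` through `x`, of the
horospheres through `x` of the Busemann functions of `l`.  All metrics with infinitely remote
point `ω` are homothetic, so they define the same horospheres. -/
def horoIntersection (ω x : X) : Set X :=
  {y | y ≠ ω ∧ ∀ d ∈ metrics X, d.infty = some ω → ∀ l : Set X, IsPtolemyLine ω l → x ∈ l →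
    ∀ b : X → ℝ, IsBusemannFunction d l b → b y = b x}

/-- The base `B_ω = {F_x | x ∈ X_ω}`. -/
def base (ω : X) : Set (Set X) := {F | ∃ x, x ≠ ω ∧ F = horoIntersection ω x}

/-- The fibre over `b ∈ B_ω` of the canonical projection `π_ω : X_ω → B_ω`, `π_ω(x) = F_x`.
The fibres of `π_ω` are the `𝕂`-lines of `X_ω`. -/
def fibre (ω : X) (b : Set X) : Set X := {x | x ≠ ω ∧ horoIntersection ω x = b}

/-- `o` and `x` are joined by a segment of a Ptolemy line in `X_ω`. -/
def JoinedBySegment (ω o x : X) : Prop := ∃ l : Set X, IsPtolemyLine ω l ∧ o ∈ l ∧ x ∈ l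

/-- `x` is the lift of `b ∈ B_ω` with respect to `o`: the point of the fibre over `b` that is
joined with `o` by a geodesic segment. -/
def IsLift (ω o : X) (b : Set X) (x : X) : Prop := x ∈ fibre ω b ∧ JoinedBySegment ω o x

/-- `D_o`, the set of all lifts of points of `B_ω` with respect to `o`.  The family of these sets,
`o ∈ X_ω`, is the canonical distribution on `X_ω`. -/
def distributionAt (ω o : X) : Set X := {x | ∃ b ∈ base ω, IsLift ω o b x}

/-- The canonical distribution on `X_ω` is integrable: `D_o = D_{o'}` for all `o ∈ X_ω` and all
`o' ∈ D_o`. -/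
def IsIntegrable (ω : X) : Prop :=
  ∀ o, o ≠ ω → ∀ o' ∈ distributionAt ω o, distributionAt ω o = distributionAt ω o'

end Properties

/-! ### Topological dimension -/

/-- The covering dimension of `X` is at most `n`: every finite open cover has a finite open
refinement that covers `X` and in which no point lies in more than `n + 1` members. -/
def CoveringDimLE (X : Type*) [TopologicalSpace X] (n : ℕ) : Prop :=
  ∀ 𝒰 : Set (Set X), 𝒰.Finite → (∀ U ∈ 𝒰, IsOpen U) → ⋃₀ 𝒰 = univ →
    ∃ 𝒱 : Set (Set X), 𝒱.Finite ∧ (∀ V ∈ 𝒱, IsOpen V) ∧ ⋃₀ 𝒱 = univ ∧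
      (∀ V ∈ 𝒱, ∃ U ∈ 𝒰, V ⊆ U) ∧ ∀ x : X, {V ∈ 𝒱 | x ∈ V}.encard ≤ n + 1

/-- `dim X = n` for the covering dimension of a nonempty space. -/
def HasCoveringDim (X : Type*) [TopologicalSpace X] (n : ℕ) : Prop :=
  Nonempty X ∧ IsLeast {m : ℕ | CoveringDimLE X m} n

end Moebius

/-! Remove a point ω and use a metric for which ω is infinitely remote. The rest is a proper
Ptolemaic metric space `Pt d`. The Ptolemy circles through ω become its geodesic lines, and space
inversions exchanging ω with o become metric inversions acting on the lines through o by t ↦ -r²/t.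
The structure `Inversions` records this, and the geometry is done there. Two inversions with a
common center compose to a homothety that preserves each line through the center; limits of composed
homotheties give a transitive family of isometries.

The decisive analytic fact is `bus_add_bus_neg`: the Busemann functions of the two ends of a line
are opposite. Ptolemy's inequality makes Busemann functions convex along lines, so they are affine
there. Hence homotheties and limit isometries act on their values as real homotheties and
translations (`bus_pureHom`, `exists_translation`), and every line has a parallel through every
point (`exists_parallel`).

The equivalence goes through a third condition: any three points lie on a Ptolemy circle, i.e. any
two points of X_ω lie on a line. If the fibres are points, Busemann functions separate points, and
the points obtained from y by homotheties about x and by translations form a line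
(`exists_line_of_separate`). Conversely, the Busemann function of a line through x and y
distinguishes them. Integrability at one ω spreads to all points by homogeneity. Then the set B of
points concircular with given a and b contains every Ptolemy circle through two of its points. If B
missed a point q, it would be compact once q is sent to infinity; at a point p of B where a Busemann
function is largest, some circle through p and another point of B rises above the maximum
(`exists_inv_notMem`), a contradiction.

When any two points lie on a line, the slopes of Busemann functions play the role of cosines and are
symmetric (`slope_symm`). This yields the law of cosines, hence an inner product, finite-dimensional
by properness. The dimension is identified by proving that a one-point compactification of ℝⁿ has
covering dimension n (`hasCoveringDim_of_onePoint`). -/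

namespace Moebius

/-! ### Metric spaces with inversions -/

/-- A Ptolemaic metric space that contains a line and has, for all centers `o` and radii `r`, an
inversion that acts on the lines through `o` by `t ↦ -r²/t`. -/
structure Inversions (M : Type*) [MetricSpace M] where
  ptolemy : ∀ x y z u : M, dist x z * dist y u ≤ dist x y * dist z u + dist x u * dist y z
  exists_line : ∃ c : ℝ → M, Isometry c
  inv : M → ℝ → M → M
  inv_ne : ∀ {o : M} {r : ℝ} {x : M}, 0 < r → x ≠ o → inv o r x ≠ o
  inv_inv : ∀ {o : M} {r : ℝ} {x : M}, 0 < r → x ≠ o → inv o r (inv o r x) = x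
  dist_inv_inv : ∀ {o : M} {r : ℝ} {x y : M}, 0 < r → x ≠ o → y ≠ o →
    dist (inv o r x) (inv o r y) = r ^ 2 * dist x y / (dist x o * dist y o)
  dist_inv : ∀ {o : M} {r : ℝ} {x : M}, 0 < r → x ≠ o → dist (inv o r x) o = r ^ 2 / dist x o
  inv_line : ∀ {o : M} {r : ℝ} {c : ℝ → M} {t : ℝ}, 0 < r → Isometry c → c 0 = o → t ≠ 0 →
    inv o r (c t) = c (-r ^ 2 / t)
  tendsto_inv : ∀ {o : M} {r : ℝ} {x : M}, 0 < r → x ≠ o →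
    Tendsto (fun s => inv o s x) (𝓝 r) (𝓝 (inv o r x))

/-! ### Ultralimits of homotheties of a proper space. -/

section Ultralimits

variable {M : Type*} [MetricSpace M]

theorem exists_tendsto_of_dist_le [ProperSpace M] {ι : Type*} (U : Ultrafilter ι) (f : ι → M)
    (p : M) (R : ℝ) (h : ∀ᶠ i in (U : Filter ι), dist (f i) p ≤ R) :
    ∃ y, Tendsto f U (𝓝 y) := by
  obtain ⟨y, -, hy⟩ := (isCompact_closedBall p R).ultrafilter_le_nhds (U.map f)
    (by rw [le_principal_iff]; exact h)
  exact ⟨y, hy⟩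

/-- An ultralimit of isometric bijections, pointed in a bounded set, is an isometric bijection. -/
theorem exists_ultralimit_isometryEquiv [ProperSpace M] {ι : Type*} (U : Ultrafilter ι)
    (f : ι → M ≃ M) (l : ι → ℝ) (a : ℝ) (ha : 0 < a) (hl : Tendsto l U (𝓝 a))
    (hf : ∀ i x y, dist (f i x) (f i y) = l i * dist x y) (p q : M)
    (h : Tendsto (fun i => f i p) U (𝓝 q)) :
    ∃ g : M ≃ M, (∀ x y, dist (g x) (g y) = a * dist x y) ∧ g p = q ∧
      (∀ x, Tendsto (fun i => f i x) U (𝓝 (g x))) ∧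
      (∀ x, Tendsto (fun i => (f i).symm x) U (𝓝 (g.symm x))) := by
  have hl2 : ∀ᶠ i in (U : Filter ι), a / 2 < l i ∧ l i < 2 * a :=
    (hl.eventually (lt_mem_nhds (by linarith))).and (hl.eventually (gt_mem_nhds (by linarith)))
  have hq : ∀ᶠ i in (U : Filter ι), dist (f i p) q < 1 :=
    h.eventually (Metric.ball_mem_nhds q one_pos)
  have h1 : ∀ x, ∃ y, Tendsto (fun i => f i x) U (𝓝 y) := by
    intro x
    refine exists_tendsto_of_dist_le U _ q (2 * a * dist x p + 1) ?_
    filter_upwards [hl2, hq] with i hi hi'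
    have := dist_triangle (f i x) (f i p) q
    rw [hf] at this
    have h3 : l i * dist x p ≤ 2 * a * dist x p :=
      mul_le_mul_of_nonneg_right hi.2.le dist_nonneg
    linarith
  choose g hg using h1
  have hs : ∀ i x y, l i * dist ((f i).symm x) ((f i).symm y) = dist x y := by
    intro i x y
    rw [← hf, Equiv.apply_symm_apply, Equiv.apply_symm_apply]
  -- The inverses expand distances by at most 2 / a for almost all indices, so they also have
  -- pointwise limits. These form the inverse of the limit map, which is therefore onto.
  have h2 : ∀ x, ∃ y, Tendsto (fun i => (f i).symm x) U (𝓝 y) := by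
    intro x
    refine exists_tendsto_of_dist_le U _ p ((dist x q + 1) * (2 / a)) ?_
    filter_upwards [hl2, hq] with i hi hi'
    have h4 := hs i x (f i p)
    rw [Equiv.symm_apply_apply] at h4
    have h5 : dist x (f i p) ≤ dist x q + 1 := by
      have := dist_triangle x q (f i p)
      rw [dist_comm q] at this
      linarith
    have h6 : a / 2 * dist ((f i).symm x) p ≤ l i * dist ((f i).symm x) p :=
      mul_le_mul_of_nonneg_right hi.1.le dist_nonneg
    rw [mul_div_assoc', le_div_iff₀ ha]
    nlinarith
  choose g' hg' using h2
  have hgd : ∀ x y, dist (g x) (g y) = a * dist x y := by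
    intro x y
    refine tendsto_nhds_unique ((hg x).dist (hg y)) ?_
    simp_rw [hf]
    exact hl.mul_const _
  have e1 : ∀ x, g' (g x) = x := by
    intro x
    have h7 : Tendsto (fun i => l i * dist ((f i).symm (g x)) x) U (𝓝 (a * dist (g' (g x)) x)) :=
      hl.mul ((hg' (g x)).dist tendsto_const_nhds)
    have h8 : Tendsto (fun i => l i * dist ((f i).symm (g x)) x) U (𝓝 0) := by
      have : ∀ i, l i * dist ((f i).symm (g x)) x = dist (g x) (f i x) := by
        intro i
        have := hs i (g x) (f i x)
        rwa [Equiv.symm_apply_apply] at this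
      simp_rw [this]
      have := (tendsto_const_nhds (x := g x) (f := (U : Filter ι))).dist (hg x)
      rwa [dist_self] at this
    have := tendsto_nhds_unique h7 h8
    rcases mul_eq_zero.1 this with h | h
    · exact absurd h ha.ne'
    · exact dist_eq_zero.1 h
  have e2 : ∀ x, g (g' x) = x := by
    intro x
    have h7 : Tendsto (fun i => l i * dist ((f i).symm x) (g' x)) U (𝓝 0) := by
      have := hl.mul ((hg' x).dist (tendsto_const_nhds (x := g' x)))
      rwa [dist_self, mul_zero] at this
    have h8 : Tendsto (fun i => l i * dist ((f i).symm x) (g' x)) U (𝓝 (dist x (g (g' x)))) := by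
      have : ∀ i, l i * dist ((f i).symm x) (g' x) = dist x (f i (g' x)) := by
        intro i
        have := hs i x (f i (g' x))
        rwa [Equiv.symm_apply_apply] at this
      simp_rw [this]
      exact tendsto_const_nhds.dist (hg _)
    exact (dist_eq_zero.1 (tendsto_nhds_unique h8 h7)).symm
  exact ⟨⟨g, g', e1, e2⟩, hgd, tendsto_nhds_unique (hg p) h, hg, hg'⟩

end Ultralimits

/-- A homothety with center `o` and coefficient `l` that preserves the lines through `o`. -/
structure IsPureHom {M : Type*} [MetricSpace M] (o : M) (l : ℝ) (k : M ≃ M) : Prop where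
  pos : 0 < l
  map_center : k o = o
  dist_map : ∀ x y, dist (k x) (k y) = l * dist x y
  map_line : ∀ c : ℝ → M, Isometry c → c 0 = o → ∀ t, k (c t) = c (l * t)

section PureHom

variable {M : Type*} [MetricSpace M]

theorem isometry_real {c : ℝ → M} (hc : Isometry c) (s t : ℝ) : dist (c s) (c t) = |s - t| := by
  rw [hc.dist_eq, Real.dist_eq]

theorem Isometry.comp_add {c : ℝ → M} (hc : Isometry c) (a : ℝ) :
    Isometry (fun t => c (a + t)) :=
  hc.comp (isometry_add_left a)

theorem Isometry.comp_neg {c : ℝ → M} (hc : Isometry c) : Isometry (fun t => c (-t)) :=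
  Isometry.of_dist_eq fun s t => by
    rw [isometry_real hc, Real.dist_eq, abs_sub_comm]; congr 1; ring

theorem IsPureHom.symm {o : M} {l : ℝ} {k : M ≃ M} (h : IsPureHom o l k) :
    IsPureHom o l⁻¹ k.symm where
  pos := inv_pos.2 h.pos
  map_center := by rw [Equiv.symm_apply_eq, h.map_center]
  dist_map x y := by
    have := h.dist_map (k.symm x) (k.symm y)
    rw [Equiv.apply_symm_apply, Equiv.apply_symm_apply] at this
    rw [this, inv_mul_cancel_left₀ h.pos.ne']
  map_line c hc h0 t := by
    rw [Equiv.symm_apply_eq, h.map_line c hc h0, mul_inv_cancel_left₀ h.pos.ne']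

/-- The image of a line under a homothety, with unit speed. -/
theorem isometry_homothety {c : ℝ → M} (hc : Isometry c) {l : ℝ} (hl : 0 < l) {k : M → M}
    (hk : ∀ x y, dist (k x) (k y) = l * dist x y) : Isometry (fun t => k (c (l⁻¹ * t))) :=
  Isometry.of_dist_eq fun s t => by
    rw [hk, isometry_real hc, Real.dist_eq, ← mul_sub, abs_mul, abs_of_pos (inv_pos.2 hl),
      mul_inv_cancel_left₀ hl.ne']

theorem IsPureHom.isometry {o : M} {l : ℝ} {k : M ≃ M} (h : IsPureHom o l k) {c : ℝ → M}
    (hc : Isometry c) : Isometry (fun t => k (c (l⁻¹ * t))) :=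
  isometry_homothety hc h.pos h.dist_map

theorem IsPureHom.map_line' {o : M} {l : ℝ} {k : M ≃ M} (h : IsPureHom o l k) (c : ℝ → M)
    (hc : Isometry c) (a : ℝ) (h0 : c a = o) (t : ℝ) : k (c t) = c (a + l * (t - a)) := by
  have := h.map_line (fun t => c (a + t)) (Isometry.comp_add hc a) (by simpa using h0) (t - a)
  simpa using this

end PureHom

/-! ### Homotheties and isometries composed from inversions. -/

namespace Inversions

variable {M : Type*} [MetricSpace M] (I : Inversions M)
include I

/-- Inversions of radii 1 and √l about o compose to ratio (√l / 1)² = l, and on a line t ↦ -1/t ↦ l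
t. By the last clause, conjugation with the unit inversion turns the homothety into its inverse. -/
theorem exists_pureHom (o : M) {l : ℝ} (hl : 0 < l) :
    ∃ k : M ≃ M, IsPureHom o l k ∧ (∀ x, x ≠ o → k x = I.inv o (√l) (I.inv o 1 x)) ∧
      ∀ x, x ≠ o → I.inv o 1 (k x) = k.symm (I.inv o 1 x) := by
  classical
  have hs : 0 < √l := Real.sqrt_pos.2 hl
  have h1 := fun {x : M} => I.inv_ne (o := o) (x := x) one_pos
  have h2 := fun {x : M} => I.inv_ne (o := o) (x := x) hs
  have h11 := fun {x : M} => I.inv_inv (o := o) (x := x) one_pos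
  have h22 := fun {x : M} => I.inv_inv (o := o) (x := x) hs
  let k : M ≃ M :=
    { toFun := fun x => if x = o then o else I.inv o (√l) (I.inv o 1 x)
      invFun := fun x => if x = o then o else I.inv o 1 (I.inv o (√l) x)
      left_inv := fun x => by
        by_cases hx : x = o
        · simp [hx]
        · simp [hx, h2 (h1 hx), h22 (h1 hx), h11 hx]
      right_inv := fun x => by
        by_cases hx : x = o
        · simp [hx]
        · simp [hx, h1 (h2 hx), h11 (h2 hx), h22 hx] }
  have ko : k o = o := by simp [k]
  have kx : ∀ x, x ≠ o → k x = I.inv o (√l) (I.inv o 1 x) := fun x hx => by simp [k, hx]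
  have ksx : ∀ x, x ≠ o → k.symm x = I.inv o 1 (I.inv o (√l) x) := fun x hx => by
    simp [k, hx]
  have ho : ∀ x, dist (k x) o = l * dist x o := by
    intro x
    by_cases hx : x = o
    · simp [hx, ko]
    · rw [kx x hx, I.dist_inv hs (h1 hx), I.dist_inv one_pos hx, Real.sq_sqrt hl.le]
      have := dist_pos.2 hx
      field_simp
  refine ⟨k, ⟨hl, ko, fun x y => ?_, fun c hc h0 t => ?_⟩, kx, fun x hx => ?_⟩
  · by_cases hx : x = o
    · rw [hx, ko, dist_comm, ho, dist_comm]
    by_cases hy : y = o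
    · rw [hy, ko, ho]
    rw [kx x hx, kx y hy, I.dist_inv_inv hs (h1 hx) (h1 hy), I.dist_inv one_pos hx,
      I.dist_inv one_pos hy, I.dist_inv_inv one_pos hx hy, Real.sq_sqrt hl.le]
    have := dist_pos.2 hx
    have := dist_pos.2 hy
    field_simp
  · by_cases ht : t = 0
    · rw [ht, mul_zero, h0, ko]
    have : c t ≠ o := by
      rw [← h0]; exact fun h => ht (hc.injective h)
    rw [kx _ this, I.inv_line one_pos hc h0 ht, I.inv_line hs hc h0 (by
      simp [ht]), Real.sq_sqrt hl.le]
    congr 1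
    field_simp
  · rw [kx x hx, ksx _ (h1 hx)]

/-- The isometries of `M` are transitive; the transition is a limit of compositions of pure
homotheties. -/
theorem exists_isometryEquiv [ProperSpace M] (o o' : M) :
    ∃ (U : Ultrafilter ℕ) (f : ℕ → M ≃ M) (g : M ≃ M), (U : Filter ℕ) ≤ atTop ∧
      (∀ x y, dist (g x) (g y) = dist x y) ∧ g o = o' ∧
      (∀ x, Tendsto (fun i => f i x) U (𝓝 (g x))) ∧
      ∀ i : ℕ, ∃ h h' : M ≃ M, IsPureHom o ((i : ℝ) + 1) h ∧ IsPureHom o' ((i : ℝ) + 1) h' ∧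
        ∀ x, f i x = h'.symm (h x) := by
  have hp : ∀ i : ℕ, (0 : ℝ) < (i : ℝ) + 1 := fun i => by positivity
  choose h hh _ _ using fun i : ℕ => I.exists_pureHom o (hp i)
  choose h' hh' _ _ using fun i : ℕ => I.exists_pureHom o' (hp i)
  let U : Ultrafilter ℕ := Ultrafilter.of atTop
  have hU : (U : Filter ℕ) ≤ atTop := Ultrafilter.of_le atTop
  let f : ℕ → M ≃ M := fun i => (h i).trans (h' i).symm
  have hf : ∀ i x y, dist (f i x) (f i y) = 1 * dist x y := by
    intro i x y
    simp only [f, Equiv.trans_apply]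
    rw [(hh' i).symm.dist_map, (hh i).dist_map, one_mul, inv_mul_cancel_left₀ (hp i).ne']
  -- The first homothety fixes o, and the second contracts it towards o': the remaining distance is
  -- dist o o' / (i + 1).
  have hlim : Tendsto (fun i => f i o) U (𝓝 o') := by
    rw [tendsto_iff_dist_tendsto_zero]
    have : ∀ i : ℕ, dist (f i o) o' = dist o o' * (1 / ((i : ℝ) + 1)) := by
      intro i
      simp only [f, Equiv.trans_apply]
      rw [(hh i).map_center]
      conv_lhs => rw [← (hh' i).symm.map_center]
      rw [(hh' i).symm.dist_map]
      simp [mul_comm]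
    simp_rw [this]
    have := (tendsto_one_div_add_atTop_nhds_zero_nat (𝕜 := ℝ)).const_mul (dist o o')
    rw [mul_zero] at this
    exact this.mono_left hU
  obtain ⟨g, g1, g2, g3, -⟩ := exists_ultralimit_isometryEquiv U f (fun _ => 1) 1 one_pos
    tendsto_const_nhds hf o o' hlim
  exact ⟨U, f, g, hU, fun x y => by rw [g1, one_mul], g2, g3, fun i =>
    ⟨h i, h' i, hh i, hh' i, fun x => rfl⟩⟩

/-- There is a line through every point. -/
theorem exists_line_through [ProperSpace M] (o : M) : ∃ c : ℝ → M, Isometry c ∧ c 0 = o := by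
  obtain ⟨c, hc⟩ := I.exists_line
  obtain ⟨-, -, g, -, hg, hgo, -⟩ := I.exists_isometryEquiv (c 0) o
  exact ⟨fun t => g (c t), (Isometry.of_dist_eq hg).comp hc, hgo⟩

end Inversions

/-! ### Busemann functions -/

section Busemann

variable {M : Type*} [MetricSpace M]

/-- The Busemann function of the ray `c t`, `t → ∞`. -/
noncomputable def bus (c : ℝ → M) (x : M) : ℝ := ⨅ t : ℝ, (dist x (c t) - t)

/-- Monotonicity turns the infimum in `bus` into the usual limit along the ray. -/
theorem antitone_bus {c : ℝ → M} (hc : Isometry c) (x : M) :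
    Antitone fun t : ℝ => dist x (c t) - t := by
  intro s t hst
  have := dist_triangle x (c s) (c t)
  rw [isometry_real hc, abs_sub_comm, abs_of_nonneg (sub_nonneg.2 hst)] at this
  simp only
  linarith

theorem neg_dist_le_dist_sub {c : ℝ → M} (hc : Isometry c) (x : M) (t : ℝ) :
    -dist x (c 0) ≤ dist x (c t) - t := by
  have := dist_triangle (c 0) x (c t)
  rw [isometry_real hc, dist_comm (c 0)] at this
  have := le_abs_self (t - 0)
  rw [abs_sub_comm] at this
  linarith

theorem bddBelow_bus {c : ℝ → M} (hc : Isometry c) (x : M) :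
    BddBelow (range fun t : ℝ => dist x (c t) - t) := by
  refine ⟨-dist x (c 0), ?_⟩
  rintro _ ⟨t, rfl⟩
  exact neg_dist_le_dist_sub hc x t

theorem tendsto_bus {c : ℝ → M} (hc : Isometry c) (x : M) :
    Tendsto (fun t : ℝ => dist x (c t) - t) atTop (𝓝 (bus c x)) :=
  tendsto_atTop_ciInf (antitone_bus hc x) (bddBelow_bus hc x)

theorem bus_line {c : ℝ → M} (hc : Isometry c) (t : ℝ) : bus c (c t) = -t := by
  refine tendsto_nhds_unique (tendsto_bus hc (c t)) ?_
  refine tendsto_const_nhds.congr' ?_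
  filter_upwards [eventually_ge_atTop t] with s hs
  rw [isometry_real hc, abs_sub_comm, abs_of_nonneg (sub_nonneg.2 hs)]
  ring

theorem bus_sub_le {c : ℝ → M} (hc : Isometry c) (x y : M) :
    bus c x - bus c y ≤ dist x y := by
  refine le_of_tendsto ((tendsto_bus hc x).sub (tendsto_bus hc y)) (Eventually.of_forall fun t => ?_)
  have := dist_triangle x y (c t)
  linarith

theorem abs_bus_sub_le {c : ℝ → M} (hc : Isometry c) (x y : M) :
    |bus c x - bus c y| ≤ dist x y := by
  rw [abs_le]
  have h1 := bus_sub_le hc x y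
  have h2 := bus_sub_le hc y x
  rw [dist_comm] at h2
  exact ⟨by linarith, h1⟩

theorem continuous_bus {c : ℝ → M} (hc : Isometry c) : Continuous (bus c) := by
  refine (LipschitzWith.of_dist_le_mul (K := 1) fun x y => ?_).continuous
  rw [Real.dist_eq, NNReal.coe_one, one_mul]
  exact abs_bus_sub_le hc x y

theorem bus_shift {c : ℝ → M} (hc : Isometry c) (a : ℝ) (x : M) :
    bus (fun t => c (a + t)) x = bus c x + a := by
  refine tendsto_nhds_unique (tendsto_bus (Isometry.comp_add hc a) x) ?_
  have := ((tendsto_bus hc x).comp (tendsto_atTop_add_const_left atTop a tendsto_id)).add_const a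
  refine this.congr fun t => ?_
  simp only [Function.comp_apply, id]
  ring

theorem bus_homothety {c : ℝ → M} (hc : Isometry c) {l : ℝ} (hl : 0 < l) {k : M → M}
    (hk : ∀ x y, dist (k x) (k y) = l * dist x y) (x : M) :
    bus (fun t => k (c (l⁻¹ * t))) (k x) = l * bus c x := by
  refine tendsto_nhds_unique (tendsto_bus (isometry_homothety hc hl hk) (k x)) ?_
  have := ((tendsto_bus hc x).comp (tendsto_id.const_mul_atTop (inv_pos.2 hl))).const_mul l
  refine this.congr fun t => ?_
  simp only [Function.comp_apply, id]
  rw [hk, mul_sub, mul_inv_cancel_left₀ hl.ne']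

end Busemann

/-! ### Convexity and affinity of Busemann functions along lines. -/

namespace Inversions

variable {M : Type*} [MetricSpace M] (I : Inversions M)
include I

/-- Ptolemy's inequality for x and three points of the line, divided by |u - v|, is the convexity
inequality. -/
theorem convexOn_dist {c : ℝ → M} (hc : Isometry c) (x : M) :
    ConvexOn ℝ univ (fun t : ℝ => dist x (c t)) := by
  refine ⟨convex_univ, fun u _ v _ a b ha hb hab => ?_⟩
  simp only [smul_eq_mul]
  rcases eq_or_ne u v with rfl | huv
  · rw [← add_mul, hab, one_mul, ← add_mul, hab, one_mul]
  have h := I.ptolemy x (c u) (c (a * u + b * v)) (c v)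
  rw [isometry_real hc, isometry_real hc, isometry_real hc] at h
  have e1 : a * u + b * v - v = a * (u - v) := by
    rw [← eq_sub_iff_add_eq] at hab; subst hab; ring
  have e2 : u - (a * u + b * v) = b * (u - v) := by
    rw [← eq_sub_iff_add_eq] at hab; subst hab; ring
  rw [e1, e2, abs_mul, abs_mul, abs_of_nonneg ha, abs_of_nonneg hb] at h
  have hp : 0 < |u - v| := abs_pos.2 (sub_ne_zero.2 huv)
  nlinarith

theorem convexOn_bus {c m : ℝ → M} (hc : Isometry c) (hm : Isometry m) :
    ConvexOn ℝ univ (fun t : ℝ => bus c (m t)) := by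
  refine ⟨convex_univ, fun u _ v _ a b ha hb hab => ?_⟩
  simp only [smul_eq_mul]
  refine le_of_tendsto_of_tendsto (tendsto_bus hc (m (a * u + b * v)))
    (((tendsto_bus hc (m u)).const_mul a).add ((tendsto_bus hc (m v)).const_mul b))
    (Eventually.of_forall fun t => ?_)
  have := (I.convexOn_dist hm (c t)).2 (mem_univ u) (mem_univ v) ha hb hab
  simp only [smul_eq_mul, dist_comm (c t)] at this
  simp only
  rw [← eq_sub_iff_add_eq] at hab
  subst hab
  linarith

/-- Since c t is the inverse of c (-1/t), distances from the inverse of x near t = 0 encode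
distances from x at the two ends of the line. -/
theorem dist_line_inv {c : ℝ → M} (hc : Isometry c) {x : M} (hx : x ≠ c 0) {t : ℝ} (ht : t ≠ 0) :
    dist (I.inv (c 0) 1 x) (c t) = |t| * dist x (c (-t⁻¹)) / dist x (c 0) := by
  have ht' : -t⁻¹ ≠ 0 := neg_ne_zero.2 (inv_ne_zero ht)
  have h1 : I.inv (c 0) 1 (c (-t⁻¹)) = c t := by
    rw [I.inv_line one_pos hc rfl ht']
    congr 1
    field_simp
  rw [← h1, I.dist_inv_inv one_pos hx (fun h => ht' (hc.injective h)), isometry_real hc, sub_zero,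
    abs_neg, abs_inv]
  have : 0 < |t| := abs_pos.2 ht
  have := dist_pos.2 hx
  field_simp

/-- If the Busemann functions of the two orientations of a line do not add up to zero at `x`, then
the distance to the inverse of `x` is not differentiable along the line. -/
theorem not_differentiableAt_dist {c : ℝ → M} (hc : Isometry c) {x : M} (hx : x ≠ c 0)
    (h : bus c x + bus (fun t => c (-t)) x ≠ 0) :
    ¬ DifferentiableAt ℝ (fun t : ℝ => dist (I.inv (c 0) 1 x) (c t)) 0 := by
  intro hd
  set y := I.inv (c 0) 1 x with hy
  have hdx := dist_pos.2 hx
  have h0 : dist y (c 0) = 1 / dist x (c 0) := by rw [hy, I.dist_inv one_pos hx, one_pow]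
  have hs := hd.hasDerivAt.tendsto_slope_zero
  set D := deriv (fun t : ℝ => dist y (c t)) 0
  have hr : Tendsto (fun t : ℝ => t⁻¹) (𝓝[>] 0) atTop := tendsto_inv_nhdsGT_zero
  -- The right difference quotient equals (dist x (c (-1/t)) - 1/t) / dist x (c 0), which tends to
  -- the Busemann function of the reversed ray over dist x (c 0). The left one gives minus that of
  -- c, so differentiability would force the sum to vanish.
  have h1 : bus (fun t => c (-t)) x / dist x (c 0) = D := by
    refine tendsto_nhds_unique (((tendsto_bus (Isometry.comp_neg hc) x).comp hr).div_const _)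
      ((hs.mono_left (nhdsWithin_mono _ fun t (ht : 0 < t) => ht.ne')).congr' ?_)
    filter_upwards [self_mem_nhdsWithin] with t (ht : 0 < t)
    simp only [zero_add, Function.comp_apply, smul_eq_mul]
    rw [h0, hy, I.dist_line_inv hc hx ht.ne', abs_of_pos ht]
    field_simp
  have hr' : Tendsto (fun t : ℝ => -t) (𝓝[>] 0) (𝓝[≠] 0) := by
    refine tendsto_nhdsWithin_iff.2 ⟨?_, ?_⟩
    · have : Tendsto (fun t : ℝ => -t) (𝓝 0) (𝓝 (-0)) := tendsto_id.neg
      rw [neg_zero] at this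
      exact this.mono_left nhdsWithin_le_nhds
    · filter_upwards [self_mem_nhdsWithin] with t (ht : 0 < t)
      simpa using ht.ne'
  have h2 : -(bus c x / dist x (c 0)) = D := by
    refine tendsto_nhds_unique (((tendsto_bus hc x).comp hr).div_const _).neg
      ((hs.comp hr').congr' ?_)
    filter_upwards [self_mem_nhdsWithin] with t (ht : 0 < t)
    simp only [zero_add, Function.comp_apply, smul_eq_mul]
    rw [h0, hy, I.dist_line_inv hc hx (neg_ne_zero.2 ht.ne'), abs_neg, abs_of_pos ht, inv_neg,
      neg_neg]
    field_simp
  apply h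
  have h3 : (bus c x + bus (fun t => c (-t)) x) / dist x (c 0) = 0 := by
    rw [add_div, h1, ← h2]; ring
  rcases div_eq_zero_iff.1 h3 with h | h
  · exact h
  · exact absurd h hdx.ne'

theorem inv_inj {o : M} {x y : M} (hx : x ≠ o) (hy : y ≠ o) {r : ℝ} (hr : 0 < r)
    (h : I.inv o r x = I.inv o r y) : x = y := by
  rw [← I.inv_inv hr hx, h, I.inv_inv hr hy]

theorem tendsto_inv_nhds {o x : M} (hx : x ≠ o) {ι : Type*} {F : Filter ι} {f : ι → M}
    (hf : Tendsto f F (𝓝 x)) : Tendsto (fun i => I.inv o 1 (f i)) F (𝓝 (I.inv o 1 x)) := by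
  rw [tendsto_iff_dist_tendsto_zero]
  have h1 : Tendsto (fun i => (1 : ℝ) ^ 2 * dist (f i) x / (dist (f i) o * dist x o)) F
      (𝓝 (1 ^ 2 * dist x x / (dist x o * dist x o))) := by
    refine Tendsto.div ((hf.dist tendsto_const_nhds).const_mul _)
      ((hf.dist tendsto_const_nhds).mul_const _) ?_
    have := dist_pos.2 hx
    positivity
  rw [dist_self, mul_zero, zero_div] at h1
  refine h1.congr' ?_
  filter_upwards [hf.eventually_ne hx] with i hi
  rw [I.dist_inv_inv one_pos hi hx]

/-- The Busemann functions of the two orientations of a line add up to zero. -/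
theorem bus_add_bus_neg {c : ℝ → M} (hc : Isometry c) (x : M) :
    bus c x + bus (fun t => c (-t)) x = 0 := by
  -- A nonzero sum at x is an open condition, so all points near the inverse y have a distance
  -- function along c that is not differentiable at 0. Homotheties spread this one bad parameter
  -- over a whole interval for y itself. A Lipschitz function of a real variable is differentiable
  -- almost everywhere, which excludes that.
  by_contra hne
  have hx : x ≠ c 0 := by
    rintro rfl
    apply hne
    have h1 := bus_line hc 0
    have h2 := bus_line (Isometry.comp_neg hc) 0
    simp only [neg_zero] at h1 h2
    rw [h1, h2, add_zero]
  set o := c 0 with ho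
  set y := I.inv o 1 x with hy
  have hyo : y ≠ o := I.inv_ne one_pos hx
  have hyy : I.inv o 1 y = x := I.inv_inv one_pos hx
  -- near `y` the distance functions are not differentiable at `0`
  have hev : ∀ᶠ z in 𝓝 y, ¬ DifferentiableAt ℝ (fun t : ℝ => dist z (c t)) 0 := by
    have h1 : Tendsto (fun z => I.inv o 1 z) (𝓝 y) (𝓝 x) := by
      have := I.tendsto_inv_nhds hyo (tendsto_id (α := M) (x := 𝓝 y))
      rwa [hyy] at this
    have h2 : ∀ᶠ z in 𝓝 x, bus c z + bus (fun t => c (-t)) z ≠ 0 :=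
      ((continuous_bus hc).add (continuous_bus (Isometry.comp_neg hc))).continuousAt.eventually_ne
        hne
    filter_upwards [h1.eventually h2, eventually_ne_nhds hyo] with z hz hzo
    have := I.not_differentiableAt_dist hc (I.inv_ne one_pos hzo) hz
    rwa [← ho, I.inv_inv one_pos hzo] at this
  -- transport by homotheties with center `c 1`
  have hp : ∀ l : ℝ, ∃ k : M ≃ M, 0 < l → IsPureHom (c 1) l k ∧
      ∀ x, x ≠ c 1 → k x = I.inv (c 1) (√l) (I.inv (c 1) 1 x) := by
    intro l
    by_cases hl : 0 < l
    · obtain ⟨k, h1, h2, -⟩ := I.exists_pureHom (c 1) hl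
      exact ⟨k, fun _ => ⟨h1, h2⟩⟩
    · exact ⟨Equiv.refl M, fun h => absurd h hl⟩
  choose k hk using hp
  have hpos : ∀ᶠ l : ℝ in 𝓝 1, 0 < l := lt_mem_nhds one_pos
  have hky : Tendsto (fun l => k l y) (𝓝 1) (𝓝 y) := by
    by_cases hy1 : y = c 1
    · refine tendsto_const_nhds.congr' ?_
      filter_upwards [hpos] with l hl
      rw [hy1, (hk l hl).1.map_center]
    · have h1 := I.tendsto_inv one_pos (I.inv_ne one_pos hy1)
      rw [I.inv_inv one_pos hy1] at h1
      have h2 : Tendsto (fun l : ℝ => √l) (𝓝 1) (𝓝 1) := by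
        have := Real.continuous_sqrt.tendsto 1
        rwa [Real.sqrt_one] at this
      refine (h1.comp h2).congr' ?_
      filter_upwards [hpos] with l hl
      rw [(hk l hl).2 y hy1, Function.comp_apply]
  have hksy : Tendsto (fun l => (k l).symm y) (𝓝 1) (𝓝 y) := by
    rw [tendsto_iff_dist_tendsto_zero]
    have h1 : Tendsto (fun l : ℝ => l⁻¹ * dist (k l y) y) (𝓝 1) (𝓝 (1⁻¹ * dist y y)) :=
      (tendsto_inv₀ one_ne_zero).mul (hky.dist tendsto_const_nhds)
    rw [dist_self, mul_zero] at h1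
    refine h1.congr' ?_
    filter_upwards [hpos] with l hl
    rw [dist_comm, ← (hk l hl).1.symm.dist_map, Equiv.symm_apply_apply]
  -- The center is c 1 and not c 0 so that the homothety moves c 0, namely to c (1 - l). The
  -- preimage of y is close to y, hence bad at 0, and this transfers to y at 1 - l.
  have hnd : ∀ᶠ l : ℝ in 𝓝 1, ¬ DifferentiableAt ℝ (fun t : ℝ => dist y (c t)) (1 - l) := by
    filter_upwards [hpos, hksy.eventually hev] with l hl hl'
    intro hd
    apply hl'
    have h1 : (fun t : ℝ => dist ((k l).symm y) (c t)) =
        fun t => l⁻¹ * dist y (c (1 + l * (t - 1))) := by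
      ext t
      have h3 := (hk l hl).1.symm.dist_map y (k l (c t))
      rw [Equiv.symm_apply_apply] at h3
      rw [h3, (hk l hl).1.map_line' c hc 1 rfl]
    rw [h1]
    have h2 : HasDerivAt (fun t : ℝ => 1 + l * (t - 1)) (l * 1) 0 :=
      (((hasDerivAt_id (0 : ℝ)).sub_const 1).const_mul l).const_add 1
    have hd' : DifferentiableAt ℝ (fun t : ℝ => dist y (c t)) (1 + l * (0 - 1)) := by
      have : 1 + l * (0 - 1) = 1 - l := by ring
      rwa [this]
    exact (hd'.comp (0 : ℝ) h2.differentiableAt).const_mul _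
  obtain ⟨e, he, hball⟩ := Metric.eventually_nhds_iff.1 hnd
  have hlip : LipschitzWith 1 (fun t : ℝ => dist y (c t)) := by
    refine LipschitzWith.of_dist_le_mul fun s t => ?_
    rw [NNReal.coe_one, one_mul, ← hc.dist_eq s t]
    have := abs_dist_sub_le (c s) (c t) y
    rwa [dist_comm (c s) y, dist_comm (c t) y] at this
  have hae := hlip.ae_differentiableAt_real
  have hsub : Metric.ball (0 : ℝ) e ⊆ {t | ¬ DifferentiableAt ℝ (fun t : ℝ => dist y (c t)) t} := by
    intro t ht
    have h1 : dist (1 - t) 1 < e := by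
      rw [Metric.mem_ball, dist_zero_right] at ht
      rw [Real.dist_eq]
      simpa using ht
    have := hball h1
    rwa [sub_sub_cancel] at this
  have hz := MeasureTheory.measure_mono_null hsub hae
  exact (Metric.measure_ball_pos MeasureTheory.volume (0 : ℝ) he).ne' hz

theorem bus_neg {c : ℝ → M} (hc : Isometry c) (x : M) :
    bus (fun t => c (-t)) x = -bus c x := by
  linarith [I.bus_add_bus_neg hc x]

/-- Busemann functions are affine on lines. -/
theorem bus_affine {c m : ℝ → M} (hc : Isometry c) (hm : Isometry m) (t : ℝ) :
    bus c (m t) = bus c (m 0) + t * (bus c (m 1) - bus c (m 0)) := by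
  have h1 := I.convexOn_bus hc hm
  have h2 := I.convexOn_bus (Isometry.comp_neg hc) hm
  simp_rw [I.bus_neg hc] at h2
  -- The Busemann function and its negative, that of the reversed line, are both convex along m.
  have key : ∀ u v a b : ℝ, 0 ≤ a → 0 ≤ b → a + b = 1 →
      bus c (m (a * u + b * v)) = a * bus c (m u) + b * bus c (m v) := by
    intro u v a b ha hb hab
    have e1 := h1.2 (mem_univ u) (mem_univ v) ha hb hab
    have e2 := h2.2 (mem_univ u) (mem_univ v) ha hb hab
    simp only [smul_eq_mul] at e1 e2
    linarith
  rcases le_or_gt 1 t with h | h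
  · have ht : 0 < t := by linarith
    have := key 0 t (1 - 1 / t) (1 / t) (by rw [sub_nonneg, div_le_one ht]; exact h)
      (by positivity) (by ring)
    rw [mul_zero, zero_add, one_div_mul_cancel ht.ne'] at this
    rw [this]
    field_simp
    ring
  rcases le_or_gt 0 t with h' | h'
  · have := key 0 1 (1 - t) t (by linarith) h' (by ring)
    rw [mul_zero, zero_add, mul_one] at this
    rw [this]
    ring
  · have h3 : 0 < 1 - t := by linarith
    have := key t 1 (1 / (1 - t)) (-t / (1 - t)) (by positivity)
      (div_nonneg (by linarith) h3.le) (by field_simp; ring)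
    have e : 1 / (1 - t) * t + -t / (1 - t) * 1 = 0 := by field_simp; ring
    rw [e] at this
    rw [this]
    field_simp
    ring

end Inversions

/-! ### Parallel lines -/

theorem tendsto_inv_natCast_add_one : Tendsto (fun i : ℕ => ((i : ℝ) + 1)⁻¹) atTop (𝓝 0) := by
  simpa [one_div] using tendsto_one_div_add_atTop_nhds_zero_nat (𝕜 := ℝ)

section Lines

variable {M : Type*} [MetricSpace M]

/-- Compare x with m s by the Lipschitz property of `bus c` and let s tend to infinity. -/
theorem bus_le_of_slope {c m : ℝ → M} (hc : Isometry c) (hm : Isometry m) {k : ℝ}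
    (h : ∀ s, bus c (m s) = k - s) (x : M) : bus c x ≤ bus m x + k := by
  refine ge_of_tendsto ((tendsto_bus hm x).add_const k) (Eventually.of_forall fun s => ?_)
  have := bus_sub_le hc x (m s)
  rw [h] at this
  linarith

/-- Ultralimits of lines. -/
theorem exists_line_limit [ProperSpace M] (U : Ultrafilter ℕ) {c : ℕ → ℝ → M}
    (hc : ∀ i, Isometry (c i)) {x : M} (h : Tendsto (fun i => c i 0) U (𝓝 x)) :
    ∃ c' : ℝ → M, Isometry c' ∧ c' 0 = x ∧ ∀ t, Tendsto (fun i => c i t) U (𝓝 (c' t)) := by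
  have h1 : ∀ t, ∃ y, Tendsto (fun i => c i t) U (𝓝 y) := by
    intro t
    refine exists_tendsto_of_dist_le U _ x (|t| + 1) ?_
    filter_upwards [h.eventually (Metric.ball_mem_nhds x one_pos)] with i hi
    have := dist_triangle (c i t) (c i 0) x
    rw [isometry_real (hc i), sub_zero] at this
    have hi' : dist (c i 0) x < 1 := hi
    linarith
  choose c' hc' using h1
  refine ⟨c', Isometry.of_dist_eq fun s t => ?_, tendsto_nhds_unique (hc' 0) h, hc'⟩
  refine tendsto_nhds_unique ((hc' s).dist (hc' t)) ?_
  simp_rw [fun i => (hc i).dist_eq s t]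
  exact tendsto_const_nhds

end Lines

namespace Inversions

variable {M : Type*} [MetricSpace M] (I : Inversions M)
include I

/-- A line along which a Busemann function has slope `-1` has the same Busemann function. -/
theorem bus_eq_of_slope {c m : ℝ → M} (hc : Isometry c) (hm : Isometry m) {k : ℝ}
    (h : ∀ s, bus c (m s) = k - s) (x : M) : bus c x = bus m x + k := by
  refine le_antisymm (bus_le_of_slope hc hm h x) ?_
  have := bus_le_of_slope (Isometry.comp_neg hc) (Isometry.comp_neg hm) (k := -k)
    (fun s => by rw [I.bus_neg hc, h]; ring) x
  rw [I.bus_neg hc, I.bus_neg hm] at this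
  linarith

/-- The image of a line under a pure homothety has sublinear distance from the line. -/
theorem exists_tendsto_dist_homothety [ProperSpace M] {c : ℝ → M} (hc : Isometry c) {x : M} {l : ℝ}
    {k : M ≃ M} (hk : IsPureHom x l k) :
    ∃ U : Ultrafilter ℕ, (U : Filter ℕ) ≤ atTop ∧ Tendsto (fun i : ℕ => ((i : ℝ) + 1)⁻¹ *
      dist (k (c (l⁻¹ * ((i : ℝ) + 1)))) (c ((i : ℝ) + 1))) U (𝓝 0) := by
  have hp : ∀ i : ℕ, (0 : ℝ) < (i : ℝ) + 1 := fun i => by positivity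
  let U : Ultrafilter ℕ := Ultrafilter.of atTop
  have hU : (U : Filter ℕ) ≤ atTop := Ultrafilter.of_le atTop
  -- Viewed through the inverse of h i, the line c is unchanged while the center x of k moves to c
  -- 0. A line through the moved center is preserved by the rescaled k, so it suffices to find such
  -- lines close to c.
  choose h hh _ _ using fun i : ℕ => I.exists_pureHom (c 0) (hp i)
  have hx : Tendsto (fun i => (h i).symm x) U (𝓝 (c 0)) := by
    rw [tendsto_iff_dist_tendsto_zero]
    have : ∀ i : ℕ, dist ((h i).symm x) (c 0) = ((i : ℝ) + 1)⁻¹ * dist x (c 0) := by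
      intro i
      conv_lhs => rw [← (hh i).symm.map_center]
      rw [(hh i).symm.dist_map]
    simp_rw [this]
    have := (tendsto_inv_natCast_add_one.mul_const (dist x (c 0))).mono_left hU
    rwa [zero_mul] at this
  have hg : ∀ i, ∃ g : M ≃ M, (∀ x y, dist (g x) (g y) = dist x y) ∧ g (c 0) = (h i).symm x := by
    intro i
    obtain ⟨-, -, g, -, h1, h2, -⟩ := I.exists_isometryEquiv (c 0) ((h i).symm x)
    exact ⟨g, h1, h2⟩
  choose g hgd hgo using hg
  -- The limit e fixes c 0 but may turn c. Composing with its inverse corrects this.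
  obtain ⟨e, e1, e2, e3, -⟩ := exists_ultralimit_isometryEquiv U g (fun _ => 1) 1 one_pos
    tendsto_const_nhds (fun i x y => by rw [hgd, one_mul]) (c 0) (c 0) (by simpa only [hgo] using hx)
  have hes : e.symm (c 0) = c 0 := by rw [Equiv.symm_apply_eq, e2]
  have hei : ∀ x y, dist (e.symm x) (e.symm y) = dist x y := by
    intro x y
    have := e1 (e.symm x) (e.symm y)
    rwa [one_mul, Equiv.apply_symm_apply, Equiv.apply_symm_apply, eq_comm] at this
  -- lines that converge to `c`
  let m : ℕ → ℝ → M := fun i t => g i (e.symm (c t))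
  have hm : ∀ i, Isometry (m i) := fun i =>
    (Isometry.of_dist_eq (hgd i)).comp ((Isometry.of_dist_eq hei).comp hc)
  have hm0 : ∀ i, m i 0 = (h i).symm x := fun i => by simp only [m, hes, hgo]
  have hmc : ∀ t, Tendsto (fun i => m i t) U (𝓝 (c t)) := fun t => by
    have := e3 (e.symm (c t))
    rwa [Equiv.apply_symm_apply] at this
  -- Up to speed, h i ∘ m i is a line through x, on which k is multiplication by l.
  have hkm : ∀ i t, k (h i (m i t)) = h i (m i (l * t)) := by
    intro i t
    have h1 := hk.map_line _ ((hh i).isometry (hm i))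
      (by rw [mul_zero, hm0, Equiv.apply_symm_apply]) (((i : ℝ) + 1) * t)
    rwa [inv_mul_cancel_left₀ (hp i).ne', mul_left_comm, inv_mul_cancel_left₀ (hp i).ne'] at h1
  refine ⟨U, hU, ?_⟩
  have hlim : Tendsto (fun i => l * dist (c l⁻¹) (m i l⁻¹) + dist (m i 1) (c 1)) U (𝓝 0) := by
    have h1 := ((tendsto_const_nhds (x := c l⁻¹)).dist (hmc l⁻¹)).const_mul l
    have h2 := (hmc 1).dist (tendsto_const_nhds (x := c 1))
    have := h1.add h2
    rwa [dist_self, dist_self, mul_zero, add_zero] at this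
  refine squeeze_zero (fun i => by have := hp i; positivity) (fun i => ?_) hlim
  have h1 : c ((i : ℝ) + 1) = h i (c 1) := by rw [(hh i).map_line c hc rfl, mul_one]
  have h2 : c (l⁻¹ * ((i : ℝ) + 1)) = h i (c l⁻¹) := by rw [(hh i).map_line c hc rfl, mul_comm]
  have h3 : k (h i (m i l⁻¹)) = h i (m i 1) := by rw [hkm, mul_inv_cancel₀ hk.pos.ne']
  have h4 := dist_triangle (k (h i (c l⁻¹))) (k (h i (m i l⁻¹))) (h i (c 1))
  rw [hk.dist_map, h3, (hh i).dist_map, (hh i).dist_map] at h4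
  rw [h1, h2, inv_mul_le_iff₀ (hp i)]
  linarith

/-- Pure homotheties map lines to parallel lines. -/
theorem bus_pureHom [ProperSpace M] {c : ℝ → M} (hc : Isometry c) {x : M} {l : ℝ}
    {k : M ≃ M} (hk : IsPureHom x l k) (y : M) :
    bus c (k y) - bus c x = l * (bus c y - bus c x) := by
  set m : ℝ → M := fun t => k (c (l⁻¹ * t)) with hmdef
  have hm : Isometry m := hk.isometry hc
  obtain ⟨U, hU, hlim⟩ := I.exists_tendsto_dist_homothety hc hk
  have hp : ∀ i : ℕ, (0 : ℝ) < (i : ℝ) + 1 := fun i => by positivity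
  -- Along m the function `bus c` is affine, and along c it has slope -1. Sublinear distance between
  -- the two lines forces equal slopes.
  have hslope : bus c (m 1) - bus c (m 0) = -1 := by
    have h1 : Tendsto (fun i : ℕ => ((i : ℝ) + 1)⁻¹ * bus c (m 0) +
        (bus c (m 1) - bus c (m 0) + 1)) U (𝓝 (0 * bus c (m 0) +
        (bus c (m 1) - bus c (m 0) + 1))) :=
      ((tendsto_inv_natCast_add_one.mono_left hU).mul_const _).add_const _
    have h2 : Tendsto (fun i : ℕ => ((i : ℝ) + 1)⁻¹ * bus c (m 0) +
        (bus c (m 1) - bus c (m 0) + 1)) U (𝓝 0) := by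
      refine squeeze_zero_norm (fun i => ?_) hlim
      have h3 := abs_bus_sub_le hc (m ((i : ℝ) + 1)) (c ((i : ℝ) + 1))
      rw [bus_line hc, I.bus_affine hc hm] at h3
      have h4 : ((i : ℝ) + 1)⁻¹ * bus c (m 0) + (bus c (m 1) - bus c (m 0) + 1) =
          ((i : ℝ) + 1)⁻¹ * (bus c (m 0) + ((i : ℝ) + 1) * (bus c (m 1) - bus c (m 0)) -
            -((i : ℝ) + 1)) := by
        have := (hp i).ne'
        field_simp
        ring
      rw [h4, Real.norm_eq_abs, abs_mul, abs_of_pos (inv_pos.2 (hp i))]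
      exact mul_le_mul_of_nonneg_left h3 (inv_pos.2 (hp i)).le
    have := tendsto_nhds_unique h1 h2
    linarith
  have hb := I.bus_eq_of_slope hc hm (k := bus c (m 0)) (fun s => by
    rw [I.bus_affine hc hm s, hslope]; ring)
  have hmk : ∀ z, bus m (k z) = l * bus c z := fun z => bus_homothety hc hk.pos hk.dist_map z
  have e1 := hb (k y)
  have e2 := hb (k x)
  rw [hmk] at e1 e2
  rw [hk.map_center] at e2
  linarith

/-- Through every point there is a line parallel to a given one. -/
theorem exists_parallel [ProperSpace M] {c : ℝ → M} (hc : Isometry c) (x : M) :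
    ∃ c' : ℝ → M, Isometry c' ∧ c' 0 = x ∧ ∀ y, bus c' y = bus c y - bus c x := by
  have hp : ∀ i : ℕ, (0 : ℝ) < ((i : ℝ) + 1)⁻¹ := fun i => by positivity
  let U : Ultrafilter ℕ := Ultrafilter.of atTop
  have hU : (U : Filter ℕ) ≤ atTop := Ultrafilter.of_le atTop
  have hlim := tendsto_inv_natCast_add_one.mono_left hU
  -- Contractions about x pull c towards x without changing the slope of `bus c` on it, so the limit
  -- line passes through x with the same slope.
  choose k hk _ _ using fun i : ℕ => I.exists_pureHom x (hp i)
  have h0 : Tendsto (fun i : ℕ => k i (c ((((i : ℝ) + 1)⁻¹)⁻¹ * 0))) U (𝓝 x) := by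
    rw [tendsto_iff_dist_tendsto_zero]
    have : ∀ i : ℕ, dist (k i (c ((((i : ℝ) + 1)⁻¹)⁻¹ * 0))) x =
        ((i : ℝ) + 1)⁻¹ * dist (c 0) x := by
      intro i
      rw [mul_zero]
      conv_lhs => rw [← (hk i).map_center, (hk i).dist_map]
    simp_rw [this]
    simpa using hlim.mul_const (dist (c 0) x)
  obtain ⟨c', h1, h2, h3⟩ := exists_line_limit U (fun i => (hk i).isometry hc) h0
  refine ⟨c', h1, h2, fun y => ?_⟩
  have hs : ∀ s, bus c (c' s) = bus c x - s := by
    intro s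
    refine tendsto_nhds_unique (((continuous_bus hc).tendsto _).comp (h3 s)) ?_
    have h5 : Tendsto (fun i : ℕ => bus c x - s - ((i : ℝ) + 1)⁻¹ * bus c x) U
        (𝓝 (bus c x - s - 0 * bus c x)) := (hlim.mul_const _).const_sub _
    rw [zero_mul, sub_zero] at h5
    refine h5.congr fun i => ?_
    have h6 := I.bus_pureHom hc (hk i) (c ((((i : ℝ) + 1)⁻¹)⁻¹ * s))
    rw [bus_line hc, mul_sub, mul_neg, mul_inv_cancel_left₀ (hp i).ne'] at h6
    simp only [Function.comp_apply]
    linarith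
  rw [I.bus_eq_of_slope hc h1 hs y]
  ring

/-- The isometries that translate all Busemann functions are transitive. -/
theorem exists_translation [ProperSpace M] (o o' : M) :
    ∃ g : M ≃ M, (∀ x y, dist (g x) (g y) = dist x y) ∧ g o = o' ∧
      ∀ c : ℝ → M, Isometry c → ∀ z, bus c (g z) = bus c z + bus c o' - bus c o := by
  obtain ⟨U, f, g, hU, h1, h2, h3, h4⟩ := I.exists_isometryEquiv o o'
  refine ⟨g, h1, h2, fun c hc z => ?_⟩
  refine tendsto_nhds_unique (((continuous_bus hc).tendsto _).comp (h3 z)) ?_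
  -- Expansion by i + 1 about o followed by contraction about o' is a translation on Busemann
  -- values, up to an error of order 1 / (i + 1) caused by the different centers.
  have h5 : Tendsto (fun i : ℕ => bus c z + bus c o' - bus c o +
      ((i : ℝ) + 1)⁻¹ * (bus c o - bus c o')) U
      (𝓝 (bus c z + bus c o' - bus c o + 0 * (bus c o - bus c o'))) :=
    ((tendsto_inv_natCast_add_one.mono_left hU).mul_const _).const_add _
  rw [zero_mul, add_zero] at h5
  refine h5.congr fun i => ?_
  obtain ⟨h, h', hh, hh', hf⟩ := h4 i
  have e1 := I.bus_pureHom hc hh z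
  have e2 := I.bus_pureHom hc hh'.symm (h z)
  have e3 : bus c (h z) = bus c o + ((i : ℝ) + 1) * (bus c z - bus c o) := by linarith
  have hp : ((i : ℝ) + 1) ≠ 0 := hh.pos.ne'
  rw [Function.comp_apply, hf, sub_eq_iff_eq_add.1 e2, e3]
  field_simp
  ring

/-- If the Busemann functions separate points, then any two points are on a line. -/
theorem exists_line_of_separate [ProperSpace M]
    (hsep : ∀ x y : M, (∀ c : ℝ → M, Isometry c → bus c x = bus c y) → x = y) (x y : M) :
    ∃ c : ℝ → M, Isometry c ∧ c 0 = x ∧ ∃ t, c t = y := by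
  rcases eq_or_ne x y with rfl | hxy
  · obtain ⟨c, hc, h0⟩ := I.exists_line_through x
    exact ⟨c, hc, h0, 0, h0⟩
  have hd : 0 < dist x y := dist_pos.2 hxy
  -- For every Busemann function, p has the value of a point at parameter l on a line with x at 0
  -- and y at 1. Such a point is unique by separation. Homotheties about x provide it for l > 0; for
  -- l < 0, a translation taking the point of parameter -l to x takes x to it.
  let Q : ℝ → M → Prop := fun l p =>
    ∀ c : ℝ → M, Isometry c → bus c p = bus c x + l * (bus c y - bus c x)
  have huniq : ∀ l p q, Q l p → Q l q → p = q := fun l p q h1 h2 =>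
    hsep p q fun c hc => by rw [h1 c hc, h2 c hc]
  have hposq : ∀ l : ℝ, 0 < l → ∃ p, Q l p ∧ dist x p = l * dist x y := by
    intro l hl
    obtain ⟨k, hk, -⟩ := I.exists_pureHom x hl
    refine ⟨k y, fun c hc => by linarith [I.bus_pureHom hc hk y], ?_⟩
    conv_lhs => rw [← hk.map_center, hk.dist_map]
  have hex : ∀ l : ℝ, ∃ p, Q l p := by
    intro l
    rcases lt_trichotomy l 0 with hl | hl | hl
    · obtain ⟨p, hp, -⟩ := hposq (-l) (by linarith)
      obtain ⟨g, -, -, hg⟩ := I.exists_translation p x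
      refine ⟨g x, fun c hc => ?_⟩
      rw [hg c hc, hp c hc]
      ring
    · exact ⟨x, fun c hc => by rw [hl]; ring⟩
    · obtain ⟨p, hp, -⟩ := hposq l hl
      exact ⟨p, hp⟩
  choose P hP using hex
  -- A translation taking P l to x takes P l' to the point of parameter l' - l, whose distance from
  -- x is given by the homothety.
  have hPd : ∀ l l', l < l' → dist (P l) (P l') = (l' - l) * dist x y := by
    intro l l' hl
    obtain ⟨g, hgd, hgx, hg⟩ := I.exists_translation (P l) x
    obtain ⟨p, hp, hpd⟩ := hposq (l' - l) (by linarith)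
    have : g (P l') = p := by
      refine huniq (l' - l) _ _ (fun c hc => ?_) hp
      rw [hg c hc, hP l c hc, hP l' c hc]
      ring
    rw [← hgd, hgx, this, hpd]
  refine ⟨fun t => P ((dist x y)⁻¹ * t), Isometry.of_dist_eq fun s t => ?_, ?_, dist x y, ?_⟩
  · have key : ∀ s t : ℝ, s < t →
        dist (P ((dist x y)⁻¹ * s)) (P ((dist x y)⁻¹ * t)) = dist s t := by
      intro s t hst
      rw [hPd _ _ (mul_lt_mul_of_pos_left hst (inv_pos.2 hd)), dist_comm s, Real.dist_eq,
        abs_of_pos (sub_pos.2 hst)]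
      field_simp
    rcases lt_trichotomy s t with h | h | h
    · exact key s t h
    · rw [h, dist_self, dist_self]
    · rw [dist_comm, key t s h, dist_comm]
  · refine huniq 0 _ _ ?_ (fun c hc => by ring)
    have := hP ((dist x y)⁻¹ * 0)
    rw [mul_zero] at this
    simpa only [mul_zero] using this
  · refine huniq 1 _ _ ?_ (fun c hc => by ring)
    have := hP ((dist x y)⁻¹ * dist x y)
    rw [inv_mul_cancel₀ hd.ne'] at this
    simpa only [inv_mul_cancel₀ hd.ne'] using this

/-- The inverse of the line through a point of a compact set need not remain in the set: a compact
set is not everywhere tangent to parallel lines. -/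
theorem exists_inv_notMem [ProperSpace M] {B : Set M} (hB : IsCompact B) (hB2 : B.Nontrivial) :
    ∃ p ∈ B, ∃ z ∈ B, z ≠ p ∧ ∃ c : ℝ → M, Isometry c ∧ c 0 = I.inv p 1 z ∧
      ∃ t, c t ≠ p ∧ I.inv p 1 (c t) ∉ B := by
  obtain ⟨c₀, hc₀⟩ := I.exists_line
  -- At p the function `bus c₀` is largest on B. The inverse about p of a parallel c to c₀ is, close
  -- to p, almost a line through p parallel to c₀. It therefore contains points above the maximum.
  obtain ⟨p, hpB, hmax⟩ := hB.exists_isMaxOn hB2.nonempty (continuous_bus hc₀).continuousOn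
  obtain ⟨z, hzB, hzp⟩ := hB2.exists_ne p
  obtain ⟨c, hc, hc0, hcb⟩ := I.exists_parallel hc₀ (I.inv p 1 z)
  refine ⟨p, hpB, z, hzB, hzp, c, hc, hc0, ?_⟩
  have hb : ∀ s, bus c₀ (c s) = bus c₀ (I.inv p 1 z) - s := fun s => by
    have := hcb (c s)
    rw [bus_line hc] at this
    linarith
  have hp : ∀ i : ℕ, (0 : ℝ) < (i : ℝ) + 1 := fun i => by positivity
  let U : Ultrafilter ℕ := Ultrafilter.of atTop
  have hU : (U : Filter ℕ) ≤ atTop := Ultrafilter.of_le atTop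
  have hlim := tendsto_inv_natCast_add_one.mono_left hU
  choose h hh _ hinv using fun i : ℕ => I.exists_pureHom p (hp i)
  have h0 : Tendsto (fun i : ℕ => (h i).symm (c ((((i : ℝ) + 1)⁻¹)⁻¹ * 0))) U (𝓝 p) := by
    rw [tendsto_iff_dist_tendsto_zero]
    have : ∀ i : ℕ, dist ((h i).symm (c ((((i : ℝ) + 1)⁻¹)⁻¹ * 0))) p =
        ((i : ℝ) + 1)⁻¹ * dist (c 0) p := by
      intro i
      rw [mul_zero]
      conv_lhs => rw [← (hh i).symm.map_center, (hh i).symm.dist_map]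
    simp_rw [this]
    simpa using hlim.mul_const (dist (c 0) p)
  obtain ⟨c', h1, h2, h3⟩ := exists_line_limit U (fun i => (hh i).symm.isometry hc) h0
  have hs : ∀ s, bus c₀ (c' s) = bus c₀ p - s := by
    intro s
    refine tendsto_nhds_unique (((continuous_bus hc₀).tendsto _).comp (h3 s)) ?_
    have h5 : Tendsto (fun i : ℕ => bus c₀ p - s +
        ((i : ℝ) + 1)⁻¹ * (bus c₀ (I.inv p 1 z) - bus c₀ p)) U
        (𝓝 (bus c₀ p - s + 0 * (bus c₀ (I.inv p 1 z) - bus c₀ p))) :=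
      (hlim.mul_const _).const_add _
    rw [zero_mul, add_zero] at h5
    refine h5.congr fun i => ?_
    have h6 := I.bus_pureHom hc₀ (hh i).symm (c ((((i : ℝ) + 1)⁻¹)⁻¹ * s))
    rw [hb] at h6
    have := (hp i).ne'
    rw [Function.comp_apply, sub_eq_iff_eq_add.1 h6]
    field_simp
    ring
  have hc1 : c' 1 ≠ p := by
    rw [← h2]; exact fun h => one_ne_zero (h1.injective h)
  have h4 := I.tendsto_inv_nhds hc1 (h3 1)
  rw [I.inv_line one_pos h1 h2 one_ne_zero] at h4
  have h5 := ((continuous_bus hc₀).tendsto _).comp h4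
  rw [hs] at h5
  -- The inverse of c' 1 is c' (-1), where `bus c₀` exceeds its value at p by 1. The strict
  -- inequality persists for a nearby rescaled point of c.
  have h6 := (h5.eventually (lt_mem_nhds (show bus c₀ p < bus c₀ p - -1 ^ 2 / 1 by norm_num))).and
    ((h3 1).eventually_ne hc1)
  obtain ⟨i, hi1, hi2⟩ := h6.exists
  set w := (h i).symm (c ((((i : ℝ) + 1)⁻¹)⁻¹ * 1)) with hw
  refine ⟨(((i : ℝ) + 1)⁻¹)⁻¹ * 1, ?_, ?_⟩
  · intro h7
    apply hi2
    rw [hw, h7, (hh i).symm.map_center]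
  · intro h7
    have h8 : c ((((i : ℝ) + 1)⁻¹)⁻¹ * 1) = h i w := by rw [hw, Equiv.apply_symm_apply]
    -- Inverting after an expansion about p is contracting after inverting, and a contraction about
    -- p keeps the sign of the difference of Busemann values to p.
    rw [h8, hinv i w hi2] at h7
    have h9 := I.bus_pureHom hc₀ (hh i).symm (I.inv p 1 w)
    have h10 : bus c₀ ((h i).symm (I.inv p 1 w)) ≤ bus c₀ p := hmax h7
    have h11 : bus c₀ p < bus c₀ (I.inv p 1 w) := hi1
    have := mul_pos (inv_pos.2 (hp i)) (sub_pos.2 h11)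
    linarith

end Inversions

/-! ### Spaces in which any two points lie on a line are Euclidean -/

/-- The hypothesis on `core` is the expansion of ‖f x - f y‖² = dist x y ^ 2, written before a norm
is chosen on W. Properness makes the unit ball of W compact, hence W finite-dimensional. -/
theorem exists_isometryEquiv_of_core {M W : Type*} [MetricSpace M] [ProperSpace M]
    [AddCommGroup W] [Module ℝ W] (core : InnerProductSpace.Core ℝ W) (f : M → W)
    (hsurj : Function.Surjective f)
    (hf : ∀ x y, core.inner (f x) (f x) - 2 * core.inner (f x) (f y) + core.inner (f y) (f y) =
      dist x y ^ 2) :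
    ∃ n : ℕ, Nonempty (M ≃ᵢ EuclideanSpace ℝ (Fin n)) := by
  let _ : NormedAddCommGroup W := core.toNormedAddCommGroup
  let _ : InnerProductSpace ℝ W := InnerProductSpace.ofCore core.toCore
  have hinner : ∀ v w : W, inner ℝ v w = core.inner v w := fun _ _ => rfl
  have hiso : Isometry f := by
    refine Isometry.of_dist_eq fun x y => ?_
    rw [← sq_eq_sq₀ dist_nonneg dist_nonneg, dist_eq_norm, norm_sub_sq_real,
      ← real_inner_self_eq_norm_sq, ← real_inner_self_eq_norm_sq, hinner, hinner, hinner, hf]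
  let F : M ≃ᵢ W := IsometryEquiv.mk' f (Function.surjInv hsurj) (Function.surjInv_eq hsurj) hiso
  have hcomp : IsCompact (Metric.closedBall (0 : W) 1) := by
    have := (isCompact_closedBall (F.symm 0) (1 : ℝ)).image F.continuous
    rwa [F.image_closedBall, F.apply_symm_apply] at this
  have : FiniteDimensional ℝ W := FiniteDimensional.of_isCompact_closedBall₀ ℝ one_pos hcomp
  exact ⟨_, ⟨F.trans (stdOrthonormalBasis ℝ W).repr.toIsometryEquiv⟩⟩

namespace Inversions

variable {M : Type*} [MetricSpace M] (I : Inversions M)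
include I

/-- The slopes of the Busemann functions of two lines through a point along each other agree. -/
theorem slope_symm {c m : ℝ → M} (hc : Isometry c) (hm : Isometry m) (h : m 0 = c 0) :
    bus m (c 1) = bus c (m 1) := by
  -- The unit inversion followed by the homothety of ratio s takes m s and c 1 to m (-1) and c (-s).
  -- It divides their distance by s and multiplies it back.
  have hd : ∀ s : ℝ, 0 < s → dist (c 1) (m s) = dist (m (-1)) (c (-s)) := by
    intro s hs
    have hm1 : m s ≠ c 0 := by rw [← h]; exact fun e => hs.ne' (hm.injective e)
    have hc1 : c 1 ≠ c 0 := fun e => one_ne_zero (hc.injective e)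
    have h1 := I.dist_inv_inv one_pos hm1 hc1
    rw [I.inv_line one_pos hm h hs.ne', I.inv_line one_pos hc rfl one_ne_zero] at h1
    obtain ⟨k, hk, -⟩ := I.exists_pureHom (c 0) hs
    have h2 := hk.dist_map (m (-1 ^ 2 / s)) (c (-1 ^ 2 / 1))
    have e1 : dist (m s) (c 0) = s := by
      rw [← h, isometry_real hm, sub_zero, abs_of_pos hs]
    have e2 : dist (c 1) (c 0) = 1 := by simp [isometry_real hc]
    rw [hk.map_line m hm h, hk.map_line c hc rfl, h1, e1, e2] at h2
    rw [dist_comm, show (-1 : ℝ) = s * (-1 ^ 2 / s) by field_simp,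
      show -s = s * (-1 ^ 2 / 1) by ring, h2]
    field_simp
  have h1 : bus m (c 1) = bus (fun t => c (-t)) (m (-1)) := by
    refine tendsto_nhds_unique (tendsto_bus hm (c 1))
      ((tendsto_bus (Isometry.comp_neg hc) (m (-1))).congr' ?_)
    filter_upwards [eventually_gt_atTop 0] with s hs
    rw [hd s hs]
  have h2 := bus_line hc 0
  rw [h1, I.bus_neg hc, I.bus_affine hc hm, h, h2]
  ring

/-- The derivative of the square of the distance to a point along a line. -/
theorem hasDerivWithinAt_dist_sq {x : M} {c : ℝ → M} (hc : Isometry c) (a : ℝ)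
    (hx : ∃ m : ℝ → M, Isometry m ∧ m 0 = c a ∧ ∃ t, m t = x) :
    HasDerivWithinAt (fun t => dist x (c t) ^ 2) (2 * (a + bus c x)) (Ici a) a := by
  rcases eq_or_ne x (c a) with rfl | hne
  · have h1 : (fun t => dist (c a) (c t) ^ 2) = fun t => (t - a) ^ 2 := by
      ext t
      rw [isometry_real hc, sq_abs]; ring
    rw [h1, bus_line hc]
    have := ((hasDerivAt_id a).sub_const a).pow 2
    convert! this.hasDerivWithinAt using 1
    simp
  obtain ⟨m, R, hm, hm0, hR, hmR⟩ : ∃ (m : ℝ → M) (R : ℝ), Isometry m ∧ m 0 = c a ∧ 0 < R ∧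
      m R = x := by
    obtain ⟨m, hm, hm0, t, ht⟩ := hx
    rcases lt_trichotomy t 0 with h | h | h
    · exact ⟨fun s => m (-s), -t, Isometry.comp_neg hm, by simpa using hm0, by linarith,
        by simpa using ht⟩
    · rw [← ht, h, hm0] at hne
      exact absurd rfl hne
    · exact ⟨m, t, hm, hm0, h, ht⟩
  set e : ℝ → M := fun t => c (a + t) with he
  have hei : Isometry e := Isometry.comp_add hc a
  have he0 : m 0 = e 0 := by rw [hm0, he]; simp
  have hfa : dist x (c a) = R := by
    rw [← hmR, ← hm0, isometry_real hm, sub_zero, abs_of_pos hR]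
  -- By symmetry this is the slope of `bus e` along m, readable from its values at m 0 = e 0 and m R
  -- = x.
  have hslope : bus m (e 1) = (a + bus c x) / R := by
    have h1 := I.bus_affine hei hm R
    rw [hmR, he0, bus_line hei, bus_shift hc, ← I.slope_symm hei hm he0] at h1
    rw [eq_div_iff hR.ne']
    linarith
  -- Rescaling about c a by 1 / (t - a) turns the difference quotient into dist (e 1) (m s) - s with
  -- s = R / (t - a), and its limit is `bus m (e 1)`.
  have hder : HasDerivWithinAt (fun t => dist x (c t)) ((a + bus c x) / R) (Ici a) a := by
    rw [← hasDerivWithinAt_Ioi_iff_Ici, hasDerivWithinAt_iff_tendsto_slope' self_notMem_Ioi,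
      ← hslope]
    have h1 : Tendsto (fun t : ℝ => R * (t - a)⁻¹) (𝓝[>] a) atTop := by
      have h2 : Tendsto (fun t : ℝ => t - a) (𝓝[>] a) (𝓝[>] 0) := by
        refine tendsto_nhdsWithin_iff.2 ⟨?_, ?_⟩
        · have : Tendsto (fun t : ℝ => t - a) (𝓝 a) (𝓝 (a - a)) := tendsto_id.sub_const a
          rw [sub_self] at this
          exact this.mono_left nhdsWithin_le_nhds
        · filter_upwards [self_mem_nhdsWithin] with t (ht : a < t)
          exact sub_pos.2 ht
      exact (tendsto_inv_nhdsGT_zero.comp h2).const_mul_atTop hR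
    refine ((tendsto_bus hm (e 1)).comp h1).congr' ?_
    filter_upwards [self_mem_nhdsWithin] with t (ht : a < t)
    have hh : 0 < t - a := sub_pos.2 ht
    obtain ⟨k, hk, -⟩ := I.exists_pureHom (m 0) hh
    have h3 := hk.dist_map (e 1) (m (R * (t - a)⁻¹))
    rw [hk.map_line m hm rfl, hk.map_line e hei he0.symm, mul_one, mul_comm R,
      mul_inv_cancel_left₀ hh.ne', hmR, dist_comm _ x] at h3
    have h4 : e (t - a) = c t := by rw [he]; simp
    rw [h4] at h3
    rw [slope_def_field, hfa, h3, Function.comp_apply, mul_comm R]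
    field_simp
  have := hder.pow 2
  rw [hfa] at this
  convert! this using 1
  field_simp
  norm_num
  exact Or.inl (mul_comm _ _)

/-- The law of cosines. -/
theorem dist_sq_line {x : M} {c : ℝ → M} (hc : Isometry c)
    (hx : ∀ y, ∃ m : ℝ → M, Isometry m ∧ m 0 = y ∧ ∃ t, m t = x) (t : ℝ) :
    dist x (c t) ^ 2 = dist x (c 0) ^ 2 + 2 * t * bus c x + t ^ 2 := by
  have key : ∀ a b, a ≤ b → dist x (c b) ^ 2 - (b ^ 2 + 2 * b * bus c x) =
      dist x (c a) ^ 2 - (a ^ 2 + 2 * a * bus c x) := by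
    intro a b hab
    refine constant_of_has_deriv_right_zero (a := a) (b := b)
      (f := fun t => dist x (c t) ^ 2 - (t ^ 2 + 2 * t * bus c x)) ?_ (fun t _ => ?_) b
      (right_mem_Icc.2 hab)
    · have : Continuous fun t : ℝ => dist x (c t) ^ 2 - (t ^ 2 + 2 * t * bus c x) := by
        have := hc.continuous
        fun_prop
      exact this.continuousOn
    · have h1 := I.hasDerivWithinAt_dist_sq hc t (hx (c t))
      have h2 : HasDerivAt (fun t : ℝ => t ^ 2 + 2 * t * bus c x) (2 * (t + bus c x)) t := by
        have := ((hasDerivAt_id t).pow 2).add (((hasDerivAt_id t).const_mul 2).mul_const (bus c x))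
        convert! this using 1
        simp
        ring
      have := h1.sub h2.hasDerivWithinAt
      rwa [sub_self] at this
  have h1 := key (min 0 t) t (min_le_right _ _)
  have h2 := key (min 0 t) 0 (min_le_left _ _)
  rw [← h2] at h1
  linarith

/-- If any two points lie on a line, then the space is Euclidean. -/
theorem exists_isometryEquiv_euclideanSpace [ProperSpace M]
    (hall : ∀ x y : M, ∃ c : ℝ → M, Isometry c ∧ c 0 = x ∧ ∃ t, c t = y) :
    ∃ n : ℕ, Nonempty (M ≃ᵢ EuclideanSpace ℝ (Fin n)) := by
  obtain ⟨c₀, -⟩ := I.exists_line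
  set o : M := c₀ 0
  -- This is the Gram kernel ⟨x - o, z - o⟩, and the functions K x serve as vectors. The law of
  -- cosines makes K affine along lines, so these functions are closed under scaling (along lines
  -- through o) and under sums (twice a midpoint).
  let K : M → M → ℝ := fun x z => (dist o x ^ 2 + dist o z ^ 2 - dist x z ^ 2) / 2
  have hK : ∀ x z, K x z = (dist o x ^ 2 + dist o z ^ 2 - dist x z ^ 2) / 2 := fun _ _ => rfl
  have hKsymm : ∀ x z, K x z = K z x := fun x z => by rw [hK, hK, dist_comm x z]; ring
  have hKo : ∀ z, K o z = 0 := fun z => by rw [hK, dist_self]; ring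
  have hline : ∀ (c : ℝ → M), Isometry c → ∀ z t,
      K (c t) z = K (c 0) z + t * (bus c o - bus c z) := by
    intro c hc z t
    have h1 := I.dist_sq_line hc (fun y => hall y z) t
    have h2 := I.dist_sq_line hc (fun y => hall y o) t
    rw [hK, hK, dist_comm (c t) z, dist_comm (c 0) z, h1, h2]
    ring
  have hsmul : ∀ (a : ℝ) (x : M), ∃ y, ∀ z, K y z = a * K x z := by
    intro a x
    obtain ⟨c, hc, h0, t, ht⟩ := hall o x
    refine ⟨c (a * t), fun z => ?_⟩
    have h1 := hline c hc z t
    rw [hline c hc, h0, hKo, zero_add]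
    rw [h0, hKo, zero_add, ht] at h1
    rw [h1, mul_assoc]
  let W : Submodule ℝ (M → ℝ) :=
    { carrier := range K
      zero_mem' := ⟨o, funext hKo⟩
      add_mem' := by
        rintro _ _ ⟨x, rfl⟩ ⟨y, rfl⟩
        obtain ⟨c, hc, h0, t, ht⟩ := hall x y
        obtain ⟨w, hw⟩ := hsmul 2 (c (t / 2))
        refine ⟨w, funext fun z => ?_⟩
        have h1 := hline c hc z t
        have h2 := hline c hc z (t / 2)
        rw [ht, h0] at h1
        rw [h0] at h2
        rw [hw, Pi.add_apply, h1, h2]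
        ring
      smul_mem' := by
        rintro a _ ⟨x, rfl⟩
        obtain ⟨y, hy⟩ := hsmul a x
        exact ⟨y, funext hy⟩ }
  have hpt : ∀ w : W, ∃ x, K x = w.1 := fun w => w.2
  choose pt hpt using hpt
  have hsymmW : ∀ v w : W, v.1 (pt w) = w.1 (pt v) := fun v w => by
    rw [← hpt v, ← hpt w, hKsymm]
  have hself : ∀ v : W, v.1 (pt v) = dist o (pt v) ^ 2 := fun v => by
    rw [← hpt v, hK, dist_self]; ring
  let core : InnerProductSpace.Core ℝ W :=
    { inner := fun v w => v.1 (pt w)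
      conj_inner_symm := fun v w => by simpa using hsymmW w v
      re_inner_nonneg := fun v => by
        change 0 ≤ v.1 (pt v)
        rw [hself]; positivity
      add_left := fun u v w => rfl
      smul_left := fun u v a => rfl
      definite := fun v hv => by
        change v.1 (pt v) = 0 at hv
        rw [hself, sq_eq_zero_iff, dist_eq_zero] at hv
        ext z
        rw [← hpt v, ← hv, hKo]
        rfl }
  let f : M → W := fun x => ⟨K x, x, rfl⟩
  have hf : ∀ x y, core.inner (f x) (f y) = K x y := fun x y => by
    change K x (pt (f y)) = K x y
    rw [hKsymm, hpt, hKsymm]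
  refine exists_isometryEquiv_of_core core f (fun w => ⟨pt w, Subtype.ext (hpt w)⟩) fun x y => ?_
  rw [hf, hf, hf, hK, hK, hK, dist_self, dist_self]
  ring

end Inversions

/-! ### Maps of the cube that preserve the faces -/

section Cube

variable {n : ℕ}

/-- The unit cube. -/
def cube (n : ℕ) : Set (EuclideanSpace ℝ (Fin n)) := {x | ∀ i, x i ∈ Icc (0 : ℝ) 1}

theorem isClosed_cube : IsClosed (cube n) := by
  have : cube n = ⋂ i, {x | x i ∈ Icc (0 : ℝ) 1} := by ext; simp [cube]
  rw [this]
  refine isClosed_iInter fun i => isClosed_Icc.preimage ?_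
  fun_prop

theorem isCompact_cube : IsCompact (cube n) := by
  have h : IsCompact (Set.pi univ fun _ : Fin n => Icc (0 : ℝ) 1) :=
    isCompact_univ_pi fun _ => isCompact_Icc
  have h2 := h.image (PiLp.continuous_toLp 2 (fun _ : Fin n => ℝ))
  convert h2 using 1
  ext x
  constructor
  · intro hx
    exact ⟨fun i => x i, fun i _ => hx i, rfl⟩
  · rintro ⟨y, hy, rfl⟩ i
    exact hy i (mem_univ i)

theorem convex_cube : Convex ℝ (cube n) := by
  intro x hx y hy a b ha hb hab i
  exact convex_Icc (0 : ℝ) 1 (hx i) (hy i) ha hb hab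

theorem volume_cube_pos : 0 < MeasureTheory.volume (cube n) := by
  refine MeasureTheory.Measure.measure_pos_of_mem_nhds _ (x := WithLp.toLp 2 fun _ => 1 / 2) ?_
  have : ∀ i : Fin n, ∀ᶠ x : EuclideanSpace ℝ (Fin n) in 𝓝 (WithLp.toLp 2 fun _ => 1 / 2),
      x i ∈ Icc (0 : ℝ) 1 := by
    intro i
    have hc : Continuous fun x : EuclideanSpace ℝ (Fin n) => x i := by fun_prop
    refine hc.continuousAt.eventually (Icc_mem_nhds ?_ ?_) <;> norm_num
  exact eventually_all.2 this

/-- The projection to the cube. -/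
noncomputable def clamp (x : EuclideanSpace ℝ (Fin n)) : EuclideanSpace ℝ (Fin n) :=
  WithLp.toLp 2 fun i => max 0 (min 1 (x i))

theorem clamp_apply (x : EuclideanSpace ℝ (Fin n)) (i : Fin n) :
    clamp x i = max 0 (min 1 (x i)) := rfl

theorem clamp_mem (x : EuclideanSpace ℝ (Fin n)) : clamp x ∈ cube n := fun i => by
  rw [clamp_apply]
  exact ⟨le_max_left _ _, max_le zero_le_one (min_le_left _ _)⟩

theorem dist_le_of_forall_abs_sub_le {x y x' y' : EuclideanSpace ℝ (Fin n)}
    (h : ∀ i, |x i - y i| ≤ |x' i - y' i|) : dist x y ≤ dist x' y' := by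
  rw [EuclideanSpace.dist_eq, EuclideanSpace.dist_eq]
  refine Real.sqrt_le_sqrt (Finset.sum_le_sum fun i _ => ?_)
  rw [Real.dist_eq, Real.dist_eq]
  exact pow_le_pow_left₀ (abs_nonneg _) (h i) 2

theorem dist_clamp_le (x y : EuclideanSpace ℝ (Fin n)) : dist (clamp x) (clamp y) ≤ dist x y := by
  refine dist_le_of_forall_abs_sub_le fun i => ?_
  rw [clamp_apply, clamp_apply]
  calc |max 0 (min 1 (x i)) - max 0 (min 1 (y i))| ≤ |min 1 (x i) - min 1 (y i)| := by
        rw [max_comm 0, max_comm 0]; exact abs_max_sub_max_le_abs _ _ _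
    _ ≤ |x i - y i| := by
        have := abs_min_sub_min_le_max 1 (x i) 1 (y i)
        simpa using this

theorem clamp_of_mem {x : EuclideanSpace ℝ (Fin n)} (hx : x ∈ cube n) : clamp x = x := by
  ext i
  rw [clamp_apply, min_eq_right (hx i).2, max_eq_right (hx i).1]

/-- The determinant of `1 + A` as a combination of the determinants of `1 + t A`. -/
theorem det_one_add_eq_sum (A : EuclideanSpace ℝ (Fin n) →L[ℝ] EuclideanSpace ℝ (Fin n))
    {t : Fin (n + 1) → ℝ} (ht : Function.Injective t) :
    (1 + A).det =
      ∑ j, (Lagrange.basis Finset.univ t j).eval 1 * (1 + t j • A).det := by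
  let b := (EuclideanSpace.basisFun (Fin n) ℝ).toBasis
  let T : Matrix (Fin n) (Fin n) ℝ := LinearMap.toMatrix b b A
  -- As a function of s, det (1 + s A) is a polynomial of degree at most n, so n + 1 values
  -- determine it.
  let q : Polynomial ℝ := Matrix.det ((Polynomial.X : Polynomial ℝ) • T.map Polynomial.C +
    (1 : Matrix (Fin n) (Fin n) ℝ).map Polynomial.C)
  have hq : ∀ s : ℝ, q.eval s = (1 + s • A).det := by
    intro s
    have h1 : q.eval s = (s • T + 1).det := by
      rw [← Polynomial.coe_evalRingHom, RingHom.map_det]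
      congr 1
      ext i j
      by_cases hij : i = j <;> simp [hij] <;> exact mul_comm _ _
    rw [h1, ContinuousLinearMap.det, ← LinearMap.det_toMatrix b]
    congr 1
    simp [T, add_comm]
  have hdeg : q.degree < (Finset.univ : Finset (Fin (n + 1))).card := by
    have h1 := Polynomial.natDegree_det_X_add_C_le T (1 : Matrix (Fin n) (Fin n) ℝ)
    refine lt_of_le_of_lt Polynomial.degree_le_natDegree ?_
    rw [Fintype.card_fin] at h1
    rw [Finset.card_univ, Fintype.card_fin]
    exact_mod_cast Nat.lt_succ_of_le h1
  have h2 := Lagrange.eq_interpolate (v := t) ht.injOn hdeg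
  have h3 := congrArg (Polynomial.eval 1) h2
  rw [Lagrange.interpolate_apply, Polynomial.eval_finsetSum, hq, one_smul] at h3
  rw [h3]
  refine Finset.sum_congr rfl fun j _ => ?_
  rw [Polynomial.eval_mul, Polynomial.eval_C, hq, mul_comm]

/-- A differentiable map that preserves the pairs of opposite faces of the cube is not everywhere
degenerate. -/
theorem exists_det_ne_zero {F : EuclideanSpace ℝ (Fin n) → EuclideanSpace ℝ (Fin n)}
    (hF : ContDiff ℝ 1 F) (h0 : ∀ x ∈ cube n, ∀ i, x i = 0 → F x i = 0)
    (h1 : ∀ x ∈ cube n, ∀ i, x i = 1 → F x i = 1) : ∃ x, (fderiv ℝ F x).det ≠ 0 := by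
  -- For small t > 0 the map x + t (F x - x) permutes the cube, so the integral of its Jacobian is
  -- the volume. That integral is polynomial in t, hence equals the volume also at t = 1, where the
  -- Jacobian is assumed to vanish.
  by_contra! hdet
  obtain ⟨u, hudef⟩ : ∃ u : EuclideanSpace ℝ (Fin n) → EuclideanSpace ℝ (Fin n),
      u = fun x => F x - x := ⟨_, rfl⟩
  have hu : ContDiff ℝ 1 u := by rw [hudef]; exact hF.sub contDiff_id
  have hud : ∀ x, HasFDerivAt u (fderiv ℝ u x) x := fun x =>
    (hu.differentiable one_ne_zero x).hasFDerivAt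
  have hufd : Continuous (fderiv ℝ u) := hu.continuous_fderiv one_ne_zero
  have hFu : ∀ x, fderiv ℝ F x = 1 + fderiv ℝ u x := by
    intro x
    have h2 : HasFDerivAt u (fderiv ℝ F x - 1) x := by
      rw [hudef]
      exact ((hF.differentiable one_ne_zero x).hasFDerivAt).sub (hasFDerivAt_id x)
    rw [h2.fderiv, add_sub_cancel]
  have hu0 : ∀ x ∈ cube n, ∀ i, x i = 0 → u x i = 0 := fun x hx i hi => by
    simp [hudef, h0 x hx i hi, hi]
  have hu1 : ∀ x ∈ cube n, ∀ i, x i = 1 → u x i = 0 := fun x hx i hi => by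
    simp [hudef, h1 x hx i hi, hi]
  obtain ⟨C, hC⟩ := isCompact_cube.exists_bound_of_continuousOn hufd.continuousOn
  set L : ℝ := max C 1 with hL
  have hL1 : 1 ≤ L := le_max_right _ _
  have hLC : ∀ x ∈ cube n, ‖fderiv ℝ u x‖ ≤ L := fun x hx => (hC x hx).trans (le_max_left _ _)
  have hlip : ∀ x ∈ cube n, ∀ y ∈ cube n, ‖u x - u y‖ ≤ L * ‖x - y‖ := fun x hx y hy =>
    convex_cube.norm_image_sub_le_of_norm_fderiv_le
      (fun z _ => hu.differentiable one_ne_zero z) hLC hy hx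
  -- near the identity the determinant is positive
  obtain ⟨η, hη, hpos⟩ : ∃ η > 0, ∀ A : EuclideanSpace ℝ (Fin n) →L[ℝ] EuclideanSpace ℝ (Fin n),
      ‖A‖ < η → 0 < (1 + A).det := by
    have hc : Continuous fun A : EuclideanSpace ℝ (Fin n) →L[ℝ] EuclideanSpace ℝ (Fin n) =>
        (1 + A).det := ContinuousLinearMap.continuous_det.comp (continuous_const.add continuous_id)
    have hev : ∀ᶠ A in 𝓝 (0 : EuclideanSpace ℝ (Fin n) →L[ℝ] EuclideanSpace ℝ (Fin n)),
        0 < (1 + A).det := by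
      refine hc.continuousAt.eventually (lt_mem_nhds ?_)
      simp [ContinuousLinearMap.det]
    obtain ⟨η, hη, h⟩ := Metric.eventually_nhds_iff.1 hev
    exact ⟨η, hη, fun A hA => h (by rwa [dist_zero_right])⟩
  -- coordinates of `u` vanish on the faces
  have hcoord : ∀ x ∈ cube n, ∀ i, ∀ a : ℝ, (a = 0 ∨ a = 1) → |u x i| ≤ L * |x i - a| := by
    intro x hx i a ha
    let x' : EuclideanSpace ℝ (Fin n) := WithLp.toLp 2 (Function.update (fun j => x j) i a)
    have hx'i : x' i = a := by simp [x']
    have hx'j : ∀ j, j ≠ i → x' j = x j := fun j hj => by simp [x', hj]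
    have hx' : x' ∈ cube n := by
      intro j
      by_cases hj : j = i
      · rw [hj, hx'i]
        rcases ha with rfl | rfl <;> simp
      · rw [hx'j j hj]; exact hx j
    have hux' : u x' i = 0 := by
      rcases ha with rfl | rfl
      · exact hu0 x' hx' i hx'i
      · exact hu1 x' hx' i hx'i
    have hd : ‖x - x'‖ = |x i - a| := by
      have : x - x' = EuclideanSpace.single i (x i - a) := by
        ext j
        by_cases hj : j = i
        · subst hj; simp [hx'i]
        · simp [hx'j j hj, hj]
      rw [this, PiLp.norm_single, Real.norm_eq_abs]
    calc |u x i| = ‖(u x - u x') i‖ := by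
          rw [PiLp.sub_apply, hux', sub_zero, Real.norm_eq_abs]
      _ ≤ ‖u x - u x'‖ := PiLp.norm_apply_le _ i
      _ ≤ L * ‖x - x'‖ := hlip x hx x' hx'
      _ = _ := by rw [hd]
  -- the perturbation of the identity
  have hvol : ∀ t : ℝ, 0 < t → t * L < 1 → t * L < η →
      ∫ x in cube n, (1 + t • fderiv ℝ u x).det = MeasureTheory.volume.real (cube n) := by
    intro t ht ht1 htη
    let G : EuclideanSpace ℝ (Fin n) → EuclideanSpace ℝ (Fin n) := fun x => x + t • u x
    have hG : ∀ x, HasFDerivAt G (1 + t • fderiv ℝ u x) x := fun x =>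
      (hasFDerivAt_id x).add ((hud x).const_smul t)
    have hinj : InjOn G (cube n) := by
      intro x hx y hy hxy
      have h2 : x - y = -(t • (u x - u y)) := by
        have : x + t • u x = y + t • u y := hxy
        rw [smul_sub, sub_eq_iff_eq_add, ← sub_eq_iff_eq_add'.2 this]
        abel
      have h3 : ‖x - y‖ ≤ t * (L * ‖x - y‖) := by
        calc ‖x - y‖ = t * ‖u x - u y‖ := by rw [h2, norm_neg, norm_smul, Real.norm_of_nonneg ht.le]
          _ ≤ _ := mul_le_mul_of_nonneg_left (hlip x hx y hy) ht.le
      have h4 : ‖x - y‖ = 0 := by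
        by_contra hne
        have hp : 0 < ‖x - y‖ := lt_of_le_of_ne (norm_nonneg _) (Ne.symm hne)
        nlinarith
      exact sub_eq_zero.1 (norm_eq_zero.1 h4)
    have himage : G '' cube n = cube n := by
      apply Subset.antisymm
      · rintro _ ⟨x, hx, rfl⟩ i
        have hGi : G x i = x i + t * u x i := by simp [G]
        have e0 := hcoord x hx i 0 (Or.inl rfl)
        have e1 := hcoord x hx i 1 (Or.inr rfl)
        rw [sub_zero, abs_of_nonneg (hx i).1] at e0
        rw [abs_sub_comm, abs_of_nonneg (sub_nonneg.2 (hx i).2)] at e1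
        have f0 := (abs_le.1 e0).1
        have f1 := (abs_le.1 e1).2
        have g0 := (hx i).1
        have g1 := (hx i).2
        rw [hGi]
        constructor
        · nlinarith [mul_le_mul_of_nonneg_left f0 ht.le, mul_nonneg g0 (sub_nonneg.2 ht1.le)]
        · nlinarith [mul_le_mul_of_nonneg_left f1 ht.le,
            mul_nonneg (sub_nonneg.2 g1) (sub_nonneg.2 ht1.le)]
      · intro y hy
        -- Clamping extends the Lipschitz bound of u from the cube to the whole space, so the
        -- contraction principle applies. The fixed point stays in the cube because the i-th
        -- coordinate of u vanishes on the i-th faces.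
        let Φ : EuclideanSpace ℝ (Fin n) → EuclideanSpace ℝ (Fin n) := fun x => y - t • u (clamp x)
        have hΦ : ContractingWith (t * L).toNNReal Φ := by
          refine ⟨?_, LipschitzWith.of_dist_le_mul fun x x' => ?_⟩
          · rw [← NNReal.coe_lt_coe, Real.coe_toNNReal _ (by positivity)]
            exact ht1
          · rw [Real.coe_toNNReal _ (by positivity)]
            simp only [Φ]
            rw [dist_sub_left, dist_smul₀, Real.norm_of_nonneg ht.le, mul_assoc, dist_eq_norm]
            refine mul_le_mul_of_nonneg_left ((hlip _ (clamp_mem x) _ (clamp_mem x')).trans ?_) ht.le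
            rw [← dist_eq_norm]
            exact mul_le_mul_of_nonneg_left (dist_clamp_le x x') (by linarith)
        set x := ContractingWith.fixedPoint Φ hΦ
        have hx : y - t • u (clamp x) = x := hΦ.fixedPoint_isFixedPt
        have hxi : ∀ i, x i = y i - t * u (clamp x) i := fun i => by
          conv_lhs => rw [← hx]
          simp
        have hxQ : x ∈ cube n := by
          intro i
          have hi := hxi i
          constructor
          · by_contra! hlt
            have : clamp x i = 0 := by
              rw [clamp_apply, min_eq_right (by linarith), max_eq_left hlt.le]
            rw [hu0 _ (clamp_mem x) i this, mul_zero, sub_zero] at hi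
            have := (hy i).1
            linarith
          · by_contra! hlt
            have : clamp x i = 1 := by
              rw [clamp_apply, min_eq_left hlt.le, max_eq_right zero_le_one]
            rw [hu1 _ (clamp_mem x) i this, mul_zero, sub_zero] at hi
            have := (hy i).2
            linarith
        refine ⟨x, hxQ, ?_⟩
        rw [clamp_of_mem hxQ] at hx
        exact (sub_eq_iff_eq_add.1 hx).symm
    have h2 := MeasureTheory.integral_image_eq_integral_abs_det_fderiv_smul MeasureTheory.volume
      isClosed_cube.measurableSet (fun x _ => (hG x).hasFDerivWithinAt) hinj (fun _ => (1 : ℝ))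
    rw [himage] at h2
    simp only [smul_eq_mul, mul_one, MeasureTheory.integral_const,
      MeasureTheory.measureReal_restrict_apply_univ] at h2
    rw [h2]
    refine MeasureTheory.setIntegral_congr_fun isClosed_cube.measurableSet fun x hx => ?_
    rw [abs_of_pos (hpos _ ?_)]
    rw [norm_smul, Real.norm_of_nonneg ht.le]
    exact (mul_le_mul_of_nonneg_left (hLC x hx) ht.le).trans_lt htη
  -- interpolation
  let δ : ℝ := min 1 η / (2 * L)
  have hδ : 0 < δ := by positivity
  -- These are n + 1 distinct nodes within the range where the volume identity is known; δ is chosen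
  -- so that δ * L is half of min 1 η.
  let t : Fin (n + 1) → ℝ := fun j => δ / ((j : ℝ) + 1)
  have htpos : ∀ j, 0 < t j := fun j => by positivity
  have htL : ∀ j, t j * L < min 1 η := by
    intro j
    have h2 : t j ≤ δ := div_le_self hδ.le (by linarith [(Nat.cast_nonneg j : (0 : ℝ) ≤ (j : ℕ))])
    have h3 : δ * L = min 1 η / 2 := by
      simp only [δ]; field_simp
    have h4 : 0 < min 1 η := lt_min one_pos hη
    nlinarith
  have htinj : Function.Injective t := by
    intro i j hij
    have h2 : δ / ((i : ℝ) + 1) = δ / ((j : ℝ) + 1) := hij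
    rw [div_eq_div_iff (by positivity) (by positivity)] at h2
    have h3 := mul_left_cancel₀ hδ.ne' h2
    exact Fin.ext (by exact_mod_cast (add_right_cancel h3).symm)
  have hcont : ∀ s : ℝ, Continuous fun x => (1 + s • fderiv ℝ u x).det := fun s =>
    ContinuousLinearMap.continuous_det.comp (continuous_const.add (hufd.const_smul s))
  have hint : ∫ x in cube n, (1 + fderiv ℝ u x).det = MeasureTheory.volume.real (cube n) := by
    simp_rw [fun x => det_one_add_eq_sum (fderiv ℝ u x) htinj]
    rw [MeasureTheory.integral_finsetSum]
    · have h2 : ∀ j, ∫ x in cube n, (Lagrange.basis Finset.univ t j).eval 1 *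
          (1 + t j • fderiv ℝ u x).det =
          (Lagrange.basis Finset.univ t j).eval 1 * MeasureTheory.volume.real (cube n) := by
        intro j
        rw [MeasureTheory.integral_const_mul, hvol (t j) (htpos j)
          ((htL j).trans_le (min_le_left _ _)) ((htL j).trans_le (min_le_right _ _))]
      simp_rw [h2]
      rw [← Finset.sum_mul, ← Polynomial.eval_finsetSum, Lagrange.sum_basis htinj.injOn
        Finset.univ_nonempty, Polynomial.eval_one, one_mul]
    · intro j _
      exact ((hcont (t j)).const_mul _).continuousOn.integrableOn_compact isCompact_cube
  simp_rw [← hFu, hdet] at hint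
  rw [MeasureTheory.integral_zero] at hint
  have hfin : MeasureTheory.volume (cube n) ≠ ⊤ := isCompact_cube.measure_lt_top.ne
  have := ENNReal.toReal_pos volume_cube_pos.ne' hfin
  rw [MeasureTheory.measureReal_def] at hint
  linarith

end Cube

/-! ### The covering dimension of the sphere -/

section CoveringDim

variable {n : ℕ}

/-- The scaled open star of the vertex `v` in Kuhn's triangulation of the lattice of mesh `e`. -/
def kuhnStar (e : ℝ) (v : Fin n → ℤ) : Set (EuclideanSpace ℝ (Fin n)) :=
  {x | ∃ a : ℝ, -1 < a ∧ a < 0 ∧ ∀ i, a < x i / e - v i ∧ x i / e - v i < a + 1}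

theorem isOpen_kuhnStar (e : ℝ) (v : Fin n → ℤ) : IsOpen (kuhnStar e v) := by
  have : kuhnStar e v = ⋃ a ∈ Ioo (-1 : ℝ) 0,
      ⋂ i, {x : EuclideanSpace ℝ (Fin n) | x i / e - v i ∈ Ioo a (a + 1)} := by
    ext x
    simp [kuhnStar, and_assoc]
  rw [this]
  refine isOpen_biUnion fun a _ => isOpen_iInter_of_finite fun i => isOpen_Ioo.preimage ?_
  fun_prop

/-- Take the vertex of floors. Any a strictly between the largest fractional part minus 1 and 0
works; including 0 in the maximum covers n = 0. -/
theorem exists_mem_kuhnStar (e : ℝ) (x : EuclideanSpace ℝ (Fin n)) :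
    ∃ v, x ∈ kuhnStar e v := by
  refine ⟨fun i => ⌊x i / e⌋, ?_⟩
  obtain ⟨k, hk⟩ := Finite.exists_max
    (fun o : Option (Fin n) => o.elim (0 : ℝ) fun i => Int.fract (x i / e))
  set m : ℝ := k.elim (0 : ℝ) fun i => Int.fract (x i / e) with hm
  have hm0 : 0 ≤ m := hk none
  have hm1 : m < 1 := by
    rw [hm]
    cases k with
    | none => exact one_pos
    | some i => exact Int.fract_lt_one _
  refine ⟨(m - 1) / 2, by linarith, by linarith, fun i => ?_⟩
  have h1 : Int.fract (x i / e) ≤ m := hk (some i)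
  have h2 := Int.fract_nonneg (x i / e)
  rw [Int.self_sub_floor]
  constructor <;> linarith

/-- Let μ be the minimum of 0 and the coordinates of x / e - v. Then v is the floor of x / e - μ,
and μ is 0 or a fractional part minus 1, which leaves n + 1 candidates. -/
theorem encard_kuhnStar_le (e : ℝ) (x : EuclideanSpace ℝ (Fin n)) :
    {v | x ∈ kuhnStar e v}.encard ≤ n + 1 := by
  let m : Option (Fin n) → ℝ := fun o => o.elim (0 : ℝ) fun i => Int.fract (x i / e) - 1
  have hsub : {v | x ∈ kuhnStar e v} ⊆ range fun o : Option (Fin n) => fun i =>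
      ⌊x i / e - m o⌋ := by
    rintro v ⟨a, ha1, ha0, hv⟩
    obtain ⟨k, hk⟩ := Finite.exists_min
      (fun o : Option (Fin n) => o.elim (0 : ℝ) fun i => x i / e - v i)
    set μ : ℝ := k.elim (0 : ℝ) fun i => x i / e - v i with hμ
    have hμ0 : μ ≤ 0 := hk none
    have hμa : a < μ := by
      rw [hμ]
      cases k with
      | none => exact ha0
      | some i => exact (hv i).1
    have hfl : ∀ i, ⌊x i / e - μ⌋ = v i := by
      intro i
      rw [Int.floor_eq_iff]
      have h1 : μ ≤ x i / e - v i := hk (some i)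
      have := (hv i).2
      constructor <;> linarith
    rcases hμ0.eq_or_lt with h0 | h0
    · refine ⟨none, funext fun i => ?_⟩
      have := hfl i
      rw [h0] at this
      exact this
    · cases k with
      | none => exact absurd h0 (lt_irrefl _)
      | some j =>
        have hμj : μ = x j / e - v j := hμ
        refine ⟨some j, funext fun i => ?_⟩
        have h2 : Int.fract (x j / e) - 1 = μ := by
          have h3 : ⌊x j / e⌋ = v j - 1 := by
            rw [Int.floor_eq_iff]
            push_cast
            constructor <;> linarith
          rw [Int.fract, h3, hμj]
          push_cast
          ring
        change ⌊x i / e - (Int.fract (x j / e) - 1)⌋ = v i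
        rw [h2, hfl]
  refine (encard_le_encard hsub).trans ?_
  rw [← image_univ]
  refine (encard_image_le _ _).trans ?_
  rw [encard_univ, ENat.card_eq_coe_fintype_card, Fintype.card_option, Fintype.card_fin]
  push_cast
  exact le_rfl

theorem abs_sub_lt_of_mem_kuhnStar {e : ℝ} (he : 0 < e) {v : Fin n → ℤ}
    {x : EuclideanSpace ℝ (Fin n)} (hx : x ∈ kuhnStar e v) (i : Fin n) : |x i - e * v i| < e := by
  obtain ⟨a, ha1, ha0, h⟩ := hx
  have h1 : x i - e * v i = e * (x i / e - v i) := by field_simp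
  rw [h1, abs_mul, abs_of_pos he]
  have h2 : |x i / e - v i| < 1 := by
    rw [abs_lt]
    have := h i
    constructor <;> linarith
  nlinarith

theorem dist_lt_of_mem_kuhnStar {δ : ℝ} (hδ : 0 < δ) {v : Fin n → ℤ}
    {x : EuclideanSpace ℝ (Fin n)} (hx : x ∈ kuhnStar (δ / (n + 1)) v) :
    dist x (WithLp.toLp 2 fun i => δ / (n + 1) * v i) < δ := by
  have he : 0 < δ / (n + 1) := by positivity
  rw [EuclideanSpace.dist_eq, Real.sqrt_lt' hδ]
  have h1 : ∀ i, dist (x i) (δ / (n + 1) * v i) ^ 2 ≤ (δ / (n + 1)) ^ 2 := by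
    intro i
    rw [Real.dist_eq]
    exact pow_le_pow_left₀ (abs_nonneg _) (abs_sub_lt_of_mem_kuhnStar he hx i).le 2
  calc ∑ i, dist (x i) (δ / (n + 1) * v i) ^ 2 ≤ ∑ _i : Fin n, (δ / (n + 1)) ^ 2 :=
        Finset.sum_le_sum fun i _ => h1 i
    _ = n * (δ / (n + 1)) ^ 2 := by simp
    _ < δ ^ 2 := by
      rw [div_pow, mul_div_assoc', div_lt_iff₀ (by positivity)]
      have : (0 : ℝ) < δ ^ 2 := by positivity
      have hn : (0 : ℝ) ≤ n := Nat.cast_nonneg n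
      nlinarith [mul_nonneg this.le hn, mul_nonneg this.le (mul_nonneg hn hn)]

variable {X : Type*} [TopologicalSpace X] [CompactSpace X] [T2Space X]

/-- Fine Kuhn stars refine the cover on a large ball. All stars that leave the ball, together with
its exterior, are merged into one neighborhood of ω, which cannot raise the number of members at a
point. -/
theorem coveringDimLE_of_onePoint {j : EuclideanSpace ℝ (Fin n) → X} (hj : IsOpenEmbedding j)
    {ω : X} (hω : range j = {ω}ᶜ) : CoveringDimLE X n := by
  classical
  intro 𝒰 hfin hopen hcov
  have hne : ∀ y, j y ≠ ω := fun y => by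
    have : j y ∈ range j := mem_range_self y
    rw [hω] at this
    exact this
  have hK : ∀ K : Set (EuclideanSpace ℝ (Fin n)), IsCompact K → IsOpen (j '' K)ᶜ := fun K h =>
    (h.image hj.continuous).isClosed.isOpen_compl
  obtain ⟨U₀, hU₀, hωU₀⟩ : ∃ U ∈ 𝒰, ω ∈ U := by
    have : ω ∈ ⋃₀ 𝒰 := by rw [hcov]; trivial
    exact this
  obtain ⟨R, hR⟩ : ∃ R, (j '' Metric.closedBall 0 R)ᶜ ⊆ U₀ := by
    have h1 : IsCompact U₀ᶜ := (hopen U₀ hU₀).isClosed_compl.isCompact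
    have h2 : U₀ᶜ ⊆ range j := by
      rw [hω]
      exact compl_subset_compl.2 (singleton_subset_iff.2 hωU₀)
    have h3 : IsCompact (j ⁻¹' U₀ᶜ) := hj.isInducing.isCompact_preimage_iff h2 |>.2 h1
    obtain ⟨R, hR⟩ := h3.isBounded.subset_closedBall 0
    refine ⟨R, ?_⟩
    rw [compl_subset_comm]
    intro x hx
    obtain ⟨y, rfl⟩ := h2 hx
    exact ⟨y, hR hx, rfl⟩
  obtain ⟨δ₀, hδ₀, hleb⟩ := lebesgue_number_lemma_of_metric_sUnion
    (isCompact_closedBall (0 : EuclideanSpace ℝ (Fin n)) (R + 1))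
    (c := (fun U => j ⁻¹' U) '' 𝒰)
    (by rintro _ ⟨U, hU, rfl⟩; exact (hopen U hU).preimage hj.continuous)
    (by
      intro x _
      have : j x ∈ ⋃₀ 𝒰 := by rw [hcov]; trivial
      obtain ⟨U, hU, hx⟩ := this
      exact ⟨_, ⟨U, hU, rfl⟩, hx⟩)
  -- Two points of a star are less than 2 δ ≤ 1 apart, so a star that leaves the ball of radius R +
  -- 1 avoids the ball of radius R.
  set δ : ℝ := min δ₀ (1 / 2) with hδdef
  have hδ : 0 < δ := by positivity
  set e : ℝ := δ / (n + 1) with he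
  have hepos : 0 < e := by positivity
  let center : (Fin n → ℤ) → EuclideanSpace ℝ (Fin n) := fun v => WithLp.toLp 2 fun i => e * v i
  have hdist : ∀ v, ∀ x ∈ kuhnStar e v, dist x (center v) < δ := fun v x hx =>
    dist_lt_of_mem_kuhnStar hδ hx
  let far : (Fin n → ℤ) → Prop := fun v => ∃ x ∈ kuhnStar e v, R + 1 < ‖x‖
  have hfar : ∀ v, far v → ∀ y ∈ kuhnStar e v, R < ‖y‖ := by
    rintro v ⟨x, hx, hxR⟩ y hy
    have h1 := hdist v x hx
    have h2 := hdist v y hy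
    have h3 := dist_triangle_right x y (center v)
    have h4 := norm_sub_norm_le x y
    rw [← dist_eq_norm] at h4
    have : δ ≤ 1 / 2 := min_le_right _ _
    linarith
  let V₀ : Set X := (⋃ v ∈ {v | far v}, j '' kuhnStar e v) ∪ (j '' Metric.closedBall 0 (R + 1))ᶜ
  let near : Set (Fin n → ℤ) := {v | ¬ far v ∧ (kuhnStar e v).Nonempty}
  have hnearfin : near.Finite := by
    refine (Set.finite_Icc (fun _ => -⌈(R + 1) / e + 1⌉ : Fin n → ℤ)
      (fun _ => ⌈(R + 1) / e + 1⌉)).subset ?_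
    rintro v ⟨hv, x, hx⟩
    have h1 : ‖x‖ ≤ R + 1 := by
      by_contra! h
      exact hv ⟨x, hx, h⟩
    have h2 : ∀ i, |(v i : ℝ)| ≤ (R + 1) / e + 1 := by
      intro i
      have h3 := abs_sub_lt_of_mem_kuhnStar hepos hx i
      have h4 : |x i| ≤ R + 1 := (PiLp.norm_apply_le x i).trans h1
      have h5 : e * |(v i : ℝ)| ≤ R + 1 + e := by
        have h6 := abs_sub_abs_le_abs_sub (e * (v i : ℝ)) (x i)
        rw [abs_sub_comm, abs_mul, abs_of_pos hepos] at h6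
        linarith
      rw [div_add_one hepos.ne', le_div_iff₀ hepos]
      linarith
    constructor
    · intro i
      have h3 := (abs_le.1 (h2 i)).1
      have h4 := Int.le_ceil ((R + 1) / e + 1)
      have h5 : -(⌈(R + 1) / e + 1⌉ : ℝ) ≤ v i := by linarith
      exact_mod_cast h5
    · intro i
      have h3 := (abs_le.1 (h2 i)).2
      have h4 := Int.le_ceil ((R + 1) / e + 1)
      have h5 : (v i : ℝ) ≤ (⌈(R + 1) / e + 1⌉ : ℝ) := by linarith
      exact_mod_cast h5
  refine ⟨insert V₀ ((fun v => j '' kuhnStar e v) '' near), (hnearfin.image _).insert _, ?_, ?_, ?_,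
    ?_⟩
  · rintro V (rfl | ⟨v, -, rfl⟩)
    · exact (isOpen_biUnion fun v _ => hj.isOpenMap _ (isOpen_kuhnStar e v)).union
        (hK _ (isCompact_closedBall _ _))
    · exact hj.isOpenMap _ (isOpen_kuhnStar e v)
  · rw [eq_univ_iff_forall]
    intro x
    by_cases hx : x = ω
    · refine ⟨V₀, mem_insert _ _, Or.inr ?_⟩
      rintro ⟨y, -, hy⟩
      exact hne y (hy.trans hx)
    · obtain ⟨y, rfl⟩ : x ∈ range j := by rw [hω]; exact hx
      obtain ⟨v, hv⟩ := exists_mem_kuhnStar e y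
      by_cases hf : far v
      · exact ⟨V₀, mem_insert _ _, Or.inl (mem_biUnion hf ⟨y, hv, rfl⟩)⟩
      · exact ⟨_, mem_insert_of_mem _ ⟨v, ⟨hf, y, hv⟩, rfl⟩, ⟨y, hv, rfl⟩⟩
  · rintro V (rfl | ⟨v, ⟨hv, x, hx⟩, rfl⟩)
    · refine ⟨U₀, hU₀, union_subset (iUnion₂_subset fun v hv => ?_) ?_⟩
      · rintro _ ⟨y, hy, rfl⟩
        apply hR
        rintro ⟨y', hy', hyy'⟩
        rw [hj.injective hyy', mem_closedBall_zero_iff] at hy'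
        exact absurd (hfar v hv y hy) (not_lt.2 hy')
      · refine Subset.trans (compl_subset_compl.2 (image_mono ?_)) hR
        exact Metric.closedBall_subset_closedBall (by linarith)
    · have hxR : x ∈ Metric.closedBall (0 : EuclideanSpace ℝ (Fin n)) (R + 1) := by
        rw [mem_closedBall_zero_iff]
        by_contra! h
        exact hv ⟨x, hx, h⟩
      have hcR : center v ∈ Metric.closedBall (0 : EuclideanSpace ℝ (Fin n)) (R + 1) := by
        rw [mem_closedBall_zero_iff]
        by_contra! h
        refine hv ⟨center v, ⟨-1 / 2, by norm_num, by norm_num, fun i => ?_⟩, h⟩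
        have : center v i / e - v i = 0 := by
          change e * (v i : ℝ) / e - v i = 0
          field_simp
          ring
        rw [this]
        norm_num
      obtain ⟨_, ⟨U, hU, rfl⟩, hball⟩ := hleb _ hcR
      refine ⟨U, hU, ?_⟩
      rintro _ ⟨y, hy, rfl⟩
      exact hball ((hdist v y hy).trans_le (min_le_left _ _))
  · intro x
    by_cases hx : x = ω
    · have : {V ∈ insert V₀ ((fun v => j '' kuhnStar e v) '' near) | x ∈ V} ⊆ {V₀} := by
        rintro V ⟨rfl | ⟨v, -, rfl⟩, hV⟩
        · rfl
        · obtain ⟨y, -, hy⟩ := hV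
          exact absurd (hy.trans hx) (hne y)
      refine (encard_le_encard this).trans ?_
      rw [encard_singleton]
      exact le_add_self
    · obtain ⟨y, rfl⟩ : x ∈ range j := by rw [hω]; exact hx
      have : {V ∈ insert V₀ ((fun v => j '' kuhnStar e v) '' near) | j y ∈ V} ⊆
          (fun v => if far v then V₀ else j '' kuhnStar e v) '' {v | y ∈ kuhnStar e v} := by
        rintro V ⟨rfl | ⟨v, ⟨hv, -⟩, rfl⟩, hV⟩
        · rcases hV with hV | hV
          · obtain ⟨v, hv, y', hy', hyy'⟩ := mem_iUnion₂.1 hV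
            rw [hj.injective hyy'] at hy'
            exact ⟨v, hy', if_pos hv⟩
          · obtain ⟨v, hv⟩ := exists_mem_kuhnStar e y
            refine ⟨v, hv, if_pos ⟨y, hv, ?_⟩⟩
            by_contra! h
            exact hV ⟨y, by rwa [mem_closedBall_zero_iff], rfl⟩
        · obtain ⟨y', hy', hyy'⟩ := hV
          rw [hj.injective hyy'] at hy'
          exact ⟨v, hy', if_neg hv⟩
      exact (encard_le_encard this).trans ((encard_image_le _ _).trans (encard_kuhnStar_le e y))

-- Lebesgue's covering theorem. The chosen open cover forces every member of a refinement to miss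
-- one of each two opposite faces of the cube. A smooth partition of unity with vertices of the cube
-- as values then gives a face-preserving map. If at most n members meet at each point, its
-- derivative is spanned by n - 1 differences of vertices and is degenerate, against
-- `exists_det_ne_zero`.
omit [CompactSpace X] in
theorem le_of_coveringDimLE {j : EuclideanSpace ℝ (Fin n) → X} (hj : IsOpenEmbedding j)
    {m : ℕ} (hm : CoveringDimLE X m) : n ≤ m := by
  classical
  by_contra! hmn
  let face : (Fin n → Bool) → Set (EuclideanSpace ℝ (Fin n)) := fun s =>
    {x | x ∈ cube n ∧ ∃ i, x i = if s i then 1 else 0}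
  have hface : ∀ s, IsCompact (face s) := by
    intro s
    refine isCompact_cube.inter_right (t := {x | ∃ i, x i = if s i then 1 else 0}) ?_
    have : {x : EuclideanSpace ℝ (Fin n) | ∃ i, x i = if s i then 1 else 0} =
        ⋃ i, {x | x i = if s i then 1 else 0} := by ext; simp
    rw [this]
    exact isClosed_iUnion_of_finite fun i => isClosed_eq (by fun_prop) continuous_const
  obtain ⟨𝒱, h𝒱fin, h𝒱open, h𝒱cov, h𝒱ref, h𝒱ord⟩ := hm (range fun s => (j '' face s)ᶜ)
    (finite_range _)
    (by rintro _ ⟨s, rfl⟩; exact ((hface s).image hj.continuous).isClosed.isOpen_compl)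
    (by
      rw [eq_univ_iff_forall]
      intro x
      by_cases hx : x ∈ range j
      · obtain ⟨y, rfl⟩ := hx
        refine ⟨_, ⟨fun i => decide (y i = 0), rfl⟩, ?_⟩
        rintro ⟨y', ⟨-, i, hi⟩, hyy'⟩
        rw [hj.injective hyy'] at hi
        by_cases h : y i = 0
        · simp [h] at hi
        · simp [h] at hi
      · refine ⟨_, ⟨fun _ => false, rfl⟩, ?_⟩
        rintro ⟨y, -, rfl⟩
        exact hx (mem_range_self y))
  have : Finite 𝒱 := h𝒱fin
  have : Fintype 𝒱 := Fintype.ofFinite _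
  -- no member of the refinement meets opposite faces
  have hopp : ∀ V ∈ 𝒱, ∀ i, ∀ x ∈ cube n, ∀ y ∈ cube n, x i = 0 → y i = 1 → j x ∈ V → j y ∈ V →
      False := by
    intro V hV i x hx y hy hxi hyi hxV hyV
    obtain ⟨_, ⟨s, rfl⟩, hVs⟩ := h𝒱ref V hV
    by_cases hs : s i
    · exact hVs hyV ⟨y, ⟨hy, i, by simp [hs, hyi]⟩, rfl⟩
    · exact hVs hxV ⟨x, ⟨hx, i, by simp [hs, hxi]⟩, rfl⟩
  obtain ⟨f, hf⟩ := SmoothPartitionOfUnity.exists_isSubordinate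
    (modelWithCornersSelf ℝ (EuclideanSpace ℝ (Fin n)))
    (isClosed_univ (X := EuclideanSpace ℝ (Fin n))) (fun V : 𝒱 => j ⁻¹' V.1)
    (fun V => (h𝒱open V.1 V.2).preimage hj.continuous) (by
      intro x _
      have : j x ∈ ⋃₀ 𝒱 := by rw [h𝒱cov]; trivial
      obtain ⟨V, hV, hx⟩ := this
      exact mem_iUnion.2 ⟨⟨V, hV⟩, hx⟩)
  have hsum : ∀ x, ∑ V, f V x = 1 := fun x => by
    have := f.sum_eq_one (mem_univ x)
    rwa [finsum_eq_sum_of_fintype] at this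
  have hsupp : ∀ V x, f V x ≠ 0 → j x ∈ V.1 := fun V x hx =>
    hf V (subset_tsupport _ hx)
  have hsmooth : ∀ V, ContDiff ℝ 1 (f V) := fun V =>
    ((f V).contMDiff.contDiff).of_le (by exact_mod_cast le_top)
  let a : 𝒱 → EuclideanSpace ℝ (Fin n) := fun V => WithLp.toLp 2 fun i =>
    if ∃ x ∈ cube n, x i = 0 ∧ j x ∈ V.1 then 0 else 1
  let F : EuclideanSpace ℝ (Fin n) → EuclideanSpace ℝ (Fin n) := fun x => ∑ V, f V x • a V
  have hFi : ∀ x i, F x i = ∑ V, f V x * a V i := fun x i => by simp [F]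
  have hF : ContDiff ℝ 1 F := ContDiff.sum fun V _ => (hsmooth V).smul contDiff_const
  obtain ⟨x, hx⟩ := exists_det_ne_zero hF
    (by
      intro x hx i hi
      rw [hFi]
      refine Finset.sum_eq_zero fun V _ => ?_
      by_cases hV : f V x = 0
      · rw [hV, zero_mul]
      · have : a V i = 0 := if_pos ⟨x, hx, hi, hsupp V x hV⟩
        rw [this, mul_zero])
    (by
      intro x hx i hi
      rw [hFi, ← hsum x]
      refine Finset.sum_congr rfl fun V _ => ?_
      by_cases hV : f V x = 0
      · rw [hV, zero_mul]
      · have : a V i = 1 := if_neg fun ⟨y, hy, hyi, hyV⟩ =>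
          hopp V.1 V.2 i y hy x hx hyi hi hyV (hsupp V x hV)
        rw [this, mul_one])
  apply hx
  -- the derivative of `F` at `x` has rank less than `n`
  let S : Finset 𝒱 := Finset.univ.filter fun V => j x ∈ V.1
  have hScard : S.card ≤ n := by
    have h1 : (S : Set 𝒱).encard ≤ m + 1 := by
      rw [← (Subtype.val_injective).encard_image]
      refine (encard_le_encard ?_).trans (h𝒱ord (j x))
      rintro _ ⟨V, hV, rfl⟩
      exact ⟨V.2, (Finset.mem_filter.1 hV).2⟩
    rw [encard_coe_eq_coe_finsetCard] at h1
    have h2 : S.card ≤ m + 1 := by exact_mod_cast h1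
    omega
  have hd : ∀ V, HasFDerivAt (f V) (fderiv ℝ (f V) x) x := fun V =>
    ((hsmooth V).differentiable one_ne_zero x).hasFDerivAt
  -- A nonnegative function has a minimum at each of its zeros. This matters because x may lie on
  -- the boundary of the support.
  have hd0 : ∀ V, V ∉ S → fderiv ℝ (f V) x = 0 := by
    intro V hV
    have h1 : f V x = 0 := by
      by_contra h
      exact hV (Finset.mem_filter.2 ⟨Finset.mem_univ _, hsupp V x h⟩)
    refine IsLocalMin.fderiv_eq_zero (Eventually.of_forall fun y => ?_)
    rw [h1]
    exact f.nonneg V y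
  have hdsum : ∑ V, fderiv ℝ (f V) x = 0 := by
    have h1 : HasFDerivAt (fun y => ∑ V, f V y) (∑ V, fderiv ℝ (f V) x) x :=
      HasFDerivAt.fun_sum fun V _ => hd V
    simp_rw [hsum] at h1
    exact h1.unique (hasFDerivAt_const (1 : ℝ) x)
  have hFd : ∀ w, fderiv ℝ F x w = ∑ V, fderiv ℝ (f V) x w • a V := by
    intro w
    have h1 : HasFDerivAt F (∑ V, (fderiv ℝ (f V) x).smulRight (a V)) x :=
      HasFDerivAt.fun_sum fun V _ => (hd V).smul_const (a V)
    rw [h1.fderiv]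
    simp
  have hSne : S.Nonempty := by
    by_contra hS
    rw [Finset.not_nonempty_iff_eq_empty] at hS
    have : ∀ V, f V x = 0 := fun V => by
      by_contra h
      have : V ∈ S := Finset.mem_filter.2 ⟨Finset.mem_univ _, hsupp V x h⟩
      rw [hS] at this
      exact absurd this (Finset.notMem_empty _)
    have h1 := hsum x
    simp_rw [this, Finset.sum_const_zero] at h1
    exact zero_ne_one h1
  obtain ⟨V₀, hV₀⟩ := hSne
  let T : Finset (EuclideanSpace ℝ (Fin n)) := (S.erase V₀).image fun V => a V - a V₀
  have hrange : LinearMap.range (fderiv ℝ F x : EuclideanSpace ℝ (Fin n) →ₗ[ℝ] _) ≤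
      Submodule.span ℝ (T : Set (EuclideanSpace ℝ (Fin n))) := by
    rintro _ ⟨w, rfl⟩
    rw [ContinuousLinearMap.coe_coe, hFd]
    have h1 : ∑ V, fderiv ℝ (f V) x w • a V = ∑ V, fderiv ℝ (f V) x w • (a V - a V₀) := by
      have h2 : ∑ V, fderiv ℝ (f V) x w = 0 := by
        have := congrArg (fun L : EuclideanSpace ℝ (Fin n) →L[ℝ] ℝ => L w) hdsum
        simpa using this
      simp_rw [smul_sub]
      rw [Finset.sum_sub_distrib, ← Finset.sum_smul, h2, zero_smul, sub_zero]
    rw [h1]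
    refine Submodule.sum_mem _ fun V _ => ?_
    by_cases hV : V ∈ S
    · by_cases hVV : V = V₀
      · rw [hVV, sub_self, smul_zero]
        exact Submodule.zero_mem _
      · refine Submodule.smul_mem _ _ (Submodule.subset_span ?_)
        exact Finset.mem_coe.2 (Finset.mem_image_of_mem _ (Finset.mem_erase.2 ⟨hVV, hV⟩))
    · rw [hd0 V hV]
      simp
  by_contra hdet
  have h1 : LinearMap.range (fderiv ℝ F x : EuclideanSpace ℝ (Fin n) →ₗ[ℝ] _) = ⊤ :=
    LinearMap.range_eq_top.2 fun w =>
      (LinearMap.equivOfDetNeZero (fderiv ℝ F x).toLinearMap hdet).surjective w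
  have h2 := Submodule.finrank_mono hrange
  rw [h1, finrank_top, finrank_euclideanSpace, Fintype.card_fin] at h2
  have h3 := finrank_span_finset_le_card (R := ℝ) T
  have h4 : T.card ≤ (S.erase V₀).card := Finset.card_image_le
  rw [Finset.card_erase_of_mem hV₀] at h4
  have h5 : 0 < S.card := Finset.card_pos.2 ⟨V₀, hV₀⟩
  have h6 : n ≤ T.card := h2.trans h3
  omega

/-- A compact space from which a point can be removed so that `ℝⁿ` remains has dimension `n`. -/
theorem hasCoveringDim_of_onePoint {j : EuclideanSpace ℝ (Fin n) → X} (hj : IsOpenEmbedding j)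
    {ω : X} (hω : range j = {ω}ᶜ) : HasCoveringDim X n :=
  ⟨⟨ω⟩, coveringDimLE_of_onePoint hj hω, fun _ hm => le_of_coveringDimLE hj hm⟩

end CoveringDim

/-! ### Cross-ratio triples -/

section Factor

variable {X Y : Type*} (d : ExtMetric X)

theorem ExtMetric.dist_self (x : X) : d.dist x x = 0 := (d.dist_eq_zero_iff x x).2 rfl

theorem ExtMetric.factor_self (x : X) : d.factor x x = 0 := by
  simp [ExtMetric.factor, d.dist_self]

theorem ExtMetric.factor_comm (x y : X) : d.factor x y = d.factor y x := by
  rw [ExtMetric.factor, ExtMetric.factor, d.dist_comm]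

theorem ExtMetric.factor_pos {x y : X} (h : x ≠ y) : 0 < d.factor x y := by
  rw [ExtMetric.factor]
  split_ifs with h1
  · exact one_pos
  · exact ENNReal.toReal_pos (fun h0 => h ((d.dist_eq_zero_iff x y).1 h0)) h1

theorem ExtMetric.factor_nonneg (x y : X) : 0 ≤ d.factor x y := by
  by_cases h : x = y
  · rw [h, d.factor_self]
  · exact (d.factor_pos h).le

variable {d}

theorem ExtMetric.dist_infty {ω : X} (hω : d.infty = some ω) {x : X} (hx : x ≠ ω) :
    d.dist x ω = ⊤ := (d.dist_eq_top_iff x ω).2 ⟨hx, Or.inr hω⟩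

theorem ExtMetric.factor_infty {ω : X} (hω : d.infty = some ω) {x : X} (hx : x ≠ ω) :
    d.factor x ω = 1 := if_pos (d.dist_infty hω hx)

theorem ExtMetric.dist_ne_top {x y : X} (hx : d.infty ≠ some x) (hy : d.infty ≠ some y) :
    d.dist x y ≠ ⊤ := fun h => ((d.dist_eq_top_iff x y).1 h).2.elim hx hy

theorem ExtMetric.factor_eq {x y : X} (hx : d.infty ≠ some x) (hy : d.infty ≠ some y) :
    d.factor x y = (d.dist x y).toReal := if_neg (d.dist_ne_top hx hy)

theorem ExtMetric.ne_infty {ω : X} (hω : d.infty = some ω) {x : X} :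
    d.infty ≠ some x ↔ x ≠ ω := by
  rw [hω, ne_eq, Option.some_inj, eq_comm]

/-- The map `f` preserves the cross-ratio triples of admissible quadruples. -/
def PreservesCrt (d : ExtMetric X) (d' : ExtMetric Y) (f : X → Y) : Prop :=
  ∀ x y z u : X, Admissible x y z u → ProjEq (d'.crt (f x) (f y) (f z) (f u)) (d.crt x y z u)

/-- Each of the three products contains every entry once, so the weights form a common factor. -/
theorem projEq_of_factor {d' : ExtMetric Y} {x y z u : X} {x' y' z' u' : Y} (w : X → ℝ)
    (hw : ∀ x, w x ≠ 0) (h1 : d'.factor x' y' = w x * w y * d.factor x y)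
    (h2 : d'.factor z' u' = w z * w u * d.factor z u)
    (h3 : d'.factor x' z' = w x * w z * d.factor x z)
    (h4 : d'.factor y' u' = w y * w u * d.factor y u)
    (h5 : d'.factor x' u' = w x * w u * d.factor x u)
    (h6 : d'.factor y' z' = w y * w z * d.factor y z) :
    ProjEq (d'.crt x' y' z' u') (d.crt x y z u) := by
  refine ⟨w x * w y * w z * w u,
    mul_ne_zero (mul_ne_zero (mul_ne_zero (hw x) (hw y)) (hw z)) (hw u), ?_⟩
  simp only [ExtMetric.crt, h1, h2, h3, h4, h5, h6, Prod.smul_mk, smul_eq_mul]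
  refine Prod.ext ?_ (Prod.ext ?_ ?_) <;> ring

theorem preservesCrt_of_factor {d' : ExtMetric Y} {f : X → Y} (w : X → ℝ) (hw : ∀ x, w x ≠ 0)
    (h : ∀ x y, d'.factor (f x) (f y) = w x * w y * d.factor x y) : PreservesCrt d d' f :=
  fun x y z u _ => projEq_of_factor w hw (h x y) (h z u) (h x z) (h y u) (h x u) (h y z)

theorem Admissible.map {f : X → Y} (hf : Function.Injective f) {x y z u : X}
    (h : Admissible x y z u) : Admissible (f x) (f y) (f z) (f u) := by
  simpa only [Admissible, hf.eq_iff] using h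

theorem PreservesCrt.comp {Z : Type*} {d' : ExtMetric Y} {d'' : ExtMetric Z} {f : X → Y}
    {g : Y → Z} (hg : PreservesCrt d' d'' g) (hf : PreservesCrt d d' f)
    (hfi : Function.Injective f) : PreservesCrt d d'' (g ∘ f) :=
  fun x y z u h => (hg _ _ _ _ (h.map hfi)).trans (hf x y z u h)

/-- A map that preserves the cross-ratio triples and the infinitely remote point is a
homothety. -/
theorem PreservesCrt.exists_factor {d' : ExtMetric Y} {f : X → Y} (hf : PreservesCrt d d' f)
    (hfi : Function.Injective f) {ω : X} (hω : d.infty = some ω) (hω' : d'.infty = some (f ω)) :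
    ∃ l : ℝ, 0 < l ∧ ∀ x y, x ≠ ω → y ≠ ω → d'.factor (f x) (f y) = l * d.factor x y := by
  have key : ∀ x y z, x ≠ ω → y ≠ ω → z ≠ ω → x ≠ y → x ≠ z →
      d'.factor (f x) (f y) / d.factor x y = d'.factor (f x) (f z) / d.factor x z := by
    intro x y z hx hy hz hxy hxz
    obtain ⟨c, -, h⟩ := hf x y z ω ⟨fun h => hxy h.1, fun h => hxy h.1, fun h => hxz h.1,
      fun h => hz h.2⟩
    have h1 := congrArg Prod.fst h
    have h2 := congrArg (fun v => v.2.1) h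
    simp only [ExtMetric.crt, d.factor_infty hω hx, d.factor_infty hω hy, d.factor_infty hω hz,
      d'.factor_infty hω' (hfi.ne hx), d'.factor_infty hω' (hfi.ne hy),
      d'.factor_infty hω' (hfi.ne hz), Prod.smul_mk, smul_eq_mul, mul_one] at h1 h2
    rw [h1, h2, mul_div_cancel_right₀ _ (d.factor_pos hxy).ne',
      mul_div_cancel_right₀ _ (d.factor_pos hxz).ne']
  by_cases hX : ∃ a b, a ≠ ω ∧ b ≠ ω ∧ a ≠ b
  · obtain ⟨a, b, ha, hb, hab⟩ := hX
    refine ⟨d'.factor (f a) (f b) / d.factor a b,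
      div_pos (d'.factor_pos (hfi.ne hab)) (d.factor_pos hab), fun x y hx hy => ?_⟩
    by_cases hxy : x = y
    · rw [hxy, d.factor_self, d'.factor_self, mul_zero]
    rw [← div_eq_iff (d.factor_pos hxy).ne']
    by_cases hxb : x = b
    · subst hxb
      rw [key x y a hx hy ha hxy hab.symm, d.factor_comm, d'.factor_comm]
    · rw [key x y b hx hy hb hxy hxb, d.factor_comm, d'.factor_comm,
        key b x a hb hx ha (Ne.symm hxb) hab.symm, d.factor_comm, d'.factor_comm]
  · push Not at hX
    refine ⟨1, one_pos, fun x y hx hy => ?_⟩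
    rw [hX x y hx hy, d.factor_self, d'.factor_self, mul_zero]

end Factor

section Space

variable {X Y : Type*} [MobiusSpace X] [MobiusSpace Y]

theorem preservesCrt_id {d d' : ExtMetric X} (hd : d ∈ metrics X) (hd' : d' ∈ metrics X) :
    PreservesCrt d d' id := MobiusSpace.equiv d' hd' d hd

theorem IsMobius.of_preservesCrt {d : ExtMetric X} {d' : ExtMetric Y} (hd : d ∈ metrics X)
    (hd' : d' ∈ metrics Y) {f : X → Y} (hfi : Function.Injective f) (hf : PreservesCrt d d' f) :
    IsMobius f :=
  ⟨hfi, fun _ he _ he' x y z u h => (preservesCrt_id hd' he' _ _ _ _ (h.map hfi)).trans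
    ((hf x y z u h).trans (preservesCrt_id he hd x y z u h))⟩

theorem IsMobius.comp {Z : Type*} [MobiusSpace Z] {f : X → Y} {g : Y → Z} (hg : IsMobius g)
    (hf : IsMobius f) : IsMobius (g ∘ f) := by
  obtain ⟨e, he⟩ := MobiusSpace.nonempty (X := Y)
  exact ⟨hg.1.comp hf.1, fun d hd d' hd' =>
    PreservesCrt.comp (hg.2 e he d' hd') (hf.2 d hd e he) hf.1⟩

theorem IsMobius.symm {f : X ≃ Y} (hf : IsMobius f) : IsMobius f.symm :=
  ⟨f.symm.injective, fun d hd d' hd' x y z u h => by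
    have := hf.2 d' hd' d hd _ _ _ _ (h.map f.symm.injective)
    simp only [Equiv.apply_symm_apply] at this
    exact this.symm⟩

/-- Every point is infinitely remote for some metric of a Ptolemy space. -/
theorem exists_metric (hP : IsPtolemySpace X) (p : X) : ∃ d ∈ metrics X, d.infty = some p := by
  classical
  obtain ⟨d, hd⟩ := MobiusSpace.nonempty (X := X)
  -- This is the metric inversion of d at p. Its triangle inequality is Ptolemy's inequality for
  -- quadruples with last entry p.
  let F : X → X → ℝ≥0∞ := fun x y => if x = y then 0 else if x = p ∨ y = p then ⊤ else
    ENNReal.ofReal (d.factor x y / (d.factor x p * d.factor y p))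
  have hF0 : ∀ x, F x x = 0 := fun x => if_pos rfl
  have hFt : ∀ {x y}, x ≠ y → (x = p ∨ y = p) → F x y = ⊤ := fun h h' => by
    simp only [F, if_neg h, if_pos h']
  have hFr : ∀ {x y}, x ≠ p → y ≠ p →
      F x y = ENNReal.ofReal (d.factor x y / (d.factor x p * d.factor y p)) := by
    intro x y hx hy
    by_cases h : x = y
    · rw [h, hF0, d.factor_self, zero_div, ENNReal.ofReal_zero]
    · simp only [F, if_neg h, hx, hy, or_self, if_false]
  have hpos : ∀ {x y}, x ≠ p → y ≠ p → x ≠ y →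
      0 < d.factor x y / (d.factor x p * d.factor y p) := fun hx hy h =>
    div_pos (d.factor_pos h) (mul_pos (d.factor_pos hx) (d.factor_pos hy))
  let d' : ExtMetric X :=
    { dist := F
      infty := some p
      dist_eq_zero_iff := by
        intro x y
        refine ⟨fun h => ?_, fun h => h ▸ hF0 x⟩
        by_contra hxy
        by_cases hp : x = p ∨ y = p
        · rw [hFt hxy hp] at h
          exact ENNReal.top_ne_zero h
        · push Not at hp
          rw [hFr hp.1 hp.2, ENNReal.ofReal_eq_zero] at h
          exact absurd (hpos hp.1 hp.2 hxy) (not_lt.2 h)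
      dist_comm := by
        intro x y
        simp only [F, d.factor_comm x y, mul_comm (d.factor x p), eq_comm (a := x) (b := y),
          or_comm (a := x = p)]
      dist_triangle := by
        intro x y z
        by_cases hxz : x = z
        · rw [hxz, hF0]
          exact zero_le
        by_cases hxy : x = y
        · rw [hxy, hF0, zero_add]
        by_cases hyz : y = z
        · rw [hyz, hF0, add_zero]
        by_cases hx : x = p
        · rw [hFt hxy (Or.inl hx), top_add]
          exact le_top
        by_cases hy : y = p
        · rw [hFt hxy (Or.inr hy), top_add]
          exact le_top
        by_cases hz : z = p
        · rw [hFt hyz (Or.inr hz), add_top]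
          exact le_top
        rw [hFr hx hz, hFr hx hy, hFr hy hz, ← ENNReal.ofReal_add (hpos hx hy hxy).le
          (hpos hy hz hyz).le]
        refine ENNReal.ofReal_le_ofReal ?_
        have h1 := (hP d hd x y z p ⟨fun h => hxy h.1, fun h => hxy h.1, fun h => hxz h.1,
          fun h => hyz h.1⟩).2.1
        simp only [ExtMetric.crt] at h1
        have hx' := d.factor_pos hx
        have hy' := d.factor_pos hy
        have hz' := d.factor_pos hz
        rw [div_add_div _ _ (mul_pos hx' hy').ne' (mul_pos hy' hz').ne',
          div_le_div_iff₀ (mul_pos hx' hz') (mul_pos (mul_pos hx' hy') (mul_pos hy' hz'))]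
        have := mul_le_mul_of_nonneg_left h1
          (mul_pos (mul_pos hx' hy') hz').le
        nlinarith
      dist_eq_top_iff := by
        intro x y
        rw [Option.some_inj, Option.some_inj, eq_comm (a := p), eq_comm (a := p)]
        refine ⟨fun h => ?_, fun h => hFt h.1 h.2⟩
        refine ⟨fun hxy => ?_, ?_⟩
        · rw [hxy, hF0] at h
          exact ENNReal.zero_ne_top h
        · by_contra hp
          push Not at hp
          rw [hFr hp.1 hp.2] at h
          exact ENNReal.ofReal_ne_top h }
  refine ⟨d', MobiusSpace.full d hd d' fun x y z u h => ProjEq.symm ?_, rfl⟩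
  have hi : d'.infty = some p := rfl
  refine preservesCrt_of_factor (d := d) (d' := d') (f := id)
    (fun x => if x = p then 1 else (d.factor x p)⁻¹) ?_ ?_ x y z u h
  · intro x
    split_ifs with hx
    · exact one_ne_zero
    · exact inv_ne_zero (d.factor_pos hx).ne'
  · intro x y
    change d'.factor x y = (if x = p then 1 else (d.factor x p)⁻¹) *
      (if y = p then 1 else (d.factor y p)⁻¹) * d.factor x y
    by_cases hx : x = p
    · by_cases hy : y = p
      · rw [hx, hy, d.factor_self, d'.factor_self, mul_zero]
      · rw [hx, if_pos rfl, if_neg hy, d'.factor_comm, d'.factor_infty hi hy, d.factor_comm p,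
          one_mul, inv_mul_cancel₀ (d.factor_pos hy).ne']
    · by_cases hy : y = p
      · rw [hy, if_pos rfl, if_neg hx, d'.factor_infty hi hx, mul_one,
          inv_mul_cancel₀ (d.factor_pos hx).ne']
      · rw [if_neg hx, if_neg hy, d'.factor_eq ((ExtMetric.ne_infty hi).2 hx)
          ((ExtMetric.ne_infty hi).2 hy)]
        change (F x y).toReal = _
        rw [hFr hx hy, ENNReal.toReal_ofReal (div_nonneg (d.factor_nonneg _ _)
          (mul_nonneg (d.factor_nonneg _ _) (d.factor_nonneg _ _))), div_eq_mul_inv, mul_inv,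
          mul_comm]

end Space

/-! ### The metric space of the points that are not infinitely remote -/

/-- The points that are not infinitely remote. -/
@[ext]
structure Pt {X : Type*} (d : ExtMetric X) where
  val : X
  infty_ne : d.infty ≠ some val

section Pt

variable {X : Type*} {d : ExtMetric X}

theorem Pt.val_injective : Function.Injective (Pt.val (d := d)) := fun _ _ => Pt.ext

noncomputable instance : MetricSpace (Pt d) where
  dist x y := (d.dist x.val y.val).toReal
  dist_self x := by rw [d.dist_self, ENNReal.toReal_zero]
  dist_comm x y := by rw [d.dist_comm]
  dist_triangle x y z := by
    rw [← ENNReal.toReal_add (d.dist_ne_top x.infty_ne y.infty_ne) (d.dist_ne_top y.infty_ne z.infty_ne)]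
    exact ENNReal.toReal_mono (ENNReal.add_ne_top.2
      ⟨d.dist_ne_top x.infty_ne y.infty_ne, d.dist_ne_top y.infty_ne z.infty_ne⟩) (d.dist_triangle _ _ _)
  eq_of_dist_eq_zero {x y} h := Pt.val_injective <| (d.dist_eq_zero_iff _ _).1 <|
    ((ENNReal.toReal_eq_zero_iff _).1 h).resolve_right (d.dist_ne_top x.infty_ne y.infty_ne)

theorem Pt.dist_eq (x y : Pt d) : dist x y = d.factor x.val y.val :=
  (d.factor_eq x.infty_ne y.infty_ne).symm

theorem Pt.ofReal_dist (x y : Pt d) : ENNReal.ofReal (dist x y) = d.dist x.val y.val :=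
  ENNReal.ofReal_toReal (d.dist_ne_top x.infty_ne y.infty_ne)

variable {ω : X} (hω : d.infty = some ω)
include hω

theorem Pt.val_ne (x : Pt d) : x.val ≠ ω := (ExtMetric.ne_infty hω).1 x.infty_ne

theorem Pt.exists_val_eq {x : X} (hx : x ≠ ω) : ∃ y : Pt d, y.val = x :=
  ⟨⟨x, (ExtMetric.ne_infty hω).2 hx⟩, rfl⟩

theorem Pt.range_val : range (Pt.val (d := d)) = {ω}ᶜ := by
  ext x
  exact ⟨fun ⟨y, hy⟩ => hy ▸ Pt.val_ne hω y, fun hx => Pt.exists_val_eq hω hx⟩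

theorem eq_or_exists_val (x : X) : x = ω ∨ ∃ y : Pt d, y.val = x := by
  by_cases hx : x = ω
  · exact Or.inl hx
  · exact Or.inr (Pt.exists_val_eq hω hx)

end Pt

section Topology

variable {X : Type*} [MobiusSpace X] {d : ExtMetric X}

theorem isOpen_of_isOpen_topology (hd : d ∈ metrics X) {s : Set X} (hs : IsOpen[d.topology] s) :
    IsOpen s :=
  (iInf₂_le d hd : mobiusTopology X ≤ d.topology) s hs

theorem isOpen_image_ball (hd : d ∈ metrics X) (x : Pt d) (r : ℝ) :
    IsOpen (Pt.val '' Metric.ball x r) := by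
  rcases le_or_gt r 0 with hr | hr
  · rw [Metric.ball_eq_empty.2 hr, image_empty]
    exact isOpen_empty
  refine isOpen_of_isOpen_topology hd
    (TopologicalSpace.isOpen_generateFrom_of_mem ⟨x.val, r, x.infty_ne, hr, Or.inl ?_⟩)
  ext y
  constructor
  · rintro ⟨y, hy, rfl⟩
    rw [Metric.mem_ball, dist_comm] at hy
    change d.dist x.val y.val < _
    rwa [← Pt.ofReal_dist, ENNReal.ofReal_lt_ofReal_iff hr]
  · intro hy
    change d.dist x.val y < _ at hy
    have hy' : d.infty ≠ some y := by
      intro h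
      have hxy : x.val ≠ y := fun h' => x.infty_ne (h.trans (congrArg some h'.symm))
      rw [d.dist_infty h hxy] at hy
      exact not_top_lt hy
    refine ⟨⟨y, hy'⟩, ?_, rfl⟩
    rw [Metric.mem_ball, dist_comm, ← ENNReal.ofReal_lt_ofReal_iff hr, Pt.ofReal_dist]
    exact hy

theorem isClosed_image_closedBall (hd : d ∈ metrics X) (x : Pt d) {r : ℝ} (hr : 0 < r) :
    IsClosed (Pt.val '' Metric.closedBall x r) := by
  refine ⟨isOpen_of_isOpen_topology hd
    (TopologicalSpace.isOpen_generateFrom_of_mem ⟨x.val, r, x.infty_ne, hr, Or.inr ?_⟩)⟩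
  congr 1
  ext y
  constructor
  · rintro ⟨y, hy, rfl⟩
    rw [Metric.mem_closedBall, dist_comm] at hy
    change d.dist x.val y.val ≤ _
    rwa [← Pt.ofReal_dist, ENNReal.ofReal_le_ofReal_iff hr.le]
  · intro hy
    change d.dist x.val y ≤ _ at hy
    have hy' : d.infty ≠ some y := by
      intro h
      have hxy : x.val ≠ y := fun h' => x.infty_ne (h.trans (congrArg some h'.symm))
      rw [d.dist_infty h hxy, top_le_iff] at hy
      exact ENNReal.ofReal_ne_top hy
    refine ⟨⟨y, hy'⟩, ?_, rfl⟩
    rw [Metric.mem_closedBall, dist_comm, ← ENNReal.ofReal_le_ofReal_iff hr.le, Pt.ofReal_dist]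
    exact hy

variable {ω : X}

omit [MobiusSpace X] in
theorem topology_t2 (hω : d.infty = some ω) : @T2Space X d.topology := by
  have hball : ∀ (x : X) (r : ℝ), x ≠ ω → 0 < r →
      IsOpen[d.topology] {y | d.dist x y < ENNReal.ofReal r} := fun x r hx hr =>
    TopologicalSpace.isOpen_generateFrom_of_mem
      ⟨x, r, (ExtMetric.ne_infty hω).2 hx, hr, Or.inl rfl⟩
  have hcl : ∀ (x : X) (r : ℝ), x ≠ ω → 0 < r →
      IsOpen[d.topology] {y | d.dist x y ≤ ENNReal.ofReal r}ᶜ := fun x r hx hr =>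
    TopologicalSpace.isOpen_generateFrom_of_mem
      ⟨x, r, (ExtMetric.ne_infty hω).2 hx, hr, Or.inr rfl⟩
  have key : ∀ x y : X, x ≠ ω → x ≠ y → ∃ u v, IsOpen[d.topology] u ∧ IsOpen[d.topology] v ∧
      x ∈ u ∧ y ∈ v ∧ Disjoint u v := by
    intro x y hx hxy
    obtain ⟨r, hr, hr'⟩ : ∃ r : ℝ, 0 < r ∧ ENNReal.ofReal r < d.dist x y := by
      have h0 : 0 < d.dist x y := pos_iff_ne_zero.2 fun h => hxy ((d.dist_eq_zero_iff x y).1 h)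
      obtain ⟨a, ha, ha'⟩ := ENNReal.lt_iff_exists_real_btwn.1 h0
      exact ⟨a, ENNReal.ofReal_pos.1 ha'.1, ha'.2⟩
    refine ⟨_, _, hball x r hx hr, hcl x r hx hr, ?_, not_le.2 hr', ?_⟩
    · change d.dist x x < _
      rw [d.dist_self]
      exact ENNReal.ofReal_pos.2 hr
    · rw [disjoint_compl_right_iff_subset]
      exact fun z (hz : d.dist x z < _) => hz.le
  refine @T2Space.mk X d.topology fun x y hxy => ?_
  by_cases hx : x = ω
  · obtain ⟨u, v, hu, hv, h1, h2, h3⟩ := key y x (fun h => hxy (hx.trans h.symm)) hxy.symm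
    exact ⟨v, u, hv, hu, h2, h1, h3.symm⟩
  · exact key x y hx hxy

variable [CompactSpace X] (hd : d ∈ metrics X) (hω : d.infty = some ω)
include hd hω

/-- A compact topology finer than a Hausdorff one coincides with it. -/
theorem mobiusTopology_eq : mobiusTopology X = d.topology := by
  have hle : mobiusTopology X ≤ d.topology := iInf₂_le d hd
  refine le_antisymm hle ?_
  have hT := topology_t2 hω
  rw [TopologicalSpace.le_def]
  intro s hs
  have h1 : IsCompact sᶜ := hs.isClosed_compl.isCompact
  have h2 : @IsCompact X d.topology sᶜ := by
    have h3 := @IsCompact.image X X (mobiusTopology X) d.topology _ _ h1 (continuous_id_of_le hle)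
    rwa [image_id] at h3
  have h4 := @IsCompact.isClosed X d.topology hT _ h2
  have := h4.isOpen_compl
  rwa [compl_compl] at this

theorem t2Space : T2Space X := by
  rw [mobiusTopology_eq hd hω]
  exact topology_t2 hω

theorem isOpenEmbedding_val : IsOpenEmbedding (Pt.val : Pt d → X) := by
  refine IsOpenEmbedding.of_continuous_injective_isOpenMap ?_ Pt.val_injective ?_
  · rw [mobiusTopology_eq hd hω]
    refine continuous_generateFrom_iff.2 ?_
    rintro s ⟨x, r, hx, hr, rfl | rfl⟩
    · have : Pt.val ⁻¹' {y | d.dist x y < ENNReal.ofReal r} =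
          Metric.ball (⟨x, hx⟩ : Pt d) r := by
        ext y
        rw [Metric.mem_ball, dist_comm, ← ENNReal.ofReal_lt_ofReal_iff hr, Pt.ofReal_dist]
        rfl
      rw [this]
      exact Metric.isOpen_ball
    · have : Pt.val ⁻¹' {y | d.dist x y ≤ ENNReal.ofReal r} =
          Metric.closedBall (⟨x, hx⟩ : Pt d) r := by
        ext y
        rw [Metric.mem_closedBall, dist_comm, ← ENNReal.ofReal_le_ofReal_iff hr.le,
          Pt.ofReal_dist]
        rfl
      rw [preimage_compl, this]
      exact Metric.isClosed_closedBall.isOpen_compl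
  · intro U hU
    have : Pt.val '' U = ⋃ p : {p : Pt d × ℝ // Metric.ball p.1 p.2 ⊆ U},
        Pt.val '' Metric.ball p.1.1 p.1.2 := by
      rw [← image_iUnion]
      congr 1
      ext x
      rw [mem_iUnion]
      constructor
      · intro hx
        obtain ⟨r, hr, h⟩ := Metric.isOpen_iff.1 hU x hx
        exact ⟨⟨(x, r), h⟩, Metric.mem_ball_self hr⟩
      · rintro ⟨p, hp⟩
        exact p.2 hp
    rw [this]
    exact isOpen_iUnion fun p => isOpen_image_ball hd _ _

/-- Complements of closed balls are open in X by definition, so closed balls are closed in a compact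
space. -/
theorem properSpace_pt : ProperSpace (Pt d) := by
  refine ProperSpace.of_isCompact_closedBall_of_le 1 fun x r hr => ?_
  rw [(isOpenEmbedding_val hd hω).isInducing.isCompact_iff]
  exact (isClosed_image_closedBall hd x (one_pos.trans_le hr)).isCompact

/-- The infinitely remote point is the limit at infinity. -/
theorem tendsto_val_infty {ι : Type*} {l : Filter ι} {f : ι → Pt d} (x : Pt d)
    (h : Tendsto (fun i => dist (f i) x) l atTop) :
    Tendsto (fun i => (f i).val) l (𝓝 ω) := by
  have hT := t2Space hd hω
  rw [tendsto_def]
  intro s hs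
  obtain ⟨u, hus, hu, hωu⟩ := mem_nhds_iff.1 hs
  have h1 : IsCompact (Pt.val ⁻¹' uᶜ : Set (Pt d)) := by
    refine (isOpenEmbedding_val hd hω).isInducing.isCompact_preimage_iff ?_ |>.2
      hu.isClosed_compl.isCompact
    rw [Pt.range_val hω]
    exact compl_subset_compl.2 (singleton_subset_iff.2 hωu)
  obtain ⟨r, hr⟩ := h1.isBounded.subset_closedBall x
  filter_upwards [h.eventually (eventually_gt_atTop r)] with i hi
  by_contra hc
  exact absurd (Metric.mem_closedBall.1 (hr (fun h => hc (hus h)))) (not_le.2 hi)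

omit [CompactSpace X] in
theorem tendsto_dist_of_val {ι : Type*} {l : Filter ι} {f : ι → Pt d} (x : Pt d)
    (h : Tendsto (fun i => (f i).val) l (𝓝 ω)) : Tendsto (fun i => dist (f i) x) l atTop := by
  rw [tendsto_atTop]
  intro r
  have h1 : (Pt.val '' Metric.closedBall x (max r 1))ᶜ ∈ 𝓝 ω := by
    refine (isClosed_image_closedBall hd x (lt_max_of_lt_right one_pos)).isOpen_compl.mem_nhds ?_
    rintro ⟨y, -, hy⟩
    exact Pt.val_ne hω y hy
  filter_upwards [h.eventually h1] with i hi
  by_contra hc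
  exact hi ⟨f i, Metric.mem_closedBall.2 ((not_le.1 hc).le.trans (le_max_left _ _)), rfl⟩

-- With ω and f ω infinitely remote, f is a homothety and pulls generating open sets back to
-- generating open sets.
omit hd hω in
theorem IsMobius.continuous (hP : IsPtolemySpace X) {f : X ≃ X} (hf : IsMobius f) :
    Continuous f := by
  rcases isEmpty_or_nonempty X with hX | ⟨⟨ω⟩⟩
  · exact continuous_of_discreteTopology
  obtain ⟨d, hd, hω⟩ := exists_metric hP ω
  obtain ⟨d', hd', hω'⟩ := exists_metric hP (f ω)
  obtain ⟨l, hl, hfl⟩ := PreservesCrt.exists_factor (hf.2 d hd d' hd') f.injective hω hω'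
  have key : ∀ x y, x ≠ ω → d'.dist (f x) (f y) = ENNReal.ofReal l * d.dist x y := by
    intro x y hx
    have hx' : f x ≠ f ω := f.injective.ne hx
    by_cases hy : y = ω
    · rw [hy, d'.dist_infty hω' hx', d.dist_infty hω hx, ENNReal.mul_top]
      exact (ENNReal.ofReal_pos.2 hl).ne'
    · have h := hfl x y hx hy
      have hy' : f y ≠ f ω := f.injective.ne hy
      rw [d'.factor_eq ((ExtMetric.ne_infty hω').2 hx') ((ExtMetric.ne_infty hω').2 hy'),
        d.factor_eq ((ExtMetric.ne_infty hω).2 hx) ((ExtMetric.ne_infty hω).2 hy)] at h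
      rw [← ENNReal.ofReal_toReal (d'.dist_ne_top ((ExtMetric.ne_infty hω').2 hx')
        ((ExtMetric.ne_infty hω').2 hy')), h, ENNReal.ofReal_mul hl.le,
        ENNReal.ofReal_toReal (d.dist_ne_top ((ExtMetric.ne_infty hω).2 hx)
        ((ExtMetric.ne_infty hω).2 hy))]
  have hg : @Continuous X X d.topology d'.topology f := by
    refine continuous_generateFrom_iff.2 ?_
    have hl0 : ENNReal.ofReal l ≠ 0 := (ENNReal.ofReal_pos.2 hl).ne'
    rintro s ⟨x, r, hx, hr, h⟩
    obtain ⟨x, rfl⟩ := f.surjective x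
    have hx' : x ≠ ω := fun h => hx (by rw [h, hω'])
    refine TopologicalSpace.isOpen_generateFrom_of_mem
      ⟨x, r / l, (ExtMetric.ne_infty hω).2 hx', div_pos hr hl, ?_⟩
    rw [ENNReal.ofReal_div_of_pos hl]
    rcases h with rfl | rfl
    · left
      ext y
      change d'.dist (f x) (f y) < _ ↔ d.dist x y < _
      rw [key x y hx', ENNReal.lt_div_iff_mul_lt (Or.inl hl0) (Or.inl ENNReal.ofReal_ne_top),
        mul_comm]
    · right
      ext y
      change ¬ d'.dist (f x) (f y) ≤ _ ↔ ¬ d.dist x y ≤ _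
      rw [key x y hx', ENNReal.le_div_iff_mul_le (Or.inl hl0) (Or.inl ENNReal.ofReal_ne_top),
        mul_comm]
  rwa [← mobiusTopology_eq hd hω, ← mobiusTopology_eq hd' hω'] at hg

end Topology

/-! ### Ptolemy circles and lines -/

section Transport

variable {X : Type*} [MobiusSpace X]

/-- Separation depends only on the topology of the parameter space K. -/
theorem Separates.transport {K : Type*} [TopologicalSpace K] {i i' : K → X} (hi : IsEmbedding i)
    (hi' : IsEmbedding i') {x z y u : K} (h : Separates (range i') (i' x) (i' z) (i' y) (i' u)) :
    Separates (range i) (i x) (i z) (i y) (i u) := by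
  obtain ⟨⟨-, hy⟩, ⟨-, hu⟩, h⟩ := h
  have hmem : ∀ {j j' : K → X}, IsEmbedding j → IsEmbedding j' → ∀ {v : K},
      j' v ∉ ({j' x, j' z} : Set X) → j v ∉ ({j x, j z} : Set X) := by
    intro j j' hj hj' v hv
    simpa only [mem_insert_iff, mem_singleton_iff, hj.injective.eq_iff,
      hj'.injective.eq_iff] using hv
  refine ⟨⟨mem_range_self _, hmem hi hi' hy⟩, ⟨mem_range_self _, hmem hi hi' hu⟩, fun hc => h ?_⟩
  set C := connectedComponentIn (range i \ {i x, i z}) (i y) with hC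
  have hCs : C ⊆ range i \ {i x, i z} := connectedComponentIn_subset _ _
  have hCp : IsPreconnected C := isPreconnected_connectedComponentIn
  have hyC : i y ∈ C := mem_connectedComponentIn ⟨mem_range_self _, hmem hi hi' hy⟩
  have h1 : i '' (i ⁻¹' C) = C :=
    image_preimage_eq_of_subset fun v hv => (hCs hv).1
  have h2 : IsPreconnected (i ⁻¹' C) := by
    rw [← hi.isInducing.isPreconnected_image, h1]
    exact hCp
  have h3 : IsPreconnected (i' '' (i ⁻¹' C)) := h2.image _ hi'.continuous.continuousOn
  refine h3.subset_connectedComponentIn (mem_image_of_mem _ hyC) ?_ (mem_image_of_mem _ hc)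
  rintro _ ⟨v, hv, rfl⟩
  exact ⟨mem_range_self _, hmem hi' hi (hCs hv).2⟩

/-- Used both for images under Möbius maps and for passing from one line to another. -/
theorem IsPtolemyCircle.transport {K : Type*} [TopologicalSpace K] {i i' : K → X}
    (hi : IsEmbedding i) (hi' : IsEmbedding i') (hσ : IsPtolemyCircle (range i))
    {d : ExtMetric X} (hd : d ∈ metrics X)
    (h : ∀ x y z u : K, Admissible x y z u →
      ProjEq (d.crt (i' x) (i' y) (i' z) (i' u)) (d.crt (i x) (i y) (i z) (i u))) :
    IsPtolemyCircle (range i') := by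
  obtain ⟨⟨e⟩, hσ⟩ := hσ
  refine ⟨⟨hi'.toHomeomorph.symm.trans (hi.toHomeomorph.trans e)⟩, ?_⟩
  rintro d' hd' _ ⟨x, rfl⟩ _ ⟨y, rfl⟩ _ ⟨z, rfl⟩ _ ⟨u, rfl⟩ hnd hsep
  have hnd' : [x, y, z, u].Nodup := List.Nodup.of_map i' hnd
  have hnd2 : [i x, i y, i z, i u].Nodup := hnd'.map hi.injective
  have hadm : Admissible x y z u := by
    simp only [List.nodup_cons, List.mem_cons, not_or, List.not_mem_nil] at hnd'
    exact ⟨fun h => hnd'.1.1 h.1, fun h => hnd'.1.1 h.1, fun h => hnd'.1.2.1 h.1,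
      fun h => hnd'.2.1.1 h.1⟩
  have h1 := hσ d hd _ (mem_range_self x) _ (mem_range_self y) _ (mem_range_self z) _
    (mem_range_self u) hnd2 (hsep.transport hi hi')
  obtain ⟨c, -, hc⟩ := (MobiusSpace.equiv d' hd' d hd _ _ _ _ (hadm.map hi'.injective)).trans
    (h x y z u hadm)
  rw [hc]
  simp only [Prod.smul_fst, Prod.smul_snd, smul_eq_mul, h1, mul_add]

variable [CompactSpace X]

theorem IsPtolemyCircle.image (hP : IsPtolemySpace X) {f : X ≃ X} (hf : IsMobius f) {σ : Set X}
    (hσ : IsPtolemyCircle σ) : IsPtolemyCircle (f '' σ) := by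
  obtain ⟨d, hd⟩ := MobiusSpace.nonempty (X := X)
  let F : X ≃ₜ X := ⟨f, hf.continuous hP, hf.symm.continuous hP⟩
  have h1 : range (Subtype.val : σ → X) = σ := Subtype.range_coe
  have h2 : range (F ∘ (Subtype.val : σ → X)) = f '' σ := by rw [range_comp, h1]; rfl
  rw [← h2]
  refine IsPtolemyCircle.transport (i := (Subtype.val : σ → X)) IsEmbedding.subtypeVal
    (F.isEmbedding.comp IsEmbedding.subtypeVal) (by rwa [h1]) hd fun x y z u h => ?_
  exact hf.2 d hd d hd _ _ _ _ (h.map Subtype.val_injective)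

end Transport

section Circle

variable {X : Type*} [MobiusSpace X] [CompactSpace X] {d : ExtMetric X} (hd : d ∈ metrics X)
  {ω : X} (hω : d.infty = some ω)

theorem cos_eq_cos_imp {t m h : ℝ} (ht : t ∈ Ioo 0 (2 * Real.pi)) (h0 : 0 < m - h)
    (h1 : m + h < 2 * Real.pi) (hh : 0 < h) (heq : Real.cos (t - m) = Real.cos h) :
    t = m - h ∨ t = m + h := by
  have hpi := Real.pi_pos
  obtain ⟨k, hk | hk⟩ := Real.cos_eq_cos_iff.1 heq
  · have hk1 : k = 0 := by
      have ha : (k : ℝ) < 1 := by nlinarith [ht.1, ht.2]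
      have hb : (-1 : ℝ) < k := by nlinarith [ht.1, ht.2]
      have ha' : k < 1 := by exact_mod_cast ha
      have hb' : -1 < k := by exact_mod_cast hb
      omega
    rw [hk1] at hk
    right
    push_cast at hk
    linarith
  · have hk1 : k = 0 := by
      have ha : (k : ℝ) < 1 := by nlinarith [ht.1, ht.2]
      have hb : (-1 : ℝ) < k := by nlinarith [ht.1, ht.2]
      have ha' : k < 1 := by exact_mod_cast ha
      have hb' : -1 < k := by exact_mod_cast hb
      omega
    rw [hk1] at hk
    left
    push_cast at hk
    linarith

-- A rotated cosine minus cos h is positive at parameter t₂, negative at p, and vanishes only at t₁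
-- and t₃. A connected set joining the two sides would meet its zeros.
omit [CompactSpace X] in
theorem separates_of_lt {σ : Set X} (e : σ ≃ₜ Circle) (p : Circle) {t₁ t₂ t₃ : ℝ} (h₀ : 0 < t₁)
    (h₁ : t₁ < t₂) (h₂ : t₂ < t₃) (h₃ : t₃ < 2 * Real.pi) :
    Separates σ (e.symm (Circle.exp t₁ * p) : X) (e.symm (Circle.exp t₃ * p) : X)
      (e.symm (Circle.exp t₂ * p) : X) (e.symm p : X) := by
  have hpi := Real.pi_pos
  set m := (t₁ + t₃) / 2 with hm
  set h := (t₃ - t₁) / 2 with hh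
  let g : σ → ℝ := fun x =>
    ((e x * p⁻¹ * Circle.exp (-m) : Circle) : ℂ).re - Real.cos h
  have hg : Continuous g := by
    refine (Complex.continuous_re.comp (continuous_subtype_val.comp ?_)).sub continuous_const
    exact (e.continuous.mul continuous_const).mul continuous_const
  have hgt : ∀ t, g (e.symm (Circle.exp t * p)) = Real.cos (t - m) - Real.cos h := by
    intro t
    simp only [g, Homeomorph.apply_symm_apply, mul_inv_cancel_right]
    rw [← Circle.exp_add, ← sub_eq_add_neg, Circle.coe_exp, Complex.exp_ofReal_mul_I_re]
  have hp : e.symm p = e.symm (Circle.exp 0 * p) := by rw [Circle.exp_zero, one_mul]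
  have hpos : 0 < g (e.symm (Circle.exp t₂ * p)) := by
    rw [hgt, sub_pos]
    rw [← Real.cos_abs (t₂ - m)]
    exact Real.cos_lt_cos_of_nonneg_of_le_pi (abs_nonneg _) (by linarith)
      (abs_lt.2 ⟨by linarith, by linarith⟩)
  have hneg : g (e.symm p) < 0 := by
    rw [hp, hgt, sub_neg, zero_sub, Real.cos_neg]
    rcases le_total m Real.pi with hmp | hmp
    · exact Real.cos_lt_cos_of_nonneg_of_le_pi (by linarith) hmp (by linarith)
    · rw [← Real.cos_two_pi_sub m]
      exact Real.cos_lt_cos_of_nonneg_of_le_pi (by linarith) (by linarith) (by linarith)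
  have hzero : ∀ x : σ, g x = 0 → (x : X) ∈ ({(e.symm (Circle.exp t₁ * p) : X),
      (e.symm (Circle.exp t₃ * p) : X)} : Set X) := by
    intro x hx
    obtain ⟨t, ht, htx⟩ : ∃ t ∈ Ico 0 (2 * Real.pi), x = e.symm (Circle.exp t * p) := by
      refine ⟨toIcoMod Real.two_pi_pos 0 (Complex.arg (e x * p⁻¹ : Circle)), ?_, ?_⟩
      · simpa using toIcoMod_mem_Ico Real.two_pi_pos 0 (Complex.arg (e x * p⁻¹ : Circle))
      · rw [eq_comm, Homeomorph.symm_apply_eq, ← eq_mul_inv_iff_mul_eq]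
        rw [toIcoMod, Circle.periodic_exp.sub_zsmul_eq, Circle.exp_arg]
    have ht0 : t ≠ 0 := by
      rintro rfl
      rw [htx, ← hp] at hx
      exact hneg.ne hx
    rw [htx, hgt, sub_eq_zero] at hx
    rw [htx]
    rcases cos_eq_cos_imp ⟨lt_of_le_of_ne ht.1 ht0.symm, ht.2⟩ (by linarith) (by linarith)
      (by linarith) hx with rfl | rfl
    · rw [show m - h = t₁ by rw [hm, hh]; ring]
      exact mem_insert _ _
    · rw [show m + h = t₃ by rw [hm, hh]; ring]
      exact mem_insert_of_mem _ rfl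
  have hgt1 : g (e.symm (Circle.exp t₁ * p)) = 0 := by
    rw [hgt, show t₁ - m = -h by rw [hm, hh]; ring, Real.cos_neg, sub_self]
  have hgt3 : g (e.symm (Circle.exp t₃ * p)) = 0 := by
    rw [hgt, show t₃ - m = h by rw [hm, hh]; ring, sub_self]
  have hmem : ∀ x : σ, g x ≠ 0 → (x : X) ∈ σ \ {(e.symm (Circle.exp t₁ * p) : X),
      (e.symm (Circle.exp t₃ * p) : X)} := by
    refine fun x hx => ⟨x.2, ?_⟩
    rintro (h' | h')
    · rw [Subtype.ext h'] at hx
      exact hx hgt1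
    · rw [Subtype.ext h'] at hx
      exact hx hgt3
  refine ⟨hmem _ hpos.ne', hmem _ hneg.ne, fun hc => ?_⟩
  set C := connectedComponentIn (σ \ {(e.symm (Circle.exp t₁ * p) : X),
    (e.symm (Circle.exp t₃ * p) : X)}) (e.symm (Circle.exp t₂ * p) : X)
  have hCs : C ⊆ σ \ {(e.symm (Circle.exp t₁ * p) : X), (e.symm (Circle.exp t₃ * p) : X)} :=
    connectedComponentIn_subset _ _
  have hyC : (e.symm (Circle.exp t₂ * p) : X) ∈ C := mem_connectedComponentIn (hmem _ hpos.ne')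
  have h1 : Subtype.val '' (Subtype.val ⁻¹' C : Set σ) = C :=
    image_preimage_eq_of_subset fun v hv => by
      rw [Subtype.range_coe]
      exact (hCs hv).1
  have h2 : IsPreconnected (Subtype.val ⁻¹' C : Set σ) := by
    rw [← IsInducing.subtypeVal.isPreconnected_image, h1]
    exact isPreconnected_connectedComponentIn
  obtain ⟨x, hx, hx0⟩ := h2.intermediate_value (a := e.symm p)
    (b := e.symm (Circle.exp t₂ * p)) hc hyC hg.continuousOn ⟨hneg.le, hpos.le⟩
  exact (hCs hx).2 (hzero x hx0)

include hd hω

/-- A Ptolemy circle through the infinitely remote point is a line. -/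
theorem IsPtolemyCircle.exists_isometry {σ : Set X} (hσ : IsPtolemyCircle σ) (hωσ : ω ∈ σ) :
    ∃ c : ℝ → Pt d, Isometry c ∧ range (fun t => (c t).val) = σ \ {ω} := by
  have hpi := Real.pi_pos
  obtain ⟨⟨e⟩, hσ⟩ := hσ
  set p := e ⟨ω, hωσ⟩ with hp
  have hsp : (e.symm p : X) = ω := by rw [hp, e.symm_apply_apply]
  let γ : ℝ → X := fun t => (e.symm (Circle.exp t * p) : X)
  have hγc : Continuous γ := continuous_subtype_val.comp
    (e.symm.continuous.comp (Circle.exp.continuous.mul continuous_const))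
  have hinj : ∀ s ∈ Ico 0 (2 * Real.pi), ∀ t ∈ Ico 0 (2 * Real.pi), γ s = γ t → s = t := by
    intro s hs t ht h
    have h1 : Circle.exp s = Circle.exp t :=
      mul_right_cancel (e.symm.injective (Subtype.ext h))
    obtain ⟨k, hk⟩ := Circle.exp_eq_exp.1 h1
    have hk1 : k = 0 := by
      have ha : (k : ℝ) < 1 := by nlinarith [ht.1, ht.2, hs.1, hs.2]
      have hb : (-1 : ℝ) < k := by nlinarith [ht.1, ht.2, hs.1, hs.2]
      have ha' : k < 1 := by exact_mod_cast ha
      have hb' : -1 < k := by exact_mod_cast hb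
      omega
    rw [hk1] at hk
    simpa using hk
  have hγ0 : γ 0 = ω := by
    simp only [γ, Circle.exp_zero, one_mul, hsp]
  have hγ2 : γ (2 * Real.pi) = ω := by
    simp only [γ, Circle.exp_two_pi, one_mul, hsp]
  have hne : ∀ t : Ioo 0 (2 * Real.pi), γ t ≠ ω := fun t h =>
    t.2.1.ne' (hinj t (Ioo_subset_Ico_self t.2) 0 ⟨le_rfl, by linarith⟩ (h.trans hγ0.symm))
  let q : Ioo 0 (2 * Real.pi) → Pt d := fun t => ⟨γ t, (ExtMetric.ne_infty hω).2 (hne t)⟩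
  have hqc : Continuous q := by
    rw [(isOpenEmbedding_val hd hω).isInducing.continuous_iff]
    exact hγc.comp continuous_subtype_val
  -- With one entry infinitely remote, Ptolemy's equality is additivity of distance along the arc.
  have hadd : ∀ a b c, a < b → b < c → dist (q a) (q c) = dist (q a) (q b) + dist (q b) (q c) := by
    intro a b c hab hbc
    have hsep := separates_of_lt e p a.2.1 hab hbc c.2.2
    rw [hsp] at hsep
    have hab' : γ a ≠ γ b := fun h =>
      hab.ne (Subtype.ext (hinj a (Ioo_subset_Ico_self a.2) b (Ioo_subset_Ico_self b.2) h))
    have hbc' : γ b ≠ γ c := fun h =>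
      hbc.ne (Subtype.ext (hinj b (Ioo_subset_Ico_self b.2) c (Ioo_subset_Ico_self c.2) h))
    have hac' : γ a ≠ γ c := fun h => (hab.trans hbc).ne
      (Subtype.ext (hinj a (Ioo_subset_Ico_self a.2) c (Ioo_subset_Ico_self c.2) h))
    have h1 := hσ d hd (γ a) (Subtype.coe_prop _) (γ b) (Subtype.coe_prop _) (γ c)
      (Subtype.coe_prop _) ω hωσ (by simp [hab', hbc', hac', hne]) hsep
    simp only [ExtMetric.crt, ExtMetric.factor_infty hω (hne _), mul_one, one_mul] at h1
    rw [Pt.dist_eq, Pt.dist_eq, Pt.dist_eq]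
    exact h1
  let o : Ioo 0 (2 * Real.pi) := ⟨Real.pi, hpi, by linarith⟩
  -- Signed arc length from o. It takes all real values because both ends of the arc tend to ω,
  -- where distances are unbounded; its inverse is the unit speed parametrization.
  let f : Ioo 0 (2 * Real.pi) → ℝ := fun t => if o ≤ t then dist (q o) (q t) else -dist (q t) (q o)
  have hf1 : ∀ a b, a < b → f b - f a = dist (q a) (q b) := by
    intro a b hab
    by_cases ha : o ≤ a
    · have hb : o ≤ b := ha.trans hab.le
      simp only [f, if_pos ha, if_pos hb]
      rcases ha.eq_or_lt with h | h
      · rw [← h, dist_self, sub_zero]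
      · rw [hadd o a b h hab, add_sub_cancel_left]
    · by_cases hb : o ≤ b
      · simp only [f, if_neg ha, if_pos hb]
        rcases hb.eq_or_lt with h | h
        · rw [← h, dist_self, zero_sub, neg_neg]
        · rw [hadd a o b (not_le.1 ha) h, sub_neg_eq_add, add_comm]
      · simp only [f, if_neg ha, if_neg hb]
        rw [hadd a b o hab (not_le.1 hb)]
        ring
  have hf2 : ∀ a b, dist (f a) (f b) = dist (q a) (q b) := by
    intro a b
    rcases lt_trichotomy a b with h | h | h
    · rw [dist_comm, Real.dist_eq, hf1 a b h, abs_of_nonneg dist_nonneg]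
    · rw [h, dist_self, dist_self]
    · rw [Real.dist_eq, hf1 b a h, abs_of_nonneg dist_nonneg, dist_comm]
  have hfc : Continuous f := by
    rw [continuous_iff_continuousAt]
    intro a
    rw [ContinuousAt, tendsto_iff_dist_tendsto_zero]
    simp only [hf2]
    exact tendsto_iff_dist_tendsto_zero.1 (hqc.tendsto a)
  have hcomap : ∀ t₀ ∈ Icc 0 (2 * Real.pi), γ t₀ = ω →
      Tendsto (fun a : Ioo 0 (2 * Real.pi) => dist (q a) (q o)) (comap Subtype.val (𝓝 t₀)) atTop :=
    fun t₀ _ h => tendsto_dist_of_val hd hω (q o)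
      (by rw [← h]; exact (hγc.tendsto t₀).comp tendsto_comap)
  have hIoo : closure (Ioo 0 (2 * Real.pi)) = Icc 0 (2 * Real.pi) :=
    closure_Ioo (by linarith : (0 : ℝ) ≠ 2 * Real.pi)
  have hbig : ∀ r : ℝ, ∃ a, r < f a := by
    intro r
    have h2 : (2 * Real.pi) ∈ Icc 0 (2 * Real.pi) := ⟨by linarith, le_rfl⟩
    have hbot : (comap (Subtype.val : Ioo 0 (2 * Real.pi) → ℝ) (𝓝 (2 * Real.pi))).NeBot :=
      mem_closure_iff_comap_neBot.1 (by rwa [hIoo])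
    have h3 : ∀ᶠ a in comap (Subtype.val : Ioo 0 (2 * Real.pi) → ℝ) (𝓝 (2 * Real.pi)), o ≤ a :=
      (tendsto_comap.eventually (lt_mem_nhds (show Real.pi < 2 * Real.pi by linarith))).mono
        fun a ha => le_of_lt ha
    obtain ⟨a, ha, ha'⟩ := (((hcomap _ h2 hγ2).eventually (eventually_gt_atTop r)).and h3).exists
    refine ⟨a, ?_⟩
    simp only [f, if_pos ha']
    rwa [dist_comm]
  have hsmall : ∀ r : ℝ, ∃ a, f a < r := by
    intro r
    have h2 : (0 : ℝ) ∈ Icc 0 (2 * Real.pi) := ⟨le_rfl, by linarith⟩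
    have hbot : (comap (Subtype.val : Ioo 0 (2 * Real.pi) → ℝ) (𝓝 0)).NeBot :=
      mem_closure_iff_comap_neBot.1 (by rwa [hIoo])
    have h3 : ∀ᶠ a in comap (Subtype.val : Ioo 0 (2 * Real.pi) → ℝ) (𝓝 0), ¬ o ≤ a :=
      (tendsto_comap.eventually (gt_mem_nhds hpi)).mono fun a ha => not_le.2 ha
    obtain ⟨a, ha, ha'⟩ := (((hcomap _ h2 hγ0).eventually (eventually_gt_atTop (-r))).and h3).exists
    refine ⟨a, ?_⟩
    simp only [f, if_neg ha']
    linarith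
  have hsurj : Function.Surjective f := by
    intro r
    obtain ⟨a, ha⟩ := hsmall r
    obtain ⟨b, hb⟩ := hbig r
    have : PreconnectedSpace (Ioo 0 (2 * Real.pi)) :=
      isPreconnected_iff_preconnectedSpace.1 isPreconnected_Ioo
    exact mem_range_of_exists_le_of_exists_ge hfc ⟨a, ha.le⟩ ⟨b, hb.le⟩
  choose g hg using hsurj
  refine ⟨q ∘ g, Isometry.of_dist_eq fun s t => ?_, ?_⟩
  · rw [Function.comp, Function.comp, ← hf2, hg, hg]
  · ext x
    constructor
    · rintro ⟨t, rfl⟩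
      exact ⟨Subtype.coe_prop _, hne _⟩
    · rintro ⟨hx, hxω⟩
      obtain ⟨t, ht, htx⟩ : ∃ t ∈ Ico 0 (2 * Real.pi), x = γ t := by
        refine ⟨toIcoMod Real.two_pi_pos 0 (Complex.arg (e ⟨x, hx⟩ * p⁻¹ : Circle)), ?_, ?_⟩
        · simpa using toIcoMod_mem_Ico Real.two_pi_pos 0 (Complex.arg (e ⟨x, hx⟩ * p⁻¹ : Circle))
        · have : e.symm (Circle.exp (toIcoMod Real.two_pi_pos 0
              (Complex.arg (e ⟨x, hx⟩ * p⁻¹ : Circle))) * p) = ⟨x, hx⟩ := by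
            rw [Homeomorph.symm_apply_eq, ← eq_mul_inv_iff_mul_eq, toIcoMod,
              Circle.periodic_exp.sub_zsmul_eq, Circle.exp_arg]
          exact (congrArg Subtype.val this).symm
      have ht0 : t ≠ 0 := by
        rintro rfl
        exact hxω (htx.trans hγ0)
      let a : Ioo 0 (2 * Real.pi) := ⟨t, lt_of_le_of_ne ht.1 ht0.symm, ht.2⟩
      refine ⟨f a, ?_⟩
      have h1 : dist (q (g (f a))) (q a) = 0 := by rw [← hf2, hg, dist_self]
      exact (congrArg Pt.val (dist_eq_zero.1 h1)).trans htx.symm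

/-- A line together with the infinitely remote point, parametrized by a circle. -/
theorem isEmbedding_elim {c : ℝ → Pt d} (hc : Isometry c) :
    IsEmbedding (fun t : OnePoint ℝ => t.elim ω (fun t => (c t).val)) := by
  have hT := t2Space hd hω
  refine (Continuous.isClosedEmbedding ?_ ?_).isEmbedding
  · rw [OnePoint.continuous_iff]
    refine ⟨?_, (isOpenEmbedding_val hd hω).continuous.comp hc.continuous⟩
    refine tendsto_val_infty hd hω (c 0) ?_
    simp only [hc.dist_eq]
    rw [coclosedCompact_eq_cocompact]
    exact tendsto_dist_right_cocompact_atTop 0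
  · intro s t h
    induction s using OnePoint.rec with
    | infty =>
      induction t using OnePoint.rec with
      | infty => rfl
      | coe t => exact absurd h.symm (Pt.val_ne hω _)
    | coe s =>
      induction t using OnePoint.rec with
      | infty => exact absurd h (Pt.val_ne hω _)
      | coe t => exact congrArg _ (hc.injective (Pt.val_injective h))

omit [MobiusSpace X] [CompactSpace X] hd hω in
theorem range_elim (c : ℝ → Pt d) :
    range (fun t : OnePoint ℝ => t.elim ω (fun t => (c t).val)) =
      insert ω (range fun t => (c t).val) := by
  ext x
  constructor
  · rintro ⟨t, rfl⟩
    induction t using OnePoint.rec with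
    | infty => exact mem_insert _ _
    | coe t => exact mem_insert_of_mem _ ⟨t, rfl⟩
  · rintro (rfl | ⟨t, rfl⟩)
    · exact ⟨OnePoint.infty, rfl⟩
    · exact ⟨(t : OnePoint ℝ), rfl⟩

theorem IsPtolemyCircle.exists_isometry' {σ : Set X} (hσ : IsPtolemyCircle σ) (hωσ : ω ∈ σ) :
    ∃ c : ℝ → Pt d, Isometry c ∧ σ = insert ω (range fun t => (c t).val) := by
  obtain ⟨c, hc, h⟩ := hσ.exists_isometry hd hω hωσ
  refine ⟨c, hc, ?_⟩
  rw [h, insert_sdiff_singleton, insert_eq_of_mem hωσ]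

/-- If there is a Ptolemy circle through the infinitely remote point, then all lines are Ptolemy
circles. -/
theorem IsPtolemyCircle.of_isometry {σ : Set X} (hσ : IsPtolemyCircle σ) (hωσ : ω ∈ σ)
    {c : ℝ → Pt d} (hc : Isometry c) : IsPtolemyCircle (insert ω (range fun t => (c t).val)) := by
  obtain ⟨c₀, hc₀, h⟩ := hσ.exists_isometry' hd hω hωσ
  rw [← range_elim] at h ⊢
  rw [h] at hσ
  refine hσ.transport (isEmbedding_elim hd hω hc₀) (isEmbedding_elim hd hω hc) hd ?_
  -- All lines are isometric, so their parametrizations extended by ω have the same factors.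
  have hfac : ∀ s t : OnePoint ℝ,
      d.factor (s.elim ω fun t => (c t).val) (t.elim ω fun t => (c t).val) =
        1 * 1 * d.factor (s.elim ω fun t => (c₀ t).val) (t.elim ω fun t => (c₀ t).val) := by
    intro s t
    rw [one_mul, one_mul]
    induction s using OnePoint.rec with
    | infty =>
      induction t using OnePoint.rec with
      | infty => rfl
      | coe t =>
        simp only [OnePoint.elim_some, OnePoint.elim_infty, d.factor_comm ω]
        exact (d.factor_infty hω (Pt.val_ne hω _)).trans
          (d.factor_infty hω (Pt.val_ne hω _)).symm
    | coe s =>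
      induction t using OnePoint.rec with
      | infty =>
        exact (d.factor_infty hω (Pt.val_ne hω _)).trans
          (d.factor_infty hω (Pt.val_ne hω _)).symm
      | coe t =>
        simp only [OnePoint.elim_some]
        rw [← Pt.dist_eq, ← Pt.dist_eq, hc.dist_eq, hc₀.dist_eq]
  exact fun x y z u _ => projEq_of_factor (fun _ => 1) (fun _ => one_ne_zero) (hfac x y)
    (hfac z u) (hfac x z) (hfac y u) (hfac x u) (hfac y z)

end Circle

/-! ### Space inversions as inversions of a metric space -/

section Extend

variable {X : Type*} {d : ExtMetric X} {ω : X} (hω : d.infty = some ω)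

open Classical in
/-- The extension of a map by a map that fixes the infinitely remote point. -/
noncomputable def extendFun (g : Pt d → Pt d) (x : X) : X :=
  if h : d.infty ≠ some x then (g ⟨x, h⟩).val else x

theorem extendFun_val (g : Pt d → Pt d) (x : Pt d) : extendFun g x.val = (g x).val :=
  dif_pos x.infty_ne

theorem extendFun_infty (g : Pt d → Pt d) {x : X} (hx : d.infty = some x) : extendFun g x = x :=
  dif_neg (not_not.2 hx)

/-- The extension of a bijection that fixes the infinitely remote point. -/
noncomputable def extend (g : Pt d ≃ Pt d) : X ≃ X where
  toFun := extendFun g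
  invFun := extendFun g.symm
  left_inv x := by
    by_cases h : d.infty = some x
    · rw [extendFun_infty _ h, extendFun_infty _ h]
    · change extendFun g.symm (extendFun g (⟨x, h⟩ : Pt d).val) = _
      rw [extendFun_val, extendFun_val, g.symm_apply_apply]
  right_inv x := by
    by_cases h : d.infty = some x
    · rw [extendFun_infty _ h, extendFun_infty _ h]
    · change extendFun g (extendFun g.symm (⟨x, h⟩ : Pt d).val) = _
      rw [extendFun_val, extendFun_val, g.apply_symm_apply]

theorem extend_val (g : Pt d ≃ Pt d) (x : Pt d) : extend g x.val = (g x).val :=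
  extendFun_val g x

theorem extend_symm_val (g : Pt d ≃ Pt d) (x : Pt d) : (extend g).symm x.val = (g.symm x).val :=
  extendFun_val g.symm x

include hω

theorem extend_infty (g : Pt d ≃ Pt d) : extend g ω = ω := extendFun_infty g hω

theorem extend_symm_infty (g : Pt d ≃ Pt d) : (extend g).symm ω = ω := extendFun_infty g.symm hω

theorem isMobius_extend [MobiusSpace X] (hd : d ∈ metrics X) (g : Pt d ≃ Pt d)
    (hg : ∀ x y, dist (g x) (g y) = dist x y) : IsMobius (extend g) := by
  refine IsMobius.of_preservesCrt hd hd (extend g).injective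
    (preservesCrt_of_factor (fun _ => 1) (fun _ => one_ne_zero) fun x y => ?_)
  rw [one_mul, one_mul]
  rcases eq_or_exists_val hω x with hx | ⟨x, rfl⟩
  · rcases eq_or_exists_val hω y with hy | ⟨y, rfl⟩
    · rw [hx, hy, d.factor_self, d.factor_self]
    · rw [hx, extend_infty hω, extend_val, d.factor_comm, d.factor_comm ω,
        d.factor_infty hω (Pt.val_ne hω _), d.factor_infty hω (Pt.val_ne hω _)]
  · rcases eq_or_exists_val hω y with hy | ⟨y, rfl⟩
    · rw [hy, extend_infty hω, extend_val,
        d.factor_infty hω (Pt.val_ne hω _), d.factor_infty hω (Pt.val_ne hω _)]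
    · rw [extend_val, extend_val, ← Pt.dist_eq, ← Pt.dist_eq, hg]

/-- The restriction of a bijection that fixes the infinitely remote point. -/
def restrict (k : X ≃ X) (hk : k ω = ω) : Pt d ≃ Pt d where
  toFun x := ⟨k x.val, (ExtMetric.ne_infty hω).2 fun h =>
    Pt.val_ne hω x (k.injective (h.trans hk.symm))⟩
  invFun x := ⟨k.symm x.val, (ExtMetric.ne_infty hω).2 fun h =>
    Pt.val_ne hω x (by rw [← k.apply_symm_apply x.val, h, hk])⟩
  left_inv x := Pt.ext (k.symm_apply_apply _)
  right_inv x := Pt.ext (k.apply_symm_apply _)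

theorem extend_restrict (k : X ≃ X) (hk : k ω = ω) :
    extend (restrict (d := d) hω k hk) = k := by
  ext x
  rcases eq_or_exists_val hω x with hx | ⟨x, rfl⟩
  · rw [hx, extend_infty hω, hk]
  · exact extend_val _ x

end Extend

section SpaceInversion

variable {X : Type*} [MobiusSpace X] {d : ExtMetric X} (hd : d ∈ metrics X)
  {ω : X} (hω : d.infty = some ω)

-- With ω infinitely remote, spheres between ω and o are metric spheres about o.
include hω in
theorem setOf_onCommonSphere (hd : d ∈ metrics X) {o x : Pt d} (hx : x ≠ o) :
    {y | OnCommonSphere ω o.val x.val y} = Pt.val '' Metric.sphere o (dist x o) := by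
  have hxo : x.val ≠ o.val := fun h => hx (Pt.ext h)
  have hadm : ∀ y, Admissible ω x.val y o.val := fun y =>
    ⟨fun h => Pt.val_ne hω x h.1.symm, fun h => Pt.val_ne hω x h.1.symm,
      fun h => Pt.val_ne hω o (h.1.trans h.2).symm, fun h => hxo (h.1.trans h.2)⟩
  have h1 : ∀ y, OnCommonSphere ω o.val x.val y ↔
      (d.crt ω x.val y o.val).1 = (d.crt ω x.val y o.val).2.1 ∧ (d.crt ω x.val y o.val).1 ≠ 0 := by
    refine fun y => ⟨fun h => h d hd, fun h d' hd' => ?_⟩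
    obtain ⟨c, hc, h'⟩ := MobiusSpace.equiv d' hd' d hd _ _ _ _ (hadm y)
    rw [h']
    simp only [Prod.smul_fst, Prod.smul_snd, smul_eq_mul]
    exact ⟨congrArg _ h.1, mul_ne_zero hc h.2⟩
  ext y
  rw [mem_ofPred_eq, h1]
  simp only [ExtMetric.crt]
  rw [d.factor_comm ω x.val, d.factor_infty hω (Pt.val_ne hω x), one_mul]
  rcases eq_or_exists_val hω y with hy | ⟨y, rfl⟩
  · rw [hy, d.factor_self, zero_mul]
    refine iff_of_false (fun h => h.2 h.1) ?_
    rintro ⟨z, -, hz⟩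
    exact Pt.val_ne hω z hz
  · rw [d.factor_comm ω y.val, d.factor_infty hω (Pt.val_ne hω y), one_mul, ← Pt.dist_eq,
      ← Pt.dist_eq]
    constructor
    · rintro ⟨h, -⟩
      exact ⟨y, h, rfl⟩
    · rintro ⟨z, hz, h⟩
      rw [← Pt.val_injective h]
      refine ⟨hz, ?_⟩
      rw [Metric.mem_sphere.1 hz]
      exact dist_ne_zero.2 hx

/-- The map `φ` is the space inversion for the pair `ω, o` and the sphere of radius `r`. -/
structure IsInversionAt (d : ExtMetric X) (ω : X) (o : Pt d) (r : ℝ) (φ : X → X) : Prop where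
  pos : 0 < r
  nonempty : (Metric.sphere o r).Nonempty
  isSpaceInversion : IsSpaceInversion ω o.val (Pt.val '' Metric.sphere o r) φ

include hd hω

theorem isSphereBetween_image {o : Pt d} {r : ℝ} (hr : 0 < r)
    (hne : (Metric.sphere o r).Nonempty) :
    IsSphereBetween ω o.val (Pt.val '' Metric.sphere o r) := by
  obtain ⟨x, hx⟩ := hne
  have hxo : x ≠ o := by
    rintro rfl
    rw [Metric.mem_sphere, dist_self] at hx
    exact hr.ne hx
  refine ⟨x.val, Pt.val_ne hω x, fun h => hxo (Pt.ext h), ?_⟩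
  rw [setOf_onCommonSphere hω hd hxo, Metric.mem_sphere.1 hx]

theorem existsUnique_isInversionAt (hI : PropertyI X) {o : Pt d} {r : ℝ} (hr : 0 < r)
    (hne : (Metric.sphere o r).Nonempty) : ∃! φ, IsInversionAt d ω o r φ := by
  obtain ⟨φ, hφ, huni⟩ := hI ω o.val (Pt.val_ne hω o).symm _ (isSphereBetween_image hd hω hr hne)
  exact ⟨φ, ⟨hr, hne, hφ⟩, fun ψ hψ => huni ψ hψ.isSpaceInversion⟩

namespace IsInversionAt

variable {o : Pt d} {r : ℝ} {φ : X → X} (h : IsInversionAt d ω o r φ)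

omit hd hω in
include h in
theorem map_center : φ o.val = ω := by
  rw [← h.isSpaceInversion.map_pole, h.isSpaceInversion.involutive]

/-- A space inversion as a permutation. -/
def toEquiv : X ≃ X := Function.Involutive.toPerm φ h.isSpaceInversion.involutive

include h

omit hd in
theorem exists_val_eq {x : Pt d} (hx : x ≠ o) : ∃ y : Pt d, y ≠ o ∧ y.val = φ x.val := by
  obtain ⟨y, hy⟩ := Pt.exists_val_eq hω (x := φ x.val) fun hc => by
    rw [← h.map_center] at hc
    exact hx (Pt.ext (h.isSpaceInversion.mobius.1 hc))
  refine ⟨y, ?_, hy⟩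
  rintro rfl
  rw [← h.isSpaceInversion.map_pole] at hy
  exact Pt.val_ne hω x (h.isSpaceInversion.mobius.1 hy).symm

/-- Since φ exchanges ω and o, the triple of (x, y, o, ω) relates all three distances by one
constant. Hence dist x' o * dist x o is independent of x, and the invariant sphere shows that it is
r². -/
theorem dist_formulas {x y x' y' : Pt d} (hx : x ≠ o) (hy : y ≠ o) (hx' : x'.val = φ x.val)
    (hy' : y'.val = φ y.val) :
    dist x' o * dist x o = r ^ 2 ∧ dist x' y' = r ^ 2 * dist x y / (dist x o * dist y o) := by
  have key : ∀ {x y x' y' : Pt d}, x ≠ o → y ≠ o → x'.val = φ x.val → y'.val = φ y.val →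
      ∃ c, dist x' y' = c * dist x y ∧ dist y' o = c * dist x o ∧ dist x' o = c * dist y o := by
    intro x y x' y' hx hy hx' hy'
    have hx1 : x.val ≠ o.val := fun h => hx (Pt.ext h)
    have hy1 : y.val ≠ o.val := fun h => hy (Pt.ext h)
    obtain ⟨c, -, hc⟩ := h.isSpaceInversion.mobius.2 d hd d hd x.val y.val o.val ω
      ⟨fun h => hy1 h.2, fun h => Pt.val_ne hω y h.2, fun h => hx1 h.1,
        fun h => hy1 h.1⟩
    rw [← hx', ← hy', h.map_center, h.isSpaceInversion.map_pole] at hc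
    have h1 := congrArg Prod.fst hc
    have h2 := congrArg (fun v => v.2.1) hc
    have h3 := congrArg (fun v => v.2.2) hc
    simp only [ExtMetric.crt, d.factor_infty hω (Pt.val_ne hω _), Prod.smul_mk, smul_eq_mul,
      d.factor_comm ω, mul_one, one_mul, ← Pt.dist_eq] at h1 h2 h3
    exact ⟨c, h1, h2, h3⟩
  have hconst : ∀ {x y x' y' : Pt d}, x ≠ o → y ≠ o → x'.val = φ x.val → y'.val = φ y.val →
      dist x' o * dist x o = dist y' o * dist y o := by
    intro x y x' y' hx hy hx' hy'
    obtain ⟨c, -, h2, h3⟩ := key hx hy hx' hy'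
    rw [h2, h3]
    ring
  have hr : dist x' o * dist x o = r ^ 2 := by
    obtain ⟨z, hz⟩ := h.nonempty
    have hzo : z ≠ o := by
      rintro rfl
      rw [Metric.mem_sphere, dist_self] at hz
      exact h.pos.ne hz
    obtain ⟨z', -, hz'⟩ := h.exists_val_eq hω hzo
    have : φ z.val ∈ Pt.val '' Metric.sphere o r := by
      rw [← h.isSpaceInversion.image_sphere]
      exact mem_image_of_mem _ (mem_image_of_mem _ hz)
    obtain ⟨w, hw, hw'⟩ := this
    rw [← hz'] at hw'
    rw [hconst hx hzo hx' hz', Metric.mem_sphere.1 hz, ← Pt.val_injective hw',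
      Metric.mem_sphere.1 hw, sq]
  refine ⟨hr, ?_⟩
  obtain ⟨c, h1, h2, h3⟩ := key hx hy hx' hy'
  have hx0 := dist_pos.2 hx
  have hy0 := dist_pos.2 hy
  rw [eq_div_iff (mul_pos hx0 hy0).ne', h1, ← hr, h3]
  ring

variable [CompactSpace X] {c : ℝ → Pt d} (hc : Isometry c) {σ : Set X}

/-- The line is preserved and distances to o are known, so only the sign of ± r² / t is open. For
|t| = r the plus sign would give a fixed point; for other t it contradicts the distance formula with
c r. -/
theorem map_line (hσ : IsPtolemyCircle σ) (hωσ : ω ∈ σ) (hc : Isometry c) (hc0 : c 0 = o) {t : ℝ}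
    (ht : t ≠ 0) : φ (c t).val = (c (-r ^ 2 / t)).val := by
  have hr := h.pos
  set τ := insert ω (range fun t => (c t).val) with hτ
  have hcirc : IsPtolemyCircle τ := hσ.of_isometry hd hω hωσ hc
  have himg : φ '' τ = τ := h.isSpaceInversion.image_circle τ hcirc (mem_insert _ _)
    (mem_insert_of_mem _ ⟨0, by rw [← hc0]⟩)
  have hne : ∀ {s : ℝ}, s ≠ 0 → c s ≠ o := fun hs h' => hs (hc.injective (h'.trans hc0.symm))
  have hd0 : ∀ s, dist (c s) o = |s| := fun s => by
    rw [← hc0, hc.dist_eq, Real.dist_eq, sub_zero]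
  have hex : ∀ s : ℝ, s ≠ 0 → φ (c s).val = (c (r ^ 2 / s)).val ∨
      φ (c s).val = (c (-r ^ 2 / s)).val := by
    intro s hs
    obtain ⟨y, hy, hys⟩ := h.exists_val_eq hω (hne hs)
    have h1 : y.val ∈ τ := by
      rw [hys, ← himg]
      exact mem_image_of_mem _ (mem_insert_of_mem _ ⟨s, rfl⟩)
    obtain ⟨u, hu⟩ := h1.resolve_left (Pt.val_ne hω y)
    obtain rfl : c u = y := Pt.ext hu
    have h2 := (h.dist_formulas hd hω (hne hs) (hne hs) hys hys).1
    rw [hd0, hd0, ← abs_mul] at h2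
    rw [← hys]
    rcases abs_eq (sq_nonneg r) |>.1 h2 with h3 | h3
    · left
      rw [← h3, mul_div_cancel_right₀ _ hs]
    · right
      rw [← h3, mul_div_cancel_right₀ _ hs]
  have hfix : ∀ s, |s| = r → φ (c s).val = (c (-r ^ 2 / s)).val := by
    intro s hs
    have hs0 : s ≠ 0 := by
      rintro rfl
      rw [abs_zero] at hs
      exact hr.ne hs
    refine (hex s hs0).resolve_left fun h1 => ?_
    have : r ^ 2 / s = s := by
      rw [div_eq_iff hs0, ← hs, sq_abs, sq]
    rw [this] at h1
    exact h.isSpaceInversion.no_fixed_point _ h1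
  refine (hex t ht).resolve_left fun h1 => ?_
  obtain ⟨s, hs, hst⟩ : ∃ s, |s| = r ∧ s * t ≠ 0 :=
    ⟨r, abs_of_pos hr, mul_ne_zero hr.ne' ht⟩
  have hs0 : s ≠ 0 := left_ne_zero_of_mul hst
  have h2 := (h.dist_formulas hd hω (hne ht) (hne hs0) h1.symm (hfix s hs).symm).2
  rw [hc.dist_eq, hc.dist_eq, hd0, hd0, Real.dist_eq, Real.dist_eq,
    show r ^ 2 / t - -r ^ 2 / s = r ^ 2 * (t + s) / (t * s) by field_simp; ring, abs_div, abs_mul,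
    abs_of_pos (pow_pos hr 2), abs_mul,
    div_left_inj' (mul_pos (abs_pos.2 ht) (abs_pos.2 hs0)).ne',
    mul_right_inj' (pow_pos hr 2).ne', ← sq_eq_sq₀ (abs_nonneg _) (abs_nonneg _), sq_abs,
    sq_abs] at h2
  apply hst
  linarith

end IsInversionAt

end SpaceInversion

/-! ### Homogeneity of the Möbius space and circles through every point. -/

section Existence

variable {X : Type*} [MobiusSpace X] [CompactSpace X] (hP : IsPtolemySpace X)
  (hE : PropertyE X) (hI : PropertyI X)

include hP hE in
theorem infinite_of_propertyE : Infinite X := by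
  obtain ⟨σ, hσ⟩ := hE
  obtain ⟨e⟩ := hσ.1
  obtain ⟨d, hd, hω⟩ := exists_metric hP (e.symm 1 : X)
  obtain ⟨c, hc, -⟩ := hσ.exists_isometry hd hω (e.symm 1).2
  exact Infinite.of_injective _ (Pt.val_injective.comp hc.injective)

include hP hE hI

/-- A space inversion exchanges its poles. A third point is needed to have a sphere between them. -/
theorem exists_isMobius_map_eq (ω₀ ω : X) : ∃ k : X ≃ X, IsMobius k ∧ k ω₀ = ω := by
  classical
  by_cases h : ω₀ = ω
  · obtain ⟨d, hd⟩ := MobiusSpace.nonempty (X := X)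
    exact ⟨Equiv.refl X, IsMobius.of_preservesCrt hd hd (Equiv.refl X).injective
      (preservesCrt_id hd hd), h⟩
  · have := infinite_of_propertyE hP hE
    obtain ⟨x, hx⟩ := Infinite.exists_notMem_finset ({ω₀, ω} : Finset X)
    rw [Finset.mem_insert, Finset.mem_singleton, not_or] at hx
    obtain ⟨φ, hφ, -⟩ := hI ω₀ ω h _ ⟨x, hx.1, hx.2, rfl⟩
    exact ⟨Function.Involutive.toPerm φ hφ.involutive, hφ.mobius, hφ.map_pole⟩

theorem exists_circle_mem (ω : X) : ∃ σ : Set X, IsPtolemyCircle σ ∧ ω ∈ σ := by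
  obtain ⟨σ, hσ⟩ := id hE
  obtain ⟨e⟩ := hσ.1
  obtain ⟨k, hk, hkω⟩ := exists_isMobius_map_eq hP hE hI (e.symm 1 : X) ω
  exact ⟨k '' σ, hσ.image hP hk, _, (e.symm 1).2, hkω⟩

end Existence

/-! ### Inversions of all radii and their dependence on the radius. -/

section Inversion

variable {X : Type*} [MobiusSpace X] [CompactSpace X] {d : ExtMetric X} {ω : X} {o : Pt d}

section Circle

variable (hd : d ∈ metrics X) (hω : d.infty = some ω) {σ : Set X} (hσ : IsPtolemyCircle σ)
  (hωσ : ω ∈ σ)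
include hd hω hσ hωσ

theorem IsPtolemyCircle.exists_isometry_center (ho : o.val ∈ σ) :
    ∃ c : ℝ → Pt d, Isometry c ∧ c 0 = o ∧ σ = insert ω (range fun t => (c t).val) := by
  obtain ⟨c, hc, h⟩ := hσ.exists_isometry' hd hω hωσ
  rw [h] at ho
  obtain ⟨a, ha⟩ := ho.resolve_left (Pt.val_ne hω o)
  refine ⟨fun t => c (a + t), Isometry.comp_add hc a, ?_, ?_⟩
  · change c (a + 0) = o
    rw [add_zero]
    exact Pt.ext ha
  · rw [h]
    congr 1
    exact ((add_left_surjective a).range_comp (fun t => (c t).val)).symm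

-- Together with uniqueness in property (I), conjugation by homotheties identifies the inversions of
-- different radii about o.
omit hσ hωσ in
theorem IsInversionAt.conj {r a : ℝ} {φ : X → X} (h : IsInversionAt d ω o r φ) (ha : 0 < a)
    (g : Pt d ≃ Pt d) (hg : ∀ x y, dist (g x) (g y) = a * dist x y) (hgo : g o = o)
    (hm : IsMobius (extend g)) (hl : ∀ c : ℝ → Pt d, Isometry c → c 0 = o →
      ∀ t, g (c t) = c (a * t)) :
    IsInversionAt d ω o (a * r) (extend g ∘ φ ∘ (extend g).symm) := by
  have hsph : g '' Metric.sphere o r = Metric.sphere o (a * r) := by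
    ext x
    obtain ⟨x, rfl⟩ := g.surjective x
    have h1 := hg x o
    rw [hgo] at h1
    rw [g.injective.mem_set_image, Metric.mem_sphere, Metric.mem_sphere, h1,
      mul_right_inj' ha.ne']
  have hsph' : extend g '' (Pt.val '' Metric.sphere o r) =
      Pt.val '' Metric.sphere o (a * r) := by
    rw [← hsph, image_image, image_image]
    simp only [extend_val]
  have hsph'' : (extend g).symm '' (Pt.val '' Metric.sphere o (a * r)) =
      Pt.val '' Metric.sphere o r := by
    rw [← hsph', Equiv.symm_image_image]
  have hcirc : ∀ τ : Set X, IsPtolemyCircle τ → ω ∈ τ → o.val ∈ τ → extend g '' τ = τ := by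
    intro τ hτ hωτ hoτ
    obtain ⟨c, hc, hc0, rfl⟩ := hτ.exists_isometry_center hd hω hωτ hoτ
    rw [image_insert_eq, extend_infty hω, ← range_comp]
    congr 1
    have : (extend g ∘ fun t => (c t).val) = (fun t => (c t).val) ∘ fun t => a * t := by
      ext t
      rw [Function.comp, Function.comp, extend_val, hl c hc hc0]
    rw [this]
    exact (mul_left_surjective₀ ha.ne').range_comp _
  refine ⟨mul_pos ha h.pos, ?_, ?_, ?_, ?_, ?_, ?_, ?_⟩
  · rw [← hsph]
    exact h.nonempty.image _
  · exact hm.comp (h.isSpaceInversion.mobius.comp hm.symm)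
  · intro x
    simp [h.isSpaceInversion.involutive]
  · intro x hx
    refine h.isSpaceInversion.no_fixed_point ((extend g).symm x) ?_
    rw [Equiv.eq_symm_apply]
    exact hx
  · rw [Function.comp, Function.comp, extend_symm_infty hω, h.isSpaceInversion.map_pole,
      extend_val, hgo]
  · rw [image_comp, image_comp, hsph'', h.isSpaceInversion.image_sphere, hsph']
  · intro τ hτ hωτ hoτ
    have h1 : (extend g).symm '' τ = τ := by
      nth_rewrite 1 [← hcirc τ hτ hωτ hoτ]
      exact Equiv.symm_image_image _ _
    rw [image_comp, image_comp, h1, h.isSpaceInversion.image_circle τ hτ hωτ hoτ,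
      hcirc τ hτ hωτ hoτ]

/-- The composition of two space inversions with the same centers is a homothety. -/
theorem IsInversionAt.exists_homothety {r s : ℝ} {φ ψ : X → X} (h : IsInversionAt d ω o r φ)
    (h' : IsInversionAt d ω o s ψ) :
    ∃ g : Pt d ≃ Pt d, (∀ x y, dist (g x) (g y) = (s / r) ^ 2 * dist x y) ∧ g o = o ∧
      IsMobius (extend g) ∧
      ∀ c : ℝ → Pt d, Isometry c → c 0 = o → ∀ t, g (c t) = c ((s / r) ^ 2 * t) := by
  have hr := h.pos
  have hs := h'.pos
  have hk : (h.toEquiv.trans h'.toEquiv) ω = ω :=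
    (congrArg ψ h.isSpaceInversion.map_pole).trans h'.map_center
  set g := restrict (d := d) hω (h.toEquiv.trans h'.toEquiv) hk with hg
  have hgval : ∀ x, (g x).val = ψ (φ x.val) := fun x => rfl
  have hgo : g o = o := Pt.ext <| (hgval o).trans <| by
    rw [h.map_center, h'.isSpaceInversion.map_pole]
  have hstep : ∀ x, x ≠ o → ∃ y, y ≠ o ∧ y.val = φ x.val ∧ (g x).val = ψ y.val ∧
      dist y o * dist x o = r ^ 2 ∧ dist (g x) o * dist y o = s ^ 2 := by
    intro x hx
    obtain ⟨y, hy, hyx⟩ := h.exists_val_eq hω hx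
    have hgy : (g x).val = ψ y.val := by rw [hgval, hyx]
    exact ⟨y, hy, hyx, hgy, (h.dist_formulas hd hω hx hx hyx hyx).1,
      (h'.dist_formulas hd hω hy hy hgy hgy).1⟩
  have hdo : ∀ x, dist (g x) o = (s / r) ^ 2 * dist x o := by
    intro x
    by_cases hx : x = o
    · rw [hx, hgo, dist_self, mul_zero]
    · obtain ⟨y, hy, -, -, h1, h2⟩ := hstep x hx
      have hy0 := dist_pos.2 hy
      rw [div_pow, ← h1, ← h2]
      have hx0 := dist_pos.2 hx
      field_simp
  refine ⟨g, fun x y => ?_, hgo, ?_, ?_⟩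
  · by_cases hx : x = o
    · rw [hx, hgo, dist_comm, hdo, dist_comm]
    by_cases hy : y = o
    · rw [hy, hgo, hdo]
    obtain ⟨x', hx', h1, h2, h3, -⟩ := hstep x hx
    obtain ⟨y', hy', h4, h5, h6, -⟩ := hstep y hy
    rw [(h'.dist_formulas hd hω hx' hy' h2 h5).2, (h.dist_formulas hd hω hx hy h1 h4).2]
    have a1 := dist_pos.2 hx
    have a2 := dist_pos.2 hy
    rw [div_pow, eq_div_of_mul_eq a1.ne' h3, eq_div_of_mul_eq a2.ne' h6]
    field_simp
  · rw [hg, extend_restrict]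
    exact h'.isSpaceInversion.mobius.comp h.isSpaceInversion.mobius
  · intro c hc hc0 t
    by_cases ht : t = 0
    · rw [ht, mul_zero, hc0, hgo]
    refine Pt.ext ?_
    rw [hgval, h.map_line hd hω hσ hωσ hc hc0 ht,
      h'.map_line hd hω hσ hωσ hc hc0 (div_ne_zero (neg_ne_zero.2 (pow_ne_zero 2 hr.ne')) ht)]
    congr 2
    field_simp

end Circle

section Radii

variable (hI : PropertyI X) (hd : d ∈ metrics X) (hω : d.infty = some ω) {σ : Set X}
  (hσ : IsPtolemyCircle σ) (hωσ : ω ∈ σ)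
include hI hd hω hσ hωσ

/-- Property (I) gives inversions only for nonempty spheres. A line meets all large spheres; with b
= dist (c 0) o, two inversions of large radii compose to a homothety of ratio r / b, which brings c
0 to distance r. -/
theorem sphere_nonempty {r : ℝ} (hr : 0 < r) : (Metric.sphere o r).Nonempty := by
  obtain ⟨c, hc, -⟩ := hσ.exists_isometry hd hω hωσ
  have hlarge : ∀ s, dist (c 0) o ≤ s → (Metric.sphere o s).Nonempty := by
    intro s hs
    have hcont : Continuous fun t => dist (c t) o := hc.continuous.dist continuous_const
    obtain ⟨t, ht⟩ := mem_range_of_exists_le_of_exists_ge hcont ⟨0, hs⟩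
      ⟨dist (c 0) o + s, by
        have h1 := dist_triangle (c (dist (c 0) o + s)) o (c 0)
        have h2 : dist (c (dist (c 0) o + s)) (c 0) = dist (c 0) o + s := by
          rw [hc.dist_eq, Real.dist_eq, sub_zero, abs_of_nonneg]
          exact add_nonneg dist_nonneg (dist_nonneg.trans hs)
        rw [h2, dist_comm o] at h1
        linarith⟩
    exact ⟨c t, ht⟩
  by_cases h : dist (c 0) o ≤ r
  · exact hlarge r h
  push Not at h
  set b := dist (c 0) o with hb
  have hb0 : 0 < b := hr.trans h
  set s := b * √(b / r) with hs
  have h1 : 1 ≤ b / r := (one_le_div hr).2 h.le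
  have hs2 : b ≤ s := le_mul_of_one_le_right hb0.le (Real.one_le_sqrt.2 h1)
  obtain ⟨φ, hφ, -⟩ := existsUnique_isInversionAt hd hω hI hb0 (hlarge b le_rfl)
  obtain ⟨ψ, hψ, -⟩ := existsUnique_isInversionAt hd hω hI (hb0.trans_le hs2) (hlarge s hs2)
  obtain ⟨g, hg, hgo, -⟩ := hψ.exists_homothety hd hω hσ hωσ hφ
  refine ⟨g (c 0), ?_⟩
  rw [Metric.mem_sphere]
  nth_rewrite 1 [← hgo]
  rw [hg, ← hb, hs, div_pow, mul_pow, Real.sq_sqrt (by positivity)]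
  field_simp

theorem existsUnique_inversion {r : ℝ} (hr : 0 < r) : ∃! φ, IsInversionAt d ω o r φ :=
  existsUnique_isInversionAt hd hω hI hr (sphere_nonempty hI hd hω hσ hωσ hr)

/-- The inversion of radius s is the conjugate of that of radius r by a homothety of ratio s / r. As
s → r these homotheties have an ultralimit isometry that fixes the lines through o. By uniqueness it
commutes with the inversion of radius r, so conjugating by the limit changes nothing. -/
theorem tendsto_inversionAt {r : ℝ} {φ : ℝ → X → X}
    (hφ : ∀ s, 0 < s → IsInversionAt d ω o s (φ s)) (hr : 0 < r) {x : Pt d} (hx : x ≠ o)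
    {y : ℝ → Pt d} (hy : ∀ s, 0 < s → (y s).val = φ s x.val) :
    Tendsto y (𝓝 r) (𝓝 (y r)) := by
  have hprop := properSpace_pt hd hω
  have huni : ∀ {s} (hs : 0 < s) {ψ}, IsInversionAt d ω o s ψ → ψ = φ s := fun hs _ hψ =>
    (existsUnique_inversion hI hd hω hσ hωσ hs).unique hψ (hφ _ hs)
  let r' : Ioi (0 : ℝ) := ⟨r, hr⟩
  have hnhds : map Subtype.val (𝓝 r') = 𝓝 r := isOpen_Ioi.isOpenEmbedding_subtypeVal.map_nhds_eq r'
  rw [← hnhds, tendsto_map'_iff, tendsto_iff_ultrafilter]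
  intro U hU
  have hl : Tendsto (fun s : Ioi (0 : ℝ) => (s : ℝ) / r) U (𝓝 1) := by
    have h1 : Tendsto (fun s : Ioi (0 : ℝ) => (s : ℝ) / r) (𝓝 r') (𝓝 ((r' : ℝ) / r)) :=
      (continuous_subtype_val.tendsto r').div_const r
    rw [div_self hr.ne'] at h1
    exact h1.mono_left hU
  have hex : ∀ s : Ioi (0 : ℝ), ∃ g : Pt d ≃ Pt d,
      (∀ x y, dist (g x) (g y) = ((s : ℝ) / r) * dist x y) ∧ g o = o ∧ IsMobius (extend g) ∧
      ∀ c : ℝ → Pt d, Isometry c → c 0 = o → ∀ t, g (c t) = c (((s : ℝ) / r) * t) := by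
    intro s
    have hs : (0 : ℝ) < s := s.2
    have h1 : (√(s * r) / r) ^ 2 = s / r := by
      rw [div_pow, Real.sq_sqrt (by positivity)]
      field_simp
    have := (hφ r hr).exists_homothety hd hω hσ hωσ (hφ (√(s * r)) (by positivity))
    rwa [h1] at this
  choose k hk hko hkm hkl using hex
  obtain ⟨g, hg, hgo, hg1, hg2⟩ := exists_ultralimit_isometryEquiv U k (fun s => (s : ℝ) / r) 1
    one_pos hl hk o o (by simp only [hko]; exact tendsto_const_nhds)
  have hg' : ∀ x y, dist (g x) (g y) = dist x y := fun x y => by rw [hg, one_mul]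
  have hconj : ∀ s : Ioi (0 : ℝ), extend (k s) ∘ φ r ∘ (extend (k s)).symm = φ s := by
    intro s
    have := (hφ r hr).conj hd hω (div_pos s.2 hr) (k s) (hk s) (hko s) (hkm s) (hkl s)
    rw [div_mul_cancel₀ _ hr.ne'] at this
    exact huni s.2 this
  have hconjg : extend g ∘ φ r ∘ (extend g).symm = φ r := by
    have := (hφ r hr).conj hd hω one_pos g hg hgo (isMobius_extend hω hd g hg')
      fun c hc hc0 t => by
        have h1 : Tendsto (fun s => k s (c t)) U (𝓝 (c (1 * t))) := by
          simp only [hkl _ c hc hc0]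
          exact (hc.continuous.tendsto _).comp (hl.mul_const t)
        exact tendsto_nhds_unique (hg1 (c t)) h1
    rw [one_mul] at this
    exact huni hr this
  have hne : ∀ s, (k s).symm x ≠ o := fun s h => hx (by
    rw [← (k s).apply_symm_apply x, h, hko])
  have hneg : g.symm x ≠ o := fun h => hx (by
    rw [← g.apply_symm_apply x, h, hgo])
  choose z hz hzv using fun s => (hφ r hr).exists_val_eq hω (hne s)
  obtain ⟨w, hw, hwv⟩ := (hφ r hr).exists_val_eq hω hneg
  have hyz : ∀ s : Ioi (0 : ℝ), y s = k s (z s) := by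
    intro s
    refine Pt.ext ?_
    rw [hy s s.2, ← hconj s, Function.comp, Function.comp, extend_symm_val, ← hzv, extend_val]
  have hyw : y r = g w := by
    refine Pt.ext ?_
    rw [hy r hr, ← hconjg, Function.comp, Function.comp, extend_symm_val, ← hwv, extend_val]
  have hzw : Tendsto (fun s => dist (z s) w) U (𝓝 0) := by
    have h1 : Tendsto (fun s => r ^ 2 * dist ((k s).symm x) (g.symm x) /
        (dist ((k s).symm x) o * dist (g.symm x) o)) U (𝓝 (r ^ 2 * dist (g.symm x) (g.symm x) /
        (dist (g.symm x) o * dist (g.symm x) o))) := by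
      refine Tendsto.div (((hg2 x).dist tendsto_const_nhds).const_mul _)
        (((hg2 x).dist tendsto_const_nhds).mul_const _) ?_
      exact (mul_pos (dist_pos.2 hneg) (dist_pos.2 hneg)).ne'
    rw [dist_self, mul_zero, zero_div] at h1
    refine h1.congr fun s => ?_
    exact ((hφ r hr).dist_formulas hd hω (hne s) hneg (hzv s) hwv).2.symm
  change Tendsto (fun s : Ioi (0 : ℝ) => y s) U (𝓝 (y r))
  simp only [hyz]
  rw [hyw, tendsto_iff_dist_tendsto_zero]
  have h2 : Tendsto (fun s : Ioi (0 : ℝ) => (s : ℝ) / r * dist (z s) w + dist (k s w) (g w)) U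
      (𝓝 (1 * 0 + 0)) := (hl.mul hzw).add (tendsto_iff_dist_tendsto_zero.1 (hg1 w))
  rw [mul_zero, add_zero] at h2
  refine squeeze_zero (fun _ => dist_nonneg) (fun s => ?_) h2
  rw [← hk]
  exact dist_triangle _ _ _

/-- The last clause keeps the Möbius map behind each inversion, so that lines can be carried to
Ptolemy circles through p. -/
theorem exists_inversions (hP : IsPtolemySpace X) :
    ∃ I : Inversions (Pt d), ∀ p r, 0 < r → ∃ k : X ≃ X, IsMobius k ∧ k ω = p.val ∧
      ∀ x, x ≠ p → (I.inv p r x).val = k x.val := by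
  have h1 : ∀ (o : Pt d) (r : ℝ), ∃ φ, 0 < r → IsInversionAt d ω o r φ := by
    intro o r
    by_cases hr : 0 < r
    · obtain ⟨φ, hφ, -⟩ := existsUnique_inversion (o := o) hI hd hω hσ hωσ hr
      exact ⟨φ, fun _ => hφ⟩
    · exact ⟨id, fun h => absurd h hr⟩
  choose J hJ using h1
  have h2 : ∀ (o : Pt d) (r : ℝ) (x : Pt d), ∃ y : Pt d,
      0 < r → x ≠ o → y ≠ o ∧ y.val = J o r x.val := by
    intro o r x
    by_cases hr : 0 < r
    · by_cases hx : x = o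
      · exact ⟨x, fun _ h => absurd hx h⟩
      · obtain ⟨y, hy⟩ := (hJ o r hr).exists_val_eq hω hx
        exact ⟨y, fun _ _ => hy⟩
    · exact ⟨x, fun h => absurd h hr⟩
  choose G hG using h2
  refine ⟨{ ptolemy := ?_, exists_line := ?_, inv := G, inv_ne := ?_, inv_inv := ?_,
            dist_inv_inv := ?_, dist_inv := ?_, inv_line := ?_, tendsto_inv := ?_ }, ?_⟩
  · intro x y z u
    by_cases hadm : Admissible x y z u
    · have := (hP d hd _ _ _ _ (hadm.map Pt.val_injective)).2.1
      simpa only [ExtMetric.crt, ← Pt.dist_eq] using this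
    · have : (x = y ∧ y = z) ∨ (x = y ∧ y = u) ∨ (x = z ∧ z = u) ∨ (y = z ∧ z = u) := by
        by_contra hc
        push Not at hc
        exact hadm ⟨fun h => hc.1 h.1 h.2, fun h => hc.2.1 h.1 h.2, fun h => hc.2.2.1 h.1 h.2,
          fun h => hc.2.2.2 h.1 h.2⟩
      rcases this with ⟨rfl, rfl⟩ | ⟨rfl, rfl⟩ | ⟨rfl, rfl⟩ | ⟨rfl, rfl⟩ <;>
        simp [dist_comm]
  · obtain ⟨c, hc, -⟩ := hσ.exists_isometry hd hω hωσ
    exact ⟨c, hc⟩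
  · intro o r x hr hx
    exact (hG o r x hr hx).1
  · intro o r x hr hx
    obtain ⟨h1, h2⟩ := hG o r x hr hx
    refine Pt.ext ?_
    rw [(hG o r _ hr h1).2, h2, (hJ o r hr).isSpaceInversion.involutive]
  · intro o r x y hr hx hy
    exact ((hJ o r hr).dist_formulas hd hω hx hy (hG o r x hr hx).2 (hG o r y hr hy).2).2
  · intro o r x hr hx
    rw [eq_div_iff (dist_pos.2 hx).ne']
    exact ((hJ o r hr).dist_formulas hd hω hx hx (hG o r x hr hx).2 (hG o r x hr hx).2).1
  · intro o r c t hr hc hc0 ht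
    have hne : c t ≠ o := fun h => ht (hc.injective (h.trans hc0.symm))
    refine Pt.ext ?_
    rw [(hG o r _ hr hne).2, (hJ o r hr).map_line hd hω hσ hωσ hc hc0 ht]
  · intro o r x hr hx
    exact tendsto_inversionAt hI hd hω hσ hωσ (φ := J o) (fun s hs => hJ o s hs) hr hx
      (fun s hs => (hG o s x hs hx).2)
  · intro p r hr
    exact ⟨(hJ p r hr).toEquiv, (hJ p r hr).isSpaceInversion.mobius,
      (hJ p r hr).isSpaceInversion.map_pole, fun x hx => (hG p r x hr hx).2⟩

end Radii

end Inversion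

/-! ### Lines through a point -/

/-- The union of the lines through a point is closed. -/
theorem isClosed_setOf_line {M : Type*} [MetricSpace M] [ProperSpace M] (o : M) :
    IsClosed {x | ∃ c : ℝ → M, Isometry c ∧ c 0 = o ∧ ∃ t, c t = x} := by
  refine IsSeqClosed.isClosed fun y x hy hyx => ?_
  have h1 : ∀ n, ∃ c : ℝ → M, Isometry c ∧ c 0 = o ∧ c (dist (y n) o) = y n := by
    intro n
    obtain ⟨c, hc, hc0, t, ht⟩ := hy n
    have h2 : dist (y n) o = |t| := by rw [← ht, ← hc0, hc.dist_eq, Real.dist_eq, sub_zero]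
    rcases abs_choice t with h | h
    · exact ⟨c, hc, hc0, by rw [h2, h, ht]⟩
    · refine ⟨fun s => c (-s), Isometry.comp_neg hc, ?_, ?_⟩
      · change c (-0) = o
        rw [neg_zero, hc0]
      · change c (-dist (y n) o) = y n
        rw [h2, h, neg_neg, ht]
  choose c hc hc0 hcy using h1
  have hU : (hyperfilter ℕ : Filter ℕ) ≤ atTop := Nat.hyperfilter_le_atTop
  obtain ⟨c', hc', hc'0, hlim⟩ := exists_line_limit (hyperfilter ℕ) hc (x := o)
    (by simp only [hc0]; exact tendsto_const_nhds)
  refine ⟨c', hc', hc'0, dist x o, ?_⟩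
  have hyx' : Tendsto y (hyperfilter ℕ) (𝓝 x) := hyx.mono_left hU
  have h2 : Tendsto (fun n => dist (y n) (c n (dist x o))) (hyperfilter ℕ) (𝓝 0) := by
    have h3 : Tendsto (fun n => dist (dist (y n) o) (dist x o)) (hyperfilter ℕ) (𝓝 0) :=
      tendsto_iff_dist_tendsto_zero.1 (hyx'.dist tendsto_const_nhds)
    refine h3.congr fun n => ?_
    rw [← (hc n).dist_eq, hcy]
  have h3 := (hyx'.dist (hlim (dist x o)))
  exact (dist_eq_zero.1 (tendsto_nhds_unique h3 h2)).symm

/-! ### Concircular triples and integrability. -/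

section Concircular

variable {X : Type*} [MobiusSpace X]

/-- Three points lie on a Ptolemy circle. -/
def Concircular (a b x : X) : Prop := ∃ σ : Set X, IsPtolemyCircle σ ∧ a ∈ σ ∧ b ∈ σ ∧ x ∈ σ

theorem Concircular.swap {a b x : X} : Concircular a b x → Concircular b a x :=
  fun ⟨σ, h, ha, hb, hx⟩ => ⟨σ, h, hb, ha, hx⟩

theorem Concircular.swap_right {a b x : X} : Concircular a b x → Concircular a x b :=
  fun ⟨σ, h, ha, hb, hx⟩ => ⟨σ, h, ha, hx, hb⟩

/-- Every x lies in the fibre of its own class, so D_o is just the union of the Ptolemy lines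
through o. -/
theorem mem_distributionAt {ω o x : X} :
    x ∈ distributionAt ω o ↔ o ≠ ω ∧ x ≠ ω ∧ Concircular ω o x := by
  constructor
  · rintro ⟨b, -, ⟨hx, -⟩, l, ⟨σ, hσ, hω, rfl⟩, ho, hx'⟩
    exact ⟨ho.2, hx, σ, hσ, hω, ho.1, hx'.1⟩
  · rintro ⟨ho, hx, σ, hσ, hω, ho', hx'⟩
    exact ⟨_, ⟨x, hx, rfl⟩, ⟨hx, rfl⟩, σ \ {ω}, ⟨σ, hσ, hω, rfl⟩, ⟨ho', ho⟩, hx', hx⟩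

/-- In this form integrability is transitivity of being joined by a line in X_ω. -/
theorem IsIntegrable.concircular {ω : X} (h : IsIntegrable ω) {o o' x : X} (ho : o ≠ ω)
    (ho' : o' ≠ ω) (h1 : Concircular ω o o') (h2 : Concircular ω o x) : Concircular ω o' x := by
  by_cases hx : x = ω
  · obtain ⟨σ, hσ, hω, -, ho'σ⟩ := h1
    exact ⟨σ, hσ, hω, ho'σ, hx ▸ hω⟩
  have h3 := h o ho o' (mem_distributionAt.2 ⟨ho, ho', h1⟩)
  have h4 : x ∈ distributionAt ω o := mem_distributionAt.2 ⟨ho, hx, h2⟩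
  rw [h3] at h4
  exact (mem_distributionAt.1 h4).2.2

variable [CompactSpace X]

theorem Concircular.map (hP : IsPtolemySpace X) {k : X ≃ X} (hk : IsMobius k) {a b x : X} :
    Concircular a b x → Concircular (k a) (k b) (k x) :=
  fun ⟨σ, h, ha, hb, hx⟩ => ⟨k '' σ, h.image hP hk, mem_image_of_mem _ ha, mem_image_of_mem _ hb,
    mem_image_of_mem _ hx⟩

theorem IsIntegrable.map (hP : IsPtolemySpace X) {k : X ≃ X} (hk : IsMobius k) {ω : X}
    (h : IsIntegrable ω) : IsIntegrable (k ω) := by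
  have key : ∀ o x, Concircular (k ω) o x ↔ Concircular ω (k.symm o) (k.symm x) := by
    refine fun o x => ⟨fun h' => ?_, fun h' => ?_⟩
    · simpa using h'.map hP hk.symm
    · simpa using h'.map hP hk
  have hne : ∀ {x}, x ≠ k ω → k.symm x ≠ ω := fun hx h' =>
    hx ((Equiv.symm_apply_eq k).1 h')
  intro o ho o' ho'
  obtain ⟨-, ho'ω, h1⟩ := mem_distributionAt.1 ho'
  rw [key] at h1
  ext x
  rw [mem_distributionAt, mem_distributionAt]
  constructor
  · rintro ⟨-, hx, h2⟩
    rw [key] at h2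
    exact ⟨ho'ω, hx, (key _ _).2 (h.concircular (hne ho) (hne ho'ω) h1 h2)⟩
  · rintro ⟨-, hx, h2⟩
    rw [key] at h2
    exact ⟨ho, hx, (key _ _).2 (h.concircular (hne ho'ω) (hne ho) h1.swap_right h2)⟩

section Lines

variable {d : ExtMetric X} {ω : X} (hd : d ∈ metrics X) (hω : d.infty = some ω) {σ : Set X}
  (hσ : IsPtolemyCircle σ) (hωσ : ω ∈ σ)
include hd hω hσ hωσ

theorem concircular_iff {x y : Pt d} :
    Concircular ω x.val y.val ↔ ∃ c : ℝ → Pt d, Isometry c ∧ c 0 = x ∧ ∃ t, c t = y := by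
  constructor
  · rintro ⟨τ, hτ, hωτ, hx, hy⟩
    obtain ⟨c, hc, hc0, rfl⟩ := hτ.exists_isometry_center hd hω hωτ hx
    obtain ⟨t, ht⟩ := hy.resolve_left (Pt.val_ne hω y)
    exact ⟨c, hc, hc0, t, Pt.ext ht⟩
  · rintro ⟨c, hc, rfl, t, rfl⟩
    exact ⟨_, hσ.of_isometry hd hω hωσ hc, mem_insert _ _, mem_insert_of_mem _ ⟨0, rfl⟩,
      mem_insert_of_mem _ ⟨t, rfl⟩⟩

theorem isClosed_setOf_concircular {o : Pt d} (ho : Concircular ω o.val o.val) :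
    IsClosed {x | Concircular ω o.val x} := by
  have hprop := properSpace_pt hd hω
  have h1 : {x | Concircular ω o.val x}ᶜ = Pt.val ''
      {x : Pt d | ∃ c : ℝ → Pt d, Isometry c ∧ c 0 = o ∧ ∃ t, c t = x}ᶜ := by
    ext x
    rcases eq_or_exists_val hω x with rfl | ⟨x, rfl⟩
    · refine iff_of_false (fun h => h ?_) ?_
      · exact ho.imp fun _ h => ⟨h.1, h.2.1, h.2.2.1, h.2.1⟩
      · rintro ⟨y, -, hy⟩
        exact Pt.val_ne hω y hy
    · rw [Pt.val_injective.mem_set_image]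
      exact not_congr (concircular_iff hd hω hσ hωσ)
  rw [← isOpen_compl_iff, h1]
  exact (isOpenEmbedding_val hd hω).isOpenMap _ (isClosed_setOf_line o).isOpen_compl

/-- The Ptolemy lines are the lines of the metric space. -/
theorem isPtolemyLine_range {c : ℝ → Pt d} (hc : Isometry c) :
    IsPtolemyLine ω (range fun t => (c t).val) := by
  refine ⟨_, hσ.of_isometry hd hω hωσ hc, mem_insert _ _, ?_⟩
  rw [insert_sdiff_of_mem _ (mem_singleton ω), sdiff_singleton_eq_self]
  rintro ⟨t, ht⟩
  exact Pt.val_ne hω _ ht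

end Lines

end Concircular

/-! ### Comparison of the two notions of Busemann function. -/

section Busemann

variable {X : Type*} {d : ExtMetric X}

-- The value 0 at the infinitely remote point is arbitrary. For t ≥ 0 the normalizing distance is t,
-- as in `bus`.
open Classical in
theorem exists_isBusemannFunction {c : ℝ → Pt d} (hc : Isometry c) :
    ∃ b, IsBusemannFunction d (range fun t => (c t).val) b ∧ ∀ x : Pt d, b x.val = bus c x := by
  let b : X → ℝ := fun x => if h : d.infty ≠ some x then bus c ⟨x, h⟩ else 0
  have hb : ∀ x : Pt d, b x.val = bus c x := fun x => dif_pos x.infty_ne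
  refine ⟨b, ⟨fun t => (c t).val, ⟨fun s t => ?_, rfl⟩, fun x hx => ?_⟩, hb⟩
  · rw [← Pt.ofReal_dist, hc.dist_eq, Real.dist_eq]
  · obtain ⟨x, rfl⟩ : ∃ y : Pt d, y.val = x := ⟨⟨x, hx⟩, rfl⟩
    rw [hb]
    refine (tendsto_bus hc x).congr' ?_
    filter_upwards [eventually_ge_atTop 0] with t ht
    change _ = dist x (c t) - dist (c 0) (c t)
    rw [hc.dist_eq, Real.dist_eq, zero_sub, abs_neg, abs_of_nonneg ht]

/-- The metric d' is a multiple of d, so its Busemann functions are multiples after a change of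
speed. -/
theorem IsBusemannFunction.exists_isometry [MobiusSpace X] (hd : d ∈ metrics X) {ω : X}
    (hω : d.infty = some ω) {d' : ExtMetric X} (hd' : d' ∈ metrics X) (hω' : d'.infty = some ω)
    {l : Set X} {b : X → ℝ} (h : IsBusemannFunction d' l b) :
    ∃ c : ℝ → Pt d, Isometry c ∧ (range fun t => (c t).val) = l ∧
      ∃ a : ℝ, ∀ x : Pt d, b x.val = a * bus c x := by
  obtain ⟨a, ha, hda⟩ := PreservesCrt.exists_factor (preservesCrt_id hd hd')
    Function.injective_id hω hω'
  obtain ⟨γ, ⟨hγ, hγl⟩, hb⟩ := h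
  have hγω : ∀ t, γ t ≠ ω := by
    intro t ht
    have h1 : γ (t + 1) ≠ ω := by
      intro h2
      have h3 := hγ (t + 1) t
      rw [h2, ht, d'.dist_self, add_sub_cancel_left, abs_one, ENNReal.ofReal_one] at h3
      exact zero_ne_one h3
    have h3 := hγ (t + 1) t
    rw [ht, d'.dist_infty hω' h1] at h3
    exact ENNReal.ofReal_ne_top h3.symm
  let p : ℝ → Pt d := fun t => ⟨γ t, (ExtMetric.ne_infty hω).2 (hγω t)⟩
  have hdist : ∀ x y : Pt d, (d'.dist x.val y.val).toReal = a * dist x y := by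
    intro x y
    rw [Pt.dist_eq, ← hda _ _ (Pt.val_ne hω x) (Pt.val_ne hω y)]
    exact (d'.factor_eq ((ExtMetric.ne_infty hω').2 (Pt.val_ne hω x))
      ((ExtMetric.ne_infty hω').2 (Pt.val_ne hω y))).symm
  have hp : ∀ s t, a * dist (p s) (p t) = |s - t| := fun s t => by
    rw [← hdist]
    change (d'.dist (γ s) (γ t)).toReal = _
    rw [hγ, ENNReal.toReal_ofReal (abs_nonneg _)]
  have hc : Isometry fun t => p (a * t) := by
    refine Isometry.of_dist_eq fun s t => ?_
    rw [← mul_right_inj' ha.ne', hp, ← mul_sub, abs_mul, abs_of_pos ha, Real.dist_eq]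
  refine ⟨fun t => p (a * t), hc, ?_, a, fun x => ?_⟩
  · rw [← hγl]
    exact (mul_left_surjective₀ ha.ne').range_comp γ
  · refine tendsto_nhds_unique ((hb x.val ((ExtMetric.ne_infty hω').2 (Pt.val_ne hω x))).comp
      (tendsto_id.const_mul_atTop ha)) ?_
    refine ((tendsto_bus hc x).const_mul a).congr' ?_
    filter_upwards [eventually_ge_atTop 0] with t ht
    change _ = (d'.dist x.val (p (a * t)).val).toReal - (d'.dist (p 0).val (p (a * t)).val).toReal
    rw [hdist, hdist, hp, zero_sub, abs_neg, abs_of_nonneg (mul_nonneg ha.le ht), mul_sub]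

end Busemann

/-! ### Recognition of the extended Euclidean space. -/

section Euclidean

variable {X : Type*} [MobiusSpace X] {d : ExtMetric X} {ω : X} (hd : d ∈ metrics X)
  (hω : d.infty = some ω)
include hd hω

open Classical in
theorem mobiusEquivalent_of_isometryEquiv {n : ℕ} (e : Pt d ≃ᵢ EuclideanSpace ℝ (Fin n)) :
    MobiusEquivalent X (ExtendedEuclideanSpace n) := by
  let E : EuclideanSpace ℝ (Fin n) → ExtendedEuclideanSpace n := Option.some
  let N : ExtendedEuclideanSpace n := Option.none
  have hEN : ∀ v, E v ≠ N := fun v => Option.some_ne_none v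
  have hE : Function.Injective E := Option.some_injective _
  have hcases : ∀ v : ExtendedEuclideanSpace n, v = N ∨ ∃ w, E w = v := by
    rintro (_ | v)
    · exact Or.inl rfl
    · exact Or.inr ⟨v, rfl⟩
  let f : X → ExtendedEuclideanSpace n := fun x =>
    if h : d.infty ≠ some x then E (e ⟨x, h⟩) else N
  have hfv : ∀ x : Pt d, f x.val = E (e x) := fun x => dif_pos x.infty_ne
  have hfω : f ω = N := dif_neg (not_not.2 hω)
  have hinj : Function.Injective f := by
    intro x y hxy
    rcases eq_or_exists_val hω x with hx | ⟨x, rfl⟩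
    · rcases eq_or_exists_val hω y with hy | ⟨y, rfl⟩
      · rw [hx, hy]
      · rw [hx, hfω, hfv] at hxy
        exact absurd hxy.symm (hEN _)
    · rcases eq_or_exists_val hω y with hy | ⟨y, rfl⟩
      · rw [hy, hfω, hfv] at hxy
        exact absurd hxy (hEN _)
      · rw [hfv, hfv] at hxy
        rw [e.injective (hE hxy)]
  set D := extendedEuclideanMetric n with hD
  have hDi : D.infty = some N := rfl
  have hDE : ∀ v w, D.factor (E v) (E w) = dist v w := by
    intro v w
    rw [D.factor_eq ((ExtMetric.ne_infty hDi).2 (hEN v)) ((ExtMetric.ne_infty hDi).2 (hEN w)),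
      dist_edist]
    rfl
  refine ⟨f, ⟨hinj, fun v => ?_⟩, IsMobius.of_preservesCrt hd
    (show D ∈ metrics (ExtendedEuclideanSpace n) from fun _ _ _ _ _ => ProjEq.refl _) hinj
    (preservesCrt_of_factor (fun _ => 1) (fun _ => one_ne_zero) fun x y => ?_)⟩
  · rcases hcases v with rfl | ⟨v, rfl⟩
    · exact ⟨ω, hfω⟩
    · exact ⟨(e.symm v).val, by rw [hfv, e.apply_symm_apply]⟩
  · rw [one_mul, one_mul]
    rcases eq_or_exists_val hω x with hx | ⟨x, rfl⟩
    · rcases eq_or_exists_val hω y with hy | ⟨y, rfl⟩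
      · rw [hx, hy, D.factor_self, d.factor_self]
      · rw [hx, hfω, hfv, D.factor_comm, d.factor_comm, D.factor_infty hDi (hEN _),
          d.factor_infty hω (Pt.val_ne hω _)]
    · rcases eq_or_exists_val hω y with hy | ⟨y, rfl⟩
      · rw [hy, hfω, hfv, D.factor_infty hDi (hEN _), d.factor_infty hω (Pt.val_ne hω _)]
      · rw [hfv, hfv, hDE, e.dist_eq, Pt.dist_eq]

theorem hasCoveringDim_of_isometryEquiv [CompactSpace X] {n : ℕ}
    (e : Pt d ≃ᵢ EuclideanSpace ℝ (Fin n)) : HasCoveringDim X n := by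
  have hT := t2Space hd hω
  refine hasCoveringDim_of_onePoint (j := Pt.val ∘ e.symm) (ω := ω)
    ((isOpenEmbedding_val hd hω).comp e.symm.toHomeomorph.isOpenEmbedding) ?_
  rw [e.symm.surjective.range_comp, Pt.range_val hω]

end Euclidean

/-! ### The equivalence by way of concircular triples. -/

section Main

variable {X : Type*} [MobiusSpace X] [CompactSpace X] (hP : IsPtolemySpace X)
  (hE : PropertyE X) (hI : PropertyI X)
include hP hE hI

theorem concircular_self {a b : X} (hab : b ≠ a) : Concircular a b b := by
  obtain ⟨d, hd, hω⟩ := exists_metric hP a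
  obtain ⟨σ, hσ, hωσ⟩ := exists_circle_mem hP hE hI a
  have hprop := properSpace_pt hd hω
  obtain ⟨I, -⟩ := exists_inversions hI hd hω hσ hωσ hP
  obtain ⟨b, rfl⟩ := Pt.exists_val_eq hω hab
  obtain ⟨c, hc, hc0⟩ := I.exists_line_through b
  exact (concircular_iff hd hω hσ hωσ).2 ⟨c, hc, hc0, 0, hc0⟩

theorem IsIntegrable.all {ω : X} (h : IsIntegrable ω) (ω' : X) : IsIntegrable ω' := by
  obtain ⟨k, hk, rfl⟩ := exists_isMobius_map_eq hP hE hI ω ω'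
  exact h.map hP hk

/-- The points concircular with a and b form a closed set containing every Ptolemy circle through
two of its points. A missing point q, sent to infinity, would make it compact, against
`exists_inv_notMem`. -/
theorem concircular_of_isIntegrable (h : ∀ ω : X, IsIntegrable ω) {a b : X} (hab : b ≠ a) (q : X) :
    Concircular a b q := by
  by_contra hq
  set B : Set X := {x | Concircular a b x} with hBdef
  have hbB : b ∈ B := concircular_self hP hE hI hab
  have haB : a ∈ B := hbB.imp fun _ h => ⟨h.1, h.2.1, h.2.2.1, h.2.1⟩
  have hBclosed : IsClosed B := by
    obtain ⟨d, hd, hω⟩ := exists_metric hP a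
    obtain ⟨σ, hσ, hωσ⟩ := exists_circle_mem hP hE hI a
    obtain ⟨b, rfl⟩ := Pt.exists_val_eq hω hab
    exact isClosed_setOf_concircular hd hω hσ hωσ hbB
  -- Transitivity at a makes a, p, z concircular, transitivity at z replaces p by a, and
  -- transitivity at a replaces z by b. This needs z ≠ a; otherwise p and z exchange roles.
  have hsub : ∀ p ∈ B, ∀ z ∈ B, z ≠ p → ∀ x, Concircular p z x → x ∈ B := by
    intro p hp z hz hzp x hx
    have key : ∀ p ∈ B, ∀ z ∈ B, z ≠ p → z ≠ a → ∀ x, Concircular p z x → x ∈ B := by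
      intro p hp z hz hzp hza x hx
      by_cases hpa : p = a
      · rw [hpa] at hx
        exact (h a).concircular hza hab (Concircular.swap_right hz) hx
      · have h1 : Concircular a p z := (h a).concircular hab hpa hp hz
        have h2 : Concircular z a x := (h z).concircular hzp.symm hza.symm h1.swap.swap_right.swap
          hx.swap
        exact (h a).concircular hza hab (Concircular.swap_right hz) h2.swap
    by_cases hza : z = a
    · exact key z hz p hp hzp.symm (fun hpa => hzp (hza.trans hpa.symm)) x hx.swap
    · exact key p hp z hz hzp hza x hx
  obtain ⟨d, hd, hω⟩ := exists_metric hP q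
  obtain ⟨σ, hσ, hωσ⟩ := exists_circle_mem hP hE hI q
  have hprop := properSpace_pt hd hω
  obtain ⟨I, hIk⟩ := exists_inversions hI hd hω hσ hωσ hP
  set B' : Set (Pt d) := Pt.val ⁻¹' B with hB'
  have himg : Pt.val '' B' = B := by
    refine image_preimage_eq_of_subset ?_
    rw [Pt.range_val hω, subset_compl_singleton_iff]
    exact hq
  have hB'c : IsCompact B' := by
    rw [(isOpenEmbedding_val hd hω).isInducing.isCompact_iff, himg]
    exact hBclosed.isCompact
  obtain ⟨a', ha', ha'v⟩ := himg.symm ▸ haB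
  obtain ⟨b', hb', hb'v⟩ := himg.symm ▸ hbB
  obtain ⟨p, hp, z, hz, hzp, c, hc, hc0, t, htp, ht⟩ := I.exists_inv_notMem hB'c
    ⟨a', ha', b', hb', fun h' => hab (by rw [← ha'v, ← hb'v, h'])⟩
  obtain ⟨k, hk, hkω, hkv⟩ := hIk p 1 one_pos
  apply ht
  rw [hB', mem_preimage, hkv _ htp]
  -- The map k carries the line c with q added to a circle through p = k q, z = k (c 0) and the
  -- point in question.
  refine hsub p.val hp z.val hz (fun h' => hzp (Pt.ext h')) _ ?_
  have hzk : z.val = k (c 0).val := by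
    rw [hc0, ← hkv _ (I.inv_ne one_pos hzp), I.inv_inv one_pos hzp]
  rw [hzk, ← hkω]
  exact Concircular.map hP hk ((concircular_iff hd hω hσ hωσ).2 ⟨c, hc, rfl, t, rfl⟩)

/-- The set F_x is defined by lines through x only, but parallels through x make it see all Busemann
functions. Points that these do not separate thus have the same F and lie in one fibre, so they are
equal. -/
theorem isIntegrable_of_fibre (h : ∀ ω : X, ∀ b ∈ base ω, ∃ x : X, fibre ω b = {x}) (ω : X) :
    IsIntegrable ω := by
  obtain ⟨d, hd, hω⟩ := exists_metric hP ω
  obtain ⟨σ, hσ, hωσ⟩ := exists_circle_mem hP hE hI ω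
  have hprop := properSpace_pt hd hω
  obtain ⟨I, -⟩ := exists_inversions hI hd hω hσ hωσ hP
  have hsub : ∀ x y : Pt d, (∀ c : ℝ → Pt d, Isometry c → bus c x = bus c y) →
      horoIntersection ω x.val ⊆ horoIntersection ω y.val := by
    rintro x y hxy w ⟨hw, hw'⟩
    refine ⟨hw, fun d' hd' hω' l _ _ b hb => ?_⟩
    obtain ⟨c, hc, -, a, hba⟩ := hb.exists_isometry hd hω hd' hω'
    obtain ⟨c', hc', hc'0, hc'b⟩ := I.exists_parallel hc x
    obtain ⟨b', hb', hb'v⟩ := exists_isBusemannFunction hc'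
    obtain ⟨w, rfl⟩ := Pt.exists_val_eq hω hw
    have h1 := hw' d hd hω _ (isPtolemyLine_range hd hω hσ hωσ hc') ⟨0, congrArg Pt.val hc'0⟩ b' hb'
    rw [hb'v, hb'v, hc'b, hc'b, sub_left_inj, hxy c hc] at h1
    rw [hba, hba, h1]
  have hsep : ∀ x y : Pt d, (∀ c : ℝ → Pt d, Isometry c → bus c x = bus c y) → x = y := by
    intro x y hxy
    have h1 : horoIntersection ω x.val = horoIntersection ω y.val :=
      (hsub x y hxy).antisymm (hsub y x fun c hc => (hxy c hc).symm)
    obtain ⟨z, hz⟩ := h ω _ ⟨y.val, Pt.val_ne hω y, rfl⟩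
    have hx : x.val ∈ fibre ω (horoIntersection ω y.val) := ⟨Pt.val_ne hω x, h1⟩
    have hy : y.val ∈ fibre ω (horoIntersection ω y.val) := ⟨Pt.val_ne hω y, rfl⟩
    rw [hz, mem_singleton_iff] at hx hy
    exact Pt.ext (hx.trans hy.symm)
  have hall : ∀ o x, o ≠ ω → x ≠ ω → Concircular ω o x := by
    intro o x ho hx
    obtain ⟨o, rfl⟩ := Pt.exists_val_eq hω ho
    obtain ⟨x, rfl⟩ := Pt.exists_val_eq hω hx
    exact (concircular_iff hd hω hσ hωσ).2 (I.exists_line_of_separate hsep o x)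
  intro o ho o' ho'
  have ho'ω := (mem_distributionAt.1 ho').2.1
  ext x
  rw [mem_distributionAt, mem_distributionAt]
  exact ⟨fun hx => ⟨ho'ω, hx.2.1, hall _ _ ho'ω hx.2.1⟩, fun hx => ⟨ho, hx.2.1, hall _ _ ho hx.2.1⟩⟩

/-- A Busemann function is injective on its own line, and some line passes through x and any other
point of the fibre. -/
theorem fibre_eq_singleton (hall : ∀ a b q : X, b ≠ a → Concircular a b q) {ω x : X}
    (hx : x ≠ ω) : fibre ω (horoIntersection ω x) = {x} := by
  obtain ⟨d, hd, hω⟩ := exists_metric hP ω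
  obtain ⟨σ, hσ, hωσ⟩ := exists_circle_mem hP hE hI ω
  ext y
  rw [mem_singleton_iff]
  refine ⟨?_, fun h => ⟨by rwa [h], by rw [h]⟩⟩
  rintro ⟨hy, hxy⟩
  have h1 : y ∈ horoIntersection ω x := hxy ▸ ⟨hy, fun _ _ _ _ _ _ _ _ => rfl⟩
  obtain ⟨x, rfl⟩ := Pt.exists_val_eq hω hx
  obtain ⟨y, rfl⟩ := Pt.exists_val_eq hω hy
  obtain ⟨c, hc, rfl, t, rfl⟩ := (concircular_iff hd hω hσ hωσ).1 (hall ω x.val y.val hx)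
  obtain ⟨b, hb, hbv⟩ := exists_isBusemannFunction hc
  have h2 := h1.2 d hd hω _ (isPtolemyLine_range hd hω hσ hωσ hc) ⟨0, rfl⟩ b hb
  rw [hbv, hbv, bus_line hc, bus_line hc, neg_inj] at h2
  rw [h2]

theorem exists_dim_mobiusEquivalent (hall : ∀ a b q : X, b ≠ a → Concircular a b q) (ω : X) :
    ∃ n : ℕ, HasCoveringDim X n ∧ MobiusEquivalent X (ExtendedEuclideanSpace n) := by
  obtain ⟨d, hd, hω⟩ := exists_metric hP ω
  obtain ⟨σ, hσ, hωσ⟩ := exists_circle_mem hP hE hI ω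
  have hprop := properSpace_pt hd hω
  obtain ⟨I, -⟩ := exists_inversions hI hd hω hσ hωσ hP
  obtain ⟨n, ⟨e⟩⟩ := I.exists_isometryEquiv_euclideanSpace fun x y =>
    (concircular_iff hd hω hσ hωσ).1 (hall ω x.val y.val (Pt.val_ne hω x))
  exact ⟨n, hasCoveringDim_of_isometryEquiv hd hω e, mobiusEquivalent_of_isometryEquiv hd hω e⟩

end Main

end Moebius

theorem proposition5p7 (X : Type*) [Moebius.MobiusSpace X] [CompactSpace X]
    (hP : Moebius.IsPtolemySpace X) (hE : Moebius.PropertyE X) (hI : Moebius.PropertyI X) :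
    ((∃ ω : X, Moebius.IsIntegrable ω) ↔
      ∀ ω : X, ∀ b ∈ Moebius.base ω, ∃ x : X, Moebius.fibre ω b = {x}) ∧
    ((∃ ω : X, Moebius.IsIntegrable ω) →
      ∃ n : ℕ, Moebius.HasCoveringDim X n ∧
        Moebius.MobiusEquivalent X (Moebius.ExtendedEuclideanSpace n)) := by
  have hall : (∃ ω : X, Moebius.IsIntegrable ω) →
      ∀ a b q : X, b ≠ a → Moebius.Concircular a b q := fun ⟨ω, h⟩ _ _ q hab =>
    Moebius.concircular_of_isIntegrable hP hE hI (h.all hP hE hI) hab q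
  refine ⟨⟨fun h ω b hb => ?_, fun h => ?_⟩, fun h => ?_⟩
  · obtain ⟨x, hx, rfl⟩ := hb
    exact ⟨x, Moebius.fibre_eq_singleton hP hE hI (hall h) hx⟩
  · have := Moebius.infinite_of_propertyE hP hE
    obtain ⟨ω⟩ : Nonempty X := inferInstance
    exact ⟨ω, Moebius.isIntegrable_of_fibre hP hE hI h ω⟩
  · obtain ⟨ω, -⟩ := id h
    exact Moebius.exists_dim_mobiusEquivalent hP hE hI (hall h) ω
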